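/- Let $n\ge 2$, let $F_n$ be the free group on $s_1,\dots,s_n$, let $\mathrm{Out}(F_n)=\mathrm{Aut}(F_n)/\mathrm{Inn}(F_n)$, and let $R_n$ be the rose with one vertex and oriented edges $e_1,\dots,e_n$. A rank $n$ marked graph $(G,\rho)$ is a finite connected graph $G$ of rank $n$, all of whose vertices have valence at least $3$, with a homotopy equivalence $\rho\colon R_n\to G$. A map $f\colon G\to G'$ between marked graphs $(G,\rho)$, $(G',\rho')$ preserves marking if $f\circ\rho$ is homotopic to $\rho'$; marked graphs are equivalent if there is a marking preserving homeomorphism between them. The cells of the outer space $\mathcal X_n$ correspond to the equivalence classes of marked graphs. The cell of $G'$ is a face of the cell of $G$ if there is a forest collapse $G\to G'$, i.e. a marking preserving homotopy equivalence $q\colon G\to G'$ such that, for some subforest $K\subset G$ (a union of closed edges), each $q^{-1}(x)$ is either a single point of $G-K$ or a component of $K$. The spine $\mathcal K_n$ of $\mathcal X_n$ is the simplicial complex with one vertex for each cell (its barycenter) and one simplex for each nonempty finite chain of cells under the face relation. The group $\mathrm{Out}(F_n)$ acts on $\mathcal K_n$ from the right by simplicial automorphisms: the class of $\Phi\in\mathrm{Aut}(F_n)$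 takes the vertex of $(G,\rho)$ to the vertex of $(G,\rho\circ f_\Phi)$, where $f_\Phi\colon R_n\to R_n$ maps $e_i$ to the edge path spelled by the reduced word $\Phi(s_i)$. For points $x,y\in\mathcal K_n$ let $d(x,y)$ be the infimum of the lengths of piecewise linear paths from $x$ to $y$, i.e. of finite concatenations of segments each contained in a simplex, where each simplex carries the metric of a regular Euclidean simplex with edges of length $1$. Then: 1. $d$ is a metric on $\mathcal K_n$ (in particular it is finite), and the action of $\mathrm{Out}(F_n)$ on $(\mathcal K_n,d)$ is geometric: it is an action by isometries; closed balls of $\mathcal K_n$ are compact; any $x,y\in\mathcal K_n$ are joined by an isometrically embedded interval of length $d(x,y)$; for any compact $A,B\subset\mathcal K_n$ the set $\{\phi\in\mathrm{Out}(F_n) : A\cdot\phi\cap B\neq\emptyset\}$ is finite; and there is a compact $D\subset\mathcal K_n$ with $D\cdot\mathrm{Out}(F_n)=\mathcal K_n$. 2. $\mathrm{Out}(F_n)$ is finitely generated. -/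

import Mathlib

open scoped unitInterval

noncomputable section

namespace OuterSpace

/-! ### Outer automorphisms of the free group -/

instance innNormal (G : Type*) [Group G] : (MulAut.conj (G := G)).range.Normal where
  conj_mem := by
    rintro _ ⟨g, rfl⟩ f
    refine ⟨f g, ?_⟩
    ext x
    simp [MulAut.conj_apply]

/-- `Out(F_n) = Aut(F_n) / Inn(F_n)`, where `F_n` is free on `s_1, …, s_n`. -/
abbrev OutFree (n : ℕ) : Type :=
  MulAut (FreeGroup (Fin n)) ⧸ (MulAut.conj (G := FreeGroup (Fin n))).range

/-! ### Finite graphs and their underlying spaces -/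

/-- A finite graph: a finite set `V` of vertices, a finite set `D` of oriented edges, the
orientation reversal `bar` (a fixed point free involution) and the initial vertex `init` of each
oriented edge.  Loops and multiple edges are allowed. -/
structure FinGraph where
  V : Type
  D : Type
  [fintypeV : Fintype V]
  [fintypeD : Fintype D]
  init : D → V
  bar : D → D
  bar_bar : ∀ d, bar (bar d) = d
  bar_ne : ∀ d, bar d ≠ d

attribute [instance] FinGraph.fintypeV FinGraph.fintypeD

namespace FinGraph

/-- The terminal vertex of an oriented edge. -/
def term (G : FinGraph) (d : G.D) : G.V := G.init (G.bar d)

/-- The disjoint union of the (discrete) vertex set and of one interval `[0,1]` for each oriented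
edge. -/
abbrev Pre (G : FinGraph) : Type := (Σ _ : G.V, Unit) ⊕ (Σ _ : G.D, I)

/-- The identifications that turn `G.Pre` into a one-dimensional CW complex: the interval of `bar d`
is the reversed interval of `d`, and the initial point of the interval of `d` is the vertex
`init d`. -/
inductive Rel (G : FinGraph) : G.Pre → G.Pre → Prop
  | bar (d : G.D) (t : I) : Rel G (Sum.inr ⟨d, t⟩) (Sum.inr ⟨G.bar d, σ t⟩)
  | init (d : G.D) : Rel G (Sum.inr ⟨d, 0⟩) (Sum.inl ⟨G.init d, ()⟩)

/-- The topological graph underlying `G`, with the quotient topology. -/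
def Space (G : FinGraph) : Type := Quot G.Rel

instance (G : FinGraph) : TopologicalSpace G.Space :=
  inferInstanceAs (TopologicalSpace (Quot G.Rel))

variable (G : FinGraph)

/-- The vertex `v` as a point of the space of `G`. -/
def vert (v : G.V) : G.Space := Quot.mk _ (Sum.inl ⟨v, ()⟩)

/-- The point at time `t` on the oriented edge `d`. -/
def pt (d : G.D) (t : I) : G.Space := Quot.mk _ (Sum.inr ⟨d, t⟩)

theorem pt_zero (d : G.D) : G.pt d 0 = G.vert (G.init d) := Quot.sound (Rel.init d)

theorem pt_bar (d : G.D) (t : I) : G.pt (G.bar d) t = G.pt d (σ t) := by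
  have h := Quot.sound (Rel.bar (G := G) d (σ t))
  rw [unitInterval.symm_symm] at h
  exact h.symm

theorem pt_one (d : G.D) : G.pt d 1 = G.vert (G.term d) := by
  have h := G.pt_bar d 0
  rw [unitInterval.symm_zero] at h
  rw [← h, pt_zero]
  rfl

theorem continuous_pt (d : G.D) : Continuous (G.pt d) := by
  unfold pt
  exact continuous_quot_mk.comp (continuous_inr.comp continuous_sigmaMk)

/-- The oriented edge `d` as a path. -/
def edgePath (d : G.D) : Path (G.vert (G.init d)) (G.vert (G.term d)) where
  toFun := G.pt d
  continuous_toFun := G.continuous_pt d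
  source' := G.pt_zero d
  target' := G.pt_one d

/-- The valence of a vertex. -/
def valence (v : G.V) : ℕ := Nat.card {d : G.D // G.init d = v}

/-- The subgraph that is the union of the closed edges of a set `S` of oriented edges. -/
def edgeUnion (S : Set G.D) : Set G.Space := {x | ∃ d ∈ S, ∃ t, x = G.pt d t}

/-- A set `S` of edges (closed under orientation reversal) is a forest if it contains no circuit,
i.e. no cyclically reduced closed edge path `c 0, c 1, …, c (k-1), c k = c 0, …` with `k > 0`. -/
def IsForest (S : Set G.D) : Prop :=
  (∀ d ∈ S, G.bar d ∈ S) ∧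
  ¬ ∃ (k : ℕ) (c : ℕ → G.D), 0 < k ∧ (∀ i, c (i + k) = c i) ∧ (∀ i, c i ∈ S) ∧
      ∀ i, G.init (c (i + 1)) = G.term (c i) ∧ c (i + 1) ≠ G.bar (c i)

end FinGraph

/-! ### The rose and its maps -/

/-- The base rose `R_n`: one vertex and `n` oriented edges `e_i = (i, true)`, with reversals
`(i, false)`. -/
def roseGraph (n : ℕ) : FinGraph where
  V := Unit
  D := Fin n × Bool
  init := fun _ => ()
  bar := fun d => (d.1, !d.2)
  bar_bar := by rintro ⟨i, b⟩; simp
  bar_ne := by rintro ⟨i, b⟩; simp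

/-- The space of the base rose. -/
abbrev Rose (n : ℕ) : Type := (roseGraph n).Space

/-- The vertex of the base rose. -/
def roseBase (n : ℕ) : Rose n := (roseGraph n).vert ()

/-- The loop `e_i` of the base rose. -/
def roseLoop (n : ℕ) (i : Fin n) : Path (roseBase n) (roseBase n) :=
  (roseGraph n).edgePath (i, true)

section RoseMaps

set_option linter.unusedSectionVars false

variable {X Y : Type*} [TopologicalSpace X] [TopologicalSpace Y] {n : ℕ}

/-- The map from the rose that sends the vertex to `x` and the loop `e_i` to the loop `p i`. -/
def roseMap {x : X} (p : Fin n → Path x x) : C(Rose n, X) where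
  toFun := Quot.lift
    (fun z => match z with
      | Sum.inl _ => x
      | Sum.inr ⟨(i, b), t⟩ => if b then p i t else p i (σ t))
    (by
      rintro _ _ (⟨⟨i, b⟩, t⟩ | ⟨i, b⟩)
      · cases b <;> simp [roseGraph]
      · cases b <;> simp)
  continuous_toFun := by
    refine continuous_quot_lift _ ?_
    refine continuous_sum_dom.2 ⟨continuous_const, continuous_sigma ?_⟩
    rintro ⟨i, b⟩
    cases b
    · exact (p i).continuous.comp unitInterval.continuous_symm
    · exact (p i).continuous

theorem roseMap_base {x : X} (p : Fin n → Path x x) : roseMap p (roseBase n) = x := rfl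

theorem roseMap_loop {x : X} (p : Fin n → Path x x) (i : Fin n) (t : I) :
    roseMap p (roseLoop n i t) = p i t := rfl

theorem rose_hom_ext {f g : Rose n → X} (hb : f (roseBase n) = g (roseBase n))
    (hl : ∀ i t, f (roseLoop n i t) = g (roseLoop n i t)) : f = g := by
  funext z
  induction z using Quot.ind with
  | mk z =>
    rcases z with ⟨⟨⟩, ⟨⟩⟩ | ⟨⟨i, b⟩, t⟩
    · exact hb
    · cases b
      · have h := (roseGraph n).pt_bar (i, true) t
        have h2 : (Quot.mk (roseGraph n).Rel (Sum.inr ⟨(i, false), t⟩) : Rose n)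
            = roseLoop n i (σ t) := h
        rw [h2]
        exact hl i _
      · exact hl i t

/-- The concatenation of loops spelled by a word in the letters `(i, true) = s_i`,
`(i, false) = s_i⁻¹`, where `s_i` is replaced by the loop `p i` and `s_i⁻¹` by its reversal. -/
def wordLoop {x : X} (p : Fin n → Path x x) : List (Fin n × Bool) → Path x x
  | [] => Path.refl x
  | (i, b) :: w => (if b then p i else (p i).symm).trans (wordLoop p w)

theorem wordLoop_map {x : X} (p : Fin n → Path x x) (f : C(X, Y)) (w : List (Fin n × Bool)) :
    (wordLoop p w).map f.continuous = wordLoop (fun i => (p i).map f.continuous) w := by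
  induction w with
  | nil => rfl
  | cons a w ih =>
    obtain ⟨i, b⟩ := a
    cases b <;> simp [wordLoop, Path.map_trans, ih, Path.map_symm]

/-- The homomorphism from the free group to the loop classes (multiplied in the order of
concatenation) that sends `s_i` to the class of `p i`. -/
def loopHom {x : X} (p : Fin n → Path x x) : FreeGroup (Fin n) →* (FundamentalGroup X x)ᵐᵒᵖ :=
  FreeGroup.lift (fun i => MulOpposite.op (Path.Homotopic.Quotient.mk (p i)))

theorem loopHom_mk {x : X} (p : Fin n → Path x x) (w : List (Fin n × Bool)) :
    loopHom p (FreeGroup.mk w) = MulOpposite.op (Path.Homotopic.Quotient.mk (wordLoop p w)) := by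
  induction w with
  | nil => rfl
  | cons a w ih =>
    have h : FreeGroup.mk (a :: w) = FreeGroup.mk [a] * FreeGroup.mk w := by
      rw [FreeGroup.mul_mk]; rfl
    rw [h, map_mul, ih]
    obtain ⟨i, b⟩ := a
    cases b
    · simp only [loopHom, FreeGroup.lift_mk, wordLoop, List.map_cons, List.map_nil,
        List.prod_cons, List.prod_nil, mul_one, cond_false]
      rfl
    · simp only [loopHom, FreeGroup.lift_mk, wordLoop, List.map_cons, List.map_nil,
        List.prod_cons, List.prod_nil, mul_one, cond_true]
      rfl

theorem loopHom_apply {x : X} (p : Fin n → Path x x) (g : FreeGroup (Fin n)) :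
    loopHom p g = MulOpposite.op (Path.Homotopic.Quotient.mk (wordLoop p g.toWord)) := by
  rw [← loopHom_mk, FreeGroup.mk_toWord]

/-- Two maps from the rose are homotopic as soon as the loops move through a family of loops. -/
theorem roseMap_homotopic_of_family {x : X} {p p' : Fin n → Path x x} (γ : C(I, X))
    (H : Fin n → C(I × I, X)) (hγ0 : γ 0 = x) (hγ1 : γ 1 = x)
    (h0 : ∀ i s, H i (0, s) = γ s) (h1 : ∀ i s, H i (1, s) = γ s)
    (hp : ∀ i t, H i (t, 0) = p i t) (hp' : ∀ i t, H i (t, 1) = p' i t) :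
    (roseMap p).Homotopic (roseMap p') := by
  let q : Fin n → Path γ γ := fun i =>
    { toFun := fun t => (H i).curry t
      continuous_toFun := (H i).curry.continuous
      source' := by ext s; exact h0 i s
      target' := by ext s; exact h1 i s }
  let F : C(Rose n, C(I, X)) := roseMap q
  refine ⟨⟨⟨fun z => F z.2 z.1, ?_⟩, ?_, ?_⟩⟩
  · exact continuous_eval.comp ((F.continuous.comp continuous_snd).prodMk continuous_fst)
  · intro z
    refine congrFun (rose_hom_ext (f := fun z => F z 0) (g := roseMap p) ?_ ?_) z
    · exact hγ0
    · exact fun i t => hp i t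
  · intro z
    refine congrFun (rose_hom_ext (f := fun z => F z 1) (g := roseMap p') ?_ ?_) z
    · exact hγ1
    · exact fun i t => hp' i t

theorem roseMap_homotopic {x : X} {p p' : Fin n → Path x x} (h : ∀ i, (p i).Homotopic (p' i)) :
    (roseMap p).Homotopic (roseMap p') := by
  refine roseMap_homotopic_of_family (ContinuousMap.const _ x)
    (fun i => (h i).some.toContinuousMap.comp ⟨Prod.swap, continuous_swap⟩) rfl rfl ?_ ?_ ?_ ?_
  · intro i s; exact (h i).some.source s
  · intro i s; exact (h i).some.target s
  · intro i t; exact (h i).some.apply_zero t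
  · intro i t; exact (h i).some.apply_one t

theorem roseMap_homotopic_of_loopHom {x : X} {p p' : Fin n → Path x x}
    (h : loopHom p = loopHom p') : (roseMap p).Homotopic (roseMap p') := by
  refine roseMap_homotopic fun i => ?_
  have h2 := DFunLike.congr_fun h (FreeGroup.of i)
  simp only [loopHom, FreeGroup.lift_apply_of] at h2
  exact Path.Homotopic.Quotient.exact (MulOpposite.op_injective h2)

theorem roseMap_conj_homotopic {x : X} (p : Fin n → Path x x) (γ : Path x x) :
    (roseMap fun i => (γ.trans (p i)).trans γ.symm).Homotopic (roseMap p) := by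
  let δ : (s : I) → Path (γ s) x := fun s =>
    { toFun := fun t => γ (s ⊔ t)
      continuous_toFun := by fun_prop
      source' := congrArg γ (sup_eq_left.2 unitInterval.nonneg')
      target' := (congrArg γ (sup_eq_right.2 unitInterval.le_one')).trans γ.target }
  have hδ : Continuous ↿δ := by
    change Continuous fun z : I × I => γ (z.1 ⊔ z.2)
    fun_prop
  have hδs : Continuous ↿(fun s => (δ s).symm) := by
    change Continuous fun z : I × I => γ (z.1 ⊔ σ z.2)
    fun_prop
  have hc (i : Fin n) : Continuous ↿(fun s => ((δ s).trans (p i)).trans (δ s).symm) := by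
    have h1 : Continuous ↿(fun _ : I => p i) := (p i).continuous.comp continuous_snd
    have h2 := Path.trans_continuous_family δ hδ (fun _ => p i) h1
    exact Path.trans_continuous_family _ h2 _ hδs
  have hδ0 (t : I) : δ 0 t = γ t := congrArg γ (sup_eq_right.2 unitInterval.nonneg')
  have hδ1 (t : I) : δ 1 t = x :=
    (congrArg γ (sup_eq_left.2 unitInterval.le_one')).trans γ.target
  clear_value δ
  have step : (roseMap fun i => (γ.trans (p i)).trans γ.symm).Homotopic
      (roseMap fun i => ((Path.refl x).trans (p i)).trans (Path.refl x).symm) := by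
    let H : Fin n → C(I × I, X) := fun i =>
      ⟨fun z => ((δ z.2).trans (p i)).trans (δ z.2).symm z.1,
        (hc i).comp (continuous_snd.prodMk continuous_fst)⟩
    have hH (i : Fin n) (t s : I) : H i (t, s) = ((δ s).trans (p i)).trans (δ s).symm t := rfl
    clear_value H
    refine roseMap_homotopic_of_family γ.toContinuousMap H γ.source γ.target ?_ ?_ ?_ ?_
    · intro i s
      rw [hH]
      exact (((δ s).trans (p i)).trans (δ s).symm).source
    · intro i s
      rw [hH]
      exact (((δ s).trans (p i)).trans (δ s).symm).target
    · intro i t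
      rw [hH]
      simp only [Path.trans_apply, Path.symm_apply, Function.comp_apply, hδ0]
    · intro i t
      rw [hH]
      simp only [Path.trans_apply, Path.symm_apply, Function.comp_apply, hδ1, Path.refl_apply]
  refine step.trans (roseMap_homotopic fun i => ?_)
  exact (Path.Homotopic.trans_refl _).trans (Path.Homotopic.refl_trans _)

end RoseMaps

/-- The map `f_Φ : R_n → R_n` of an automorphism `Φ`: the loop `e_i` goes to the edge path that is
spelled by the reduced word `Φ(s_i)`. -/
def autMap {n : ℕ} (Φ : MulAut (FreeGroup (Fin n))) : C(Rose n, Rose n) :=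
  roseMap fun i => wordLoop (roseLoop n) (Φ (FreeGroup.of i)).toWord

theorem loopHom_autMap {n : ℕ} (Φ : MulAut (FreeGroup (Fin n))) :
    loopHom (fun i => wordLoop (roseLoop n) (Φ (FreeGroup.of i)).toWord)
      = (loopHom (roseLoop n)).comp Φ.toMonoidHom := by
  ext i
  change loopHom _ (FreeGroup.of i) = loopHom (roseLoop n) (Φ (FreeGroup.of i))
  rw [loopHom_apply (roseLoop n)]
  simp [loopHom]

theorem autMap_comp {n : ℕ} (Φ Ψ : MulAut (FreeGroup (Fin n))) :
    ((autMap Φ).comp (autMap Ψ)).Homotopic (autMap (Φ * Ψ)) := by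
  let p : Fin n → Path (roseBase n) (roseBase n) :=
    fun i => wordLoop (roseLoop n) (Φ (FreeGroup.of i)).toWord
  have h1 : (autMap Φ).comp (autMap Ψ)
      = roseMap (x := roseBase n) fun i => wordLoop p (Ψ (FreeGroup.of i)).toWord := by
    refine ContinuousMap.coe_injective (rose_hom_ext rfl fun i t => ?_)
    change autMap Φ (wordLoop (roseLoop n) (Ψ (FreeGroup.of i)).toWord t)
      = wordLoop p (Ψ (FreeGroup.of i)).toWord t
    exact congrArg (fun q : Path (roseBase n) (roseBase n) => q t)
      (wordLoop_map (roseLoop n) (autMap Φ) (Ψ (FreeGroup.of i)).toWord)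
  rw [h1]
  refine roseMap_homotopic_of_loopHom ?_
  rw [loopHom_autMap]
  ext i
  have h2 : loopHom (fun i => wordLoop p (Ψ (FreeGroup.of i)).toWord) (FreeGroup.of i)
      = loopHom p (Ψ (FreeGroup.of i)) := by
    rw [loopHom_apply p]; simp [loopHom]
  refine h2.trans ?_
  have h3 : loopHom p = (loopHom (roseLoop n)).comp Φ.toMonoidHom := loopHom_autMap Φ
  rw [h3]
  rfl

theorem autMap_one {n : ℕ} :
    (autMap (1 : MulAut (FreeGroup (Fin n)))).Homotopic (ContinuousMap.id _) := by
  have h1 : ContinuousMap.id (Rose n) = roseMap (roseLoop n) :=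
    ContinuousMap.coe_injective (rose_hom_ext rfl fun i t => rfl)
  rw [h1]
  refine roseMap_homotopic_of_loopHom ?_
  rw [loopHom_autMap]
  ext i
  rfl

theorem autMap_conj {n : ℕ} (Φ : MulAut (FreeGroup (Fin n))) (g : FreeGroup (Fin n)) :
    (autMap (Φ * MulAut.conj g)).Homotopic (autMap Φ) := by
  refine ContinuousMap.Homotopic.trans ?_
    (roseMap_conj_homotopic _ (wordLoop (roseLoop n) (Φ g).toWord))
  refine roseMap_homotopic_of_loopHom ?_
  rw [loopHom_autMap]
  ext i
  change loopHom (roseLoop n) (Φ (g * FreeGroup.of i * g⁻¹)) = _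
  rw [map_mul, map_mul, map_inv, map_mul, map_mul, map_inv, loopHom_apply, loopHom_apply]
  simp only [loopHom, FreeGroup.lift_apply_of]
  rfl

/-- The homotopy equivalence `f_Φ` of the base rose. -/
def autEquiv {n : ℕ} (Φ : MulAut (FreeGroup (Fin n))) :
    ContinuousMap.HomotopyEquiv (Rose n) (Rose n) where
  toFun := autMap Φ
  invFun := autMap Φ⁻¹
  left_inv := (autMap_comp _ _).trans (by rw [inv_mul_cancel]; exact autMap_one)
  right_inv := (autMap_comp _ _).trans (by rw [mul_inv_cancel]; exact autMap_one)

/-! ### Marked graphs -/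

/-- A rank `n` marked graph (for `n ≥ 2`): a finite connected core graph of rank `n` with its
natural cell structure (so that every vertex has valence at least `3`), together with a homotopy
equivalence from the base rose.  The rank condition is `n = 1 - #vertices + #edges`, where
`#D = 2 #edges`. -/
structure MarkedGraph (n : ℕ) where
  graph : FinGraph
  connected : ConnectedSpace graph.Space
  valence_ge : ∀ v, 3 ≤ graph.valence v
  rank_eq : Fintype.card graph.D + 2 = 2 * Fintype.card graph.V + 2 * n
  marking : ContinuousMap.HomotopyEquiv (Rose n) graph.Space

namespace MarkedGraph

variable {n : ℕ}

/-- A map between marked graphs preserves marking. -/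
def PreservesMarking (M N : MarkedGraph n) (f : C(M.graph.Space, N.graph.Space)) : Prop :=
  (f.comp M.marking.toFun).Homotopic N.marking.toFun

/-- Two marked graphs are equivalent if some homeomorphism preserves marking. -/
def Equivalent (M N : MarkedGraph n) : Prop :=
  ∃ h : M.graph.Space ≃ₜ N.graph.Space, PreservesMarking M N (h : C(M.graph.Space, N.graph.Space))

theorem PreservesMarking.comp {M N P : MarkedGraph n} {f : C(M.graph.Space, N.graph.Space)}
    {g : C(N.graph.Space, P.graph.Space)} (hf : PreservesMarking M N f)
    (hg : PreservesMarking N P g) : PreservesMarking M P (g.comp f) := by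
  unfold PreservesMarking at *
  rw [ContinuousMap.comp_assoc]
  exact ((ContinuousMap.Homotopic.refl g).comp hf).trans hg

instance setoid (n : ℕ) : Setoid (MarkedGraph n) where
  r := Equivalent
  iseqv :=
    { refl := fun M => ⟨Homeomorph.refl _, ContinuousMap.Homotopic.refl _⟩
      symm := by
        rintro M N ⟨h, hh⟩
        refine ⟨h.symm, ?_⟩
        have h2 := (ContinuousMap.Homotopic.refl (h.symm : C(N.graph.Space, M.graph.Space))).comp
          hh.symm
        rw [← ContinuousMap.comp_assoc] at h2
        have h3 : (h.symm : C(N.graph.Space, M.graph.Space)).comp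
            (h : C(M.graph.Space, N.graph.Space)) = ContinuousMap.id _ := by
          ext x; simp
        rw [h3] at h2
        exact h2
      trans := by
        rintro M N P ⟨h, hh⟩ ⟨k, hk⟩
        exact ⟨h.trans k, hh.comp hk⟩ }

/-- `M` collapses to `N`: there is a forest collapse `q`, i.e. a homotopy equivalence that preserves
marking and such that, for some subforest `K` (the union of the closed edges in `S`), each preimage
of a point is a single point outside `K` or a component of `K`.  Homeomorphisms are included,
through the empty forest. -/
def CollapsesTo (M N : MarkedGraph n) : Prop :=
  ∃ q : C(M.graph.Space, N.graph.Space),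
    (∃ e : ContinuousMap.HomotopyEquiv M.graph.Space N.graph.Space, e.toFun = q) ∧
    PreservesMarking M N q ∧
    ∃ S : Set M.graph.D, M.graph.IsForest S ∧
      ∀ y : N.graph.Space,
        (∃ x ∉ M.graph.edgeUnion S, q ⁻¹' {y} = {x}) ∨
        (∃ x ∈ M.graph.edgeUnion S,
          q ⁻¹' {y} = connectedComponentIn (M.graph.edgeUnion S) x)

/-- The marked graph `(G, ρ ∘ f_Φ)`. -/
def twist (M : MarkedGraph n) (Φ : MulAut (FreeGroup (Fin n))) : MarkedGraph n :=
  { M with marking := (autEquiv Φ).trans M.marking }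

theorem PreservesMarking.twist {M N : MarkedGraph n} {f : C(M.graph.Space, N.graph.Space)}
    (h : PreservesMarking M N f) (Φ : MulAut (FreeGroup (Fin n))) :
    PreservesMarking (M.twist Φ) (N.twist Φ) f :=
  ContinuousMap.Homotopic.comp h (ContinuousMap.Homotopic.refl (autMap Φ))

theorem equivalent_of_homotopic {M : MarkedGraph n} {Φ : MulAut (FreeGroup (Fin n))}
    {Ψ : MulAut (FreeGroup (Fin n))} (h : (autMap Φ).Homotopic (autMap Ψ)) :
    Equivalent (M.twist Φ) (M.twist Ψ) :=
  ⟨Homeomorph.refl _, (ContinuousMap.Homotopic.refl M.marking.toFun).comp h⟩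

end MarkedGraph

/-! ### The cells of outer space, with their face relation and the action of `Out(F_n)` -/

/-- The cells of the outer space of rank `n`: one for each equivalence class of marked graphs. -/
def Cell (n : ℕ) : Type 1 := Quotient (MarkedGraph.setoid n)

namespace Cell

variable {n : ℕ}

/-- The cell of a marked graph. -/
def mk (M : MarkedGraph n) : Cell n := Quotient.mk _ M

/-- `c` is a face of `c'`: some marked graph of the cell `c'` collapses to one of the cell `c`. -/
def IsFace (c c' : Cell n) : Prop :=
  ∃ M N : MarkedGraph n, mk M = c ∧ mk N = c' ∧ N.CollapsesTo M

/-- The right action of `Out(F_n)` on cells: the class of `Φ` takes the cell of `(G, ρ)` to the cell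
of `(G, ρ ∘ f_Φ)`. -/
def act (c : Cell n) (φ : OutFree n) : Cell n :=
  Quotient.liftOn₂ c φ (fun M Φ => mk (M.twist Φ)) (by
    rintro M Φ N Ψ ⟨h, hh⟩ hΦ
    refine Quotient.sound (Setoid.trans (b := N.twist Φ) ⟨h, hh.twist Φ⟩ ?_)
    obtain ⟨g, hg⟩ := QuotientGroup.leftRel_apply.1 hΦ
    refine MarkedGraph.equivalent_of_homotopic ?_
    have h2 : Ψ = Φ * MulAut.conj g := by rw [hg]; group
    rw [h2]
    exact (autMap_conj Φ g).symm)

theorem act_mk (M : MarkedGraph n) (Φ : MulAut (FreeGroup (Fin n))) :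
    (mk M).act (Φ : OutFree n) = mk (M.twist Φ) := rfl

/-- The right action, as a left action of the opposite group: `op φ • c = c · φ`. -/
instance : MulAction (OutFree n)ᵐᵒᵖ (Cell n) where
  smul φ c := c.act φ.unop
  one_smul c := by
    induction c using Quotient.ind with
    | _ M =>
      refine Quotient.sound ⟨Homeomorph.refl _, ?_⟩
      exact (ContinuousMap.Homotopic.refl M.marking.toFun).comp autMap_one
  mul_smul φ ψ c := by
    induction c using Quotient.ind with
    | _ M =>
      obtain ⟨φ⟩ := φ
      obtain ⟨ψ⟩ := ψ
      induction φ using QuotientGroup.induction_on with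
      | H Φ =>
        induction ψ using QuotientGroup.induction_on with
        | H Ψ =>
          refine Quotient.sound ⟨Homeomorph.refl _, ?_⟩
          exact (ContinuousMap.Homotopic.refl M.marking.toFun).comp (autMap_comp Ψ Φ).symm

theorem smul_mk (M : MarkedGraph n) (Φ : MulAut (FreeGroup (Fin n))) :
    MulOpposite.op (Φ : OutFree n) • mk M = mk (M.twist Φ) := rfl

theorem IsFace.smul {c c' : Cell n} (h : IsFace c c') (φ : (OutFree n)ᵐᵒᵖ) :
    IsFace (φ • c) (φ • c') := by
  obtain ⟨M, N, rfl, rfl, q, he, hq, hS⟩ := h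
  obtain ⟨φ⟩ := φ
  induction φ using QuotientGroup.induction_on with
  | H Φ => exact ⟨M.twist Φ, N.twist Φ, rfl, rfl, q, he, hq.twist Φ, hS⟩

end Cell

/-! ### The spine and its simplicial metric -/

/-- The spine `K_n` of outer space.  It is the union of the simplices of the barycentric subdivision
of the closed cells that are disjoint from the missing (nonconcrete) faces.  Its vertices are the
barycenters of the cells of outer space, and a finite set of cells spans a simplex if and only if it
is a chain for the face relation.  A point is given by its barycentric coordinates. -/
@[ext]
structure Spine (n : ℕ) : Type 1 where
  coord : Cell n →₀ ℝ
  nonneg : ∀ c, 0 ≤ coord c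
  sum_eq_one : coord.sum (fun _ t => t) = 1
  chain : IsChain Cell.IsFace (coord.support : Set (Cell n))

namespace Spine

variable {n : ℕ}

/-- The action of `Out(F_n)` on the spine: it permutes the vertices and is affine on each simplex. -/
instance : MulAction (OutFree n)ᵐᵒᵖ (Spine n) where
  smul φ x :=
    { coord := x.coord.equivMapDomain (MulAction.toPerm φ)
      nonneg := fun c => x.nonneg _
      sum_eq_one := by
        rw [Finsupp.sum_equivMapDomain]
        exact x.sum_eq_one
      chain := by
        intro c hc c' hc' hne
        have h (d : Cell n) (hd : d ∈ (x.coord.equivMapDomain (MulAction.toPerm φ)).support) :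
            φ⁻¹ • d ∈ (x.coord.support : Set (Cell n)) := by
          simpa using hd
        have h2 := x.chain (h c hc) (h c' hc') (fun h3 => hne (smul_left_cancel _ h3))
        refine h2.imp (fun h3 => ?_) (fun h3 => ?_)
        · simpa using h3.smul φ
        · simpa using h3.smul φ }
  one_smul x := by
    ext c
    change x.coord ((1 : (OutFree n)ᵐᵒᵖ)⁻¹ • c) = x.coord c
    simp
  mul_smul φ ψ x := by
    ext c
    change x.coord ((φ * ψ)⁻¹ • c) = x.coord (ψ⁻¹ • φ⁻¹ • c)
    rw [mul_inv_rev, mul_smul]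

theorem smul_coord (φ : (OutFree n)ᵐᵒᵖ) (x : Spine n) (c : Cell n) :
    (φ • x).coord (φ • c) = x.coord c := by
  change x.coord (φ⁻¹ • φ • c) = x.coord c
  simp

/-- Two points lie in a common (closed) simplex of the spine. -/
def InCommonSimplex (x y : Spine n) : Prop :=
  IsChain Cell.IsFace ((x.coord.support : Set (Cell n)) ∪ y.coord.support)

/-- The distance of two points in a common simplex, for the Euclidean metric in which the simplex is
regular with edges of length `1`. -/
def segLength (x y : Spine n) : ℝ :=
  Real.sqrt ((x.coord - y.coord).sum (fun _ t => t ^ 2) / 2)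

/-- The simplicial metric: the infimum of the lengths of the piecewise linear paths
`p 0 = x, p 1, …, p m = y` each of whose segments lies in a simplex (`∞` if there is no such
path). -/
def simplicialEDist (x y : Spine n) : ENNReal :=
  ⨅ (m : ℕ) (p : ℕ → Spine n) (_ : p 0 = x ∧ p m = y ∧ ∀ k < m, InCommonSimplex (p k) (p (k + 1))),
    ∑ k ∈ Finset.range m, ENNReal.ofReal (segLength (p k) (p (k + 1)))

end Spine

/-! ### Geometric actions -/

/-- Every two points are joined by an isometrically embedded interval. -/
def IsGeodesicSpace (X : Type*) [MetricSpace X] : Prop :=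
  ∀ x y : X, ∃ γ : ℝ → X, γ 0 = x ∧ γ (dist x y) = y ∧
    ∀ s ∈ Set.Icc 0 (dist x y), ∀ t ∈ Set.Icc 0 (dist x y), dist (γ s) (γ t) = |s - t|

/-- A geometric action: an action by isometries on a proper geodesic metric space that is proper
and cocompact. -/
structure IsGeometricAction (Γ X : Type*) [Group Γ] [MetricSpace X] [MulAction Γ X] : Prop where
  isometry : ∀ g : Γ, Isometry fun x : X => g • x
  properSpace : ProperSpace X
  geodesic : IsGeodesicSpace X
  proper : ∀ A B : Set X, IsCompact A → IsCompact B →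
    {g : Γ | (((fun x : X => g • x) '' A) ∩ B).Nonempty}.Finite
  cocompact : ∃ D : Set X, IsCompact D ∧ (⋃ g : Γ, (fun x : X => g • x) '' D) = Set.univ

end OuterSpace

end

/-! ### Graphs as Hausdorff spaces, and homotopies of maps out of them -/

noncomputable section

namespace OuterSpace

/-! ### Maps out of the space of a graph -/

namespace FinGraph

variable (G : FinGraph) {X : Type*} [TopologicalSpace X]

/-! The metric statements follow formally from finiteness and connectivity properties of the set of
cells with its face relation.

Finiteness. The valence condition leaves fewer than `6 * n` vertices and oriented edges (`card_lt`),
so only finitely many graphs occur. Two markings of one graph differ by a self homotopy equivalence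
of the rose, which comes from an automorphism (`exists_autMap`); hence there are finitely many
orbits of cells. Local finiteness rests on a rigidity of collapse maps: every open edge goes to a
point or into a single open edge. Indeed the map is an open embedding on an open edge outside the
forest, and a vertex of valence at least 3 has no neighbourhood that is an interval
(`not_mem_range_of_valence`). Up to sliding the images of vertices along edges, the image of an edge
is therefore an edge word of length at most 12, and only finitely many homotopy classes of collapse
maps join two given graphs (`HasData.homotopic`). Since homeomorphisms are collapse maps of the
empty forest, one count bounds faces, cofaces and transporters (`finite_faces`, `finite_cofaces`,
`finite_transporter`). For the last one, homotopic maps `autMap Φ`, `autMap Ψ` must have equal outer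
classes; this uses that the fundamental group of the rose is free, which the Cayley graph covering
shows.

Connectivity. Collapses of edges that are not loops join every marked graph to a rose with some
marking. A graph with two vertices that collapses to a rose in two ways joins the base rose to its
translate under a transvection, and signed permutations of the basis fix the cell of the base rose.
Nielsen reduction shows that these automorphisms generate the whole group
(`eq_top_of_transvection_mem`), so all cells are linked. They are finite in number, which is also
the proof of finite generation; the geometric action is not needed for it.

Metric. The Euclidean distance of barycentric coordinates makes sense for any two points and is at
most the length of every path between them (`PLPath.segLength_le`). So the path metric separates
points and is Euclidean on each simplex. Supports have bounded size, so points at small distance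
share a cell (`exists_common_cell`); along a path this propagates, and a ball involves only finitely
many cells. Balls are then compact, and geodesics are limits of almost shortest paths. Properness of
the action comes from finite transporters, cocompactness from the finitely many orbits. -/

theorem bar_injective : Function.Injective G.bar := fun d e h => by
  rw [← G.bar_bar d, h, G.bar_bar]

@[simp] theorem init_bar (d : G.D) : G.init (G.bar d) = G.term d := rfl

@[simp] theorem term_bar (d : G.D) : G.term (G.bar d) = G.init d := by
  rw [term, G.bar_bar]

/-- The map out of the space of a graph that is given on vertices and on oriented edges. -/
def lift (fv : G.V → X) (fd : G.D → C(I, X)) (hb : ∀ d t, fd (G.bar d) t = fd d (σ t))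
    (h0 : ∀ d, fd d 0 = fv (G.init d)) : C(G.Space, X) where
  toFun := Quot.lift (fun z => match z with
      | Sum.inl v => fv v.1
      | Sum.inr z => fd z.1 z.2) (by
    rintro _ _ (⟨d, t⟩ | d)
    · change fd d t = fd (G.bar d) (σ t)
      rw [hb, unitInterval.symm_symm]
    · exact h0 d)
  continuous_toFun := by
    refine continuous_quot_lift _ ?_
    refine continuous_sum_dom.2 ⟨continuous_sigma fun v => (continuous_const : Continuous fun _ : Unit => fv v),
      continuous_sigma fun d => (fd d).continuous⟩

@[simp] theorem lift_vert (fv : G.V → X) (fd : G.D → C(I, X)) (hb h0) (v : G.V) :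
    G.lift fv fd hb h0 (G.vert v) = fv v := rfl

@[simp] theorem lift_pt (fv : G.V → X) (fd : G.D → C(I, X)) (hb h0) (d : G.D) (t : I) :
    G.lift fv fd hb h0 (G.pt d t) = fd d t := rfl

theorem eq_vert_or_pt (x : G.Space) :
    (∃ v, x = G.vert v) ∨ ∃ d t, 0 < t ∧ t < 1 ∧ x = G.pt d t := by
  induction x using Quot.ind with
  | mk z =>
    rcases z with ⟨v, ⟨⟩⟩ | ⟨d, t⟩
    · exact Or.inl ⟨v, rfl⟩
    · change _ ∨ ∃ d' t', _ ∧ _ ∧ G.pt d t = _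
      change (∃ v, G.pt d t = _) ∨ _
      rcases eq_or_ne t 0 with rfl | h0
      · exact Or.inl ⟨_, G.pt_zero d⟩
      rcases eq_or_ne t 1 with rfl | h1
      · exact Or.inl ⟨_, G.pt_one d⟩
      · exact Or.inr ⟨d, t, unitInterval.pos_iff_ne_zero.2 h0, unitInterval.lt_one_iff_ne_one.2 h1,
          rfl⟩

theorem map_ext {Y : Type*} {f g : G.Space → Y} (hv : ∀ v, f (G.vert v) = g (G.vert v))
    (hd : ∀ d t, f (G.pt d t) = g (G.pt d t)) : f = g := by
  funext x
  rcases G.eq_vert_or_pt x with ⟨v, rfl⟩ | ⟨d, t, -, -, rfl⟩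
  · exact hv v
  · exact hd d t

instance : CompactSpace G.Space := inferInstanceAs (CompactSpace (Quot G.Rel))

open Classical in
/-- The function `t (1 - t)` on the edge `d`, extended by zero. -/
def bump (d : G.D) : C(G.Space, ℝ) :=
  G.lift (fun _ => 0)
    (fun e => if e = d ∨ e = G.bar d then ⟨fun t => (t : ℝ) * (1 - t), by fun_prop⟩ else 0)
    (by
      intro e t
      have : (G.bar e = d ∨ G.bar e = G.bar d) ↔ (e = d ∨ e = G.bar d) := by
        rw [G.bar_injective.eq_iff, or_comm, ← G.bar_injective.eq_iff (a := G.bar e), G.bar_bar]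
      simp only [this]
      split_ifs <;> simp [mul_comm])
    (by intro e; split_ifs <;> simp)

open Classical in
/-- The function `t ^ 2 (1 - t)` on the oriented edge `d`, extended by zero. -/
def skewBump (d : G.D) : C(G.Space, ℝ) :=
  G.lift (fun _ => 0)
    (fun e => if e = d then ⟨fun t => (t : ℝ) ^ 2 * (1 - t), by fun_prop⟩ else
      if e = G.bar d then ⟨fun t => (t : ℝ) * (1 - t) ^ 2, by fun_prop⟩ else 0)
    (by
      intro e t
      by_cases h : e = d
      · subst h
        simp [G.bar_ne, mul_comm]
      · by_cases h2 : e = G.bar d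
        · subst h2
          simp [G.bar_bar, G.bar_ne, mul_comm]
        · have h3 : G.bar e ≠ d := fun h4 => h2 (by rw [← h4, G.bar_bar])
          have h4 : G.bar e ≠ G.bar d := fun h5 => h (G.bar_injective h5)
          simp [h, h2, h3, h4])
    (by intro e; split_ifs <;> simp)

open Classical in
/-- A function that is `1` at the vertex `v`, decreases along the edges that start at `v`, and
vanishes outside of the first thirds of these edges. -/
def starFun (v : G.V) : C(G.Space, ℝ) :=
  G.lift (fun w => if w = v then 1 else 0)
    (fun e => ⟨fun t => (if G.init e = v then max (1 - 3 * (t : ℝ)) 0 else 0) +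
      (if G.term e = v then max (1 - 3 * (σ t : ℝ)) 0 else 0), by split_ifs <;> fun_prop⟩)
    (by
      intro e t
      simp only [init_bar, term_bar, ContinuousMap.coe_mk, unitInterval.symm_symm]
      exact add_comm _ _)
    (by
      intro e
      simp)

theorem bump_pt (d : G.D) (t : I) : G.bump d (G.pt d t) = t * (1 - t) := by
  simp [bump]

theorem bump_pt_bar (d : G.D) (t : I) : G.bump d (G.pt (G.bar d) t) = t * (1 - t) := by
  simp [bump]

theorem bump_pt_of_ne {d e : G.D} (h : e ≠ d) (h' : e ≠ G.bar d) (t : I) :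
    G.bump d (G.pt e t) = 0 := by
  simp [bump, h, h']

theorem bump_vert (d : G.D) (v : G.V) : G.bump d (G.vert v) = 0 := rfl

theorem skewBump_pt (d : G.D) (t : I) : G.skewBump d (G.pt d t) = t ^ 2 * (1 - t) := by
  simp [skewBump]

theorem unit_mul_pos {t : I} (h0 : 0 < t) (h1 : t < 1) : 0 < (t : ℝ) * (1 - t) :=
  mul_pos h0 (sub_pos.2 h1)

theorem bump_pos {d : G.D} {t : I} (h0 : 0 < t) (h1 : t < 1) : 0 < G.bump d (G.pt d t) := by
  rw [bump_pt]
  exact unit_mul_pos h0 h1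

theorem bump_pos_iff {d : G.D} {x : G.Space} :
    0 < G.bump d x ↔ ∃ t, 0 < t ∧ t < 1 ∧ x = G.pt d t := by
  constructor
  · intro h
    rcases G.eq_vert_or_pt x with ⟨v, rfl⟩ | ⟨e, t, h0, h1, rfl⟩
    · rw [bump_vert] at h
      exact absurd h (lt_irrefl _)
    · by_cases he : e = d
      · subst he
        exact ⟨t, h0, h1, rfl⟩
      · by_cases he' : e = G.bar d
        · subst he'
          refine ⟨σ t, ?_, ?_, G.pt_bar d t⟩
          · rw [unitInterval.pos_iff_ne_zero]
            simpa using h1.ne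
          · rw [unitInterval.lt_one_iff_ne_one]
            simpa using h0.ne'
        · rw [G.bump_pt_of_ne he he'] at h
          exact absurd h (lt_irrefl _)
  · rintro ⟨t, h0, h1, rfl⟩
    exact G.bump_pos h0 h1

/-- On an edge `skewBump` is `t` times `bump`, so the two values determine `t` wherever `bump` is
nonzero. Continuous functions replace an analysis of the equivalence relation generated by `Rel`. -/
theorem pt_inj {d : G.D} {s t : I} (h0 : 0 < t) (h1 : t < 1) (h : G.pt d s = G.pt d t) :
    s = t := by
  have hb := congrArg (G.bump d) h
  have hs := congrArg (G.skewBump d) h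
  rw [skewBump_pt, skewBump_pt] at hs
  rw [bump_pt, bump_pt] at hb
  have h2 : (t : ℝ) * (1 - t) ≠ 0 := (unit_mul_pos h0 h1).ne'
  apply Subtype.ext
  apply mul_right_cancel₀ h2
  nth_rw 1 [← hb]
  linear_combination hs

theorem eq_of_pt_eq_pt {d e : G.D} {s t : I} (h0 : 0 < t) (h1 : t < 1)
    (h : G.pt e s = G.pt d t) : (e = d ∧ s = t) ∨ (e = G.bar d ∧ s = σ t) := by
  have hp := G.bump_pos (d := d) h0 h1
  by_cases he : e = d
  · subst he
    exact Or.inl ⟨rfl, G.pt_inj h0 h1 h⟩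
  · by_cases he' : e = G.bar d
    · subst he'
      rw [G.pt_bar] at h
      refine Or.inr ⟨rfl, ?_⟩
      rw [← G.pt_inj h0 h1 h, unitInterval.symm_symm]
    · rw [← h, G.bump_pt_of_ne he he'] at hp
      exact absurd hp (lt_irrefl _)

theorem pt_ne_vert {d : G.D} {t : I} (h0 : 0 < t) (h1 : t < 1) (v : G.V) :
    G.pt d t ≠ G.vert v := by
  intro h
  have hp := G.bump_pos (d := d) h0 h1
  rw [h, bump_vert] at hp
  exact absurd hp (lt_irrefl _)

theorem vert_injective : Function.Injective G.vert := by
  intro v w h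
  have h2 := congrArg (G.starFun w) h
  by_contra hne
  simp [starFun, hne] at h2

theorem starFun_vert (v : G.V) : G.starFun v (G.vert v) = 1 := by
  simp [starFun]

open Classical in
theorem eq_of_starFun_pos {v : G.V} {x : G.Space} (h : 0 < G.starFun v x) :
    x = G.vert v ∨ ∃ d, ∃ t : I, G.init d = v ∧ (t : ℝ) < 1 / 3 ∧ x = G.pt d t := by
  rcases G.eq_vert_or_pt x with ⟨w, rfl⟩ | ⟨d, t, -, -, rfl⟩
  · by_cases hw : w = v
    · exact Or.inl (by rw [hw])
    · simp [starFun, hw] at h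
  · right
    simp only [starFun, lift_pt, ContinuousMap.coe_mk] at h
    by_cases h1 : G.init d = v ∧ (t : ℝ) < 1 / 3
    · exact ⟨d, t, h1.1, h1.2, rfl⟩
    by_cases h2 : G.term d = v ∧ (σ t : ℝ) < 1 / 3
    · exact ⟨G.bar d, σ t, h2.1, h2.2, by rw [G.pt_bar, unitInterval.symm_symm]⟩
    · exfalso
      have e1 : (if G.init d = v then max (1 - 3 * (t : ℝ)) 0 else 0) = 0 := by
        split_ifs with h3
        · exact max_eq_right (by have := not_lt.1 fun h4 => h1 ⟨h3, h4⟩; linarith)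
        · rfl
      have e2 : (if G.term d = v then max (1 - 3 * (σ t : ℝ)) 0 else 0) = 0 := by
        split_ifs with h3
        · exact max_eq_right (by have := not_lt.1 fun h4 => h2 ⟨h3, h4⟩; linarith)
        · rfl
      rw [e1, e2] at h
      simp at h

/-- Finitely many real functions separate points: `bump` detects the open edge, `skewBump` the
position on it, and `starFun` distinguishes the vertices. -/
instance : T2Space G.Space := by
  let f : G.Space → (G.D → ℝ) × (G.D → ℝ) × (G.V → ℝ) := fun x =>
    (fun d => G.bump d x, fun d => G.skewBump d x, fun v => G.starFun v x)
  have hf : Continuous f := by fun_prop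
  refine T2Space.of_injective_continuous (f := f) ?_ hf
  intro x y h
  simp only [f, Prod.mk.injEq, funext_iff] at h
  obtain ⟨h1, h2, h3⟩ := h
  by_cases hx : ∃ d, 0 < G.bump d x
  · obtain ⟨d, hd⟩ := hx
    have hd' := hd
    rw [h1] at hd'
    obtain ⟨s, hs0, hs1, rfl⟩ := G.bump_pos_iff.1 hd
    obtain ⟨t, ht0, ht1, rfl⟩ := G.bump_pos_iff.1 hd'
    have hb := h1 d
    have hs := h2 d
    rw [skewBump_pt, skewBump_pt] at hs
    rw [bump_pt, bump_pt] at hb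
    have hne : (t : ℝ) * (1 - t) ≠ 0 := (unit_mul_pos ht0 ht1).ne'
    congr 1
    apply Subtype.ext
    apply mul_right_cancel₀ hne
    nth_rw 1 [← hb]
    linear_combination hs
  · rcases G.eq_vert_or_pt x with ⟨v, rfl⟩ | ⟨d, t, ht0, ht1, rfl⟩
    · rcases G.eq_vert_or_pt y with ⟨w, rfl⟩ | ⟨d, t, ht0, ht1, rfl⟩
      · have h4 := h3 w
        by_contra hne
        have hne' : v ≠ w := fun h5 => hne (by rw [h5])
        simp [starFun, hne'] at h4
      · exact absurd ⟨d, (h1 d).symm ▸ G.bump_pos ht0 ht1⟩ hx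
    · exact absurd ⟨d, G.bump_pos ht0 ht1⟩ hx

/-- The coordinate along the oriented edge `d` (meaningful in the interior of `d`). -/
def edgeCoord (d : G.D) (x : G.Space) : ℝ := G.skewBump d x / G.bump d x

theorem edgeCoord_pt {d : G.D} {t : I} (h0 : 0 < t) (h1 : t < 1) :
    G.edgeCoord d (G.pt d t) = t := by
  rw [edgeCoord, skewBump_pt, bump_pt]
  have hne : (t : ℝ) * (1 - t) ≠ 0 := (unit_mul_pos h0 h1).ne'
  rw [div_eq_iff hne]
  ring

theorem continuousOn_edgeCoord (d : G.D) :
    ContinuousOn (G.edgeCoord d) {x | 0 < G.bump d x} :=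
  (map_continuous _).continuousOn.div (map_continuous _).continuousOn fun _ hx => ne_of_gt hx

theorem isOpen_bump_pos (d : G.D) : IsOpen {x | 0 < G.bump d x} :=
  isOpen_lt continuous_const (map_continuous _)

/-! ### Homotopies between maps out of a graph -/

/-- A choice of one orientation for every edge. -/
def Pos (d : G.D) : Prop := Fintype.equivFin G.D d < Fintype.equivFin G.D (G.bar d)

theorem pos_bar_iff (d : G.D) : G.Pos (G.bar d) ↔ ¬ G.Pos d := by
  rw [Pos, Pos, G.bar_bar, not_lt, le_iff_lt_or_eq, or_iff_left]
  exact fun h => G.bar_ne d ((Fintype.equivFin G.D).injective h)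

open Classical in
/-- A map out of the space of a graph from a path for every positively oriented edge. -/
def glue (fv : G.V → X) (p : ∀ d, Path (fv (G.init d)) (fv (G.term d))) : C(G.Space, X) :=
  G.lift fv (fun d => if G.Pos d then (p d).toContinuousMap else
      (p (G.bar d)).symm.toContinuousMap)
    (by
      intro d t
      by_cases h : G.Pos d
      · have h' : ¬ G.Pos (G.bar d) := by rw [G.pos_bar_iff]; simpa using h
        simp only [h, h', if_true, if_false]
        change p (G.bar (G.bar d)) (σ t) = p d (σ t)
        rw [G.bar_bar]
      · have h' : G.Pos (G.bar d) := (G.pos_bar_iff d).2 h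
        simp only [h, h', if_true, if_false]
        change p (G.bar d) t = p (G.bar d) (σ (σ t))
        rw [unitInterval.symm_symm])
    (by
      intro d
      split_ifs
      · exact (p d).source
      · exact (p (G.bar d)).symm.source.trans (by rw [term_bar]))

theorem glue_pt_of_pos (fv : G.V → X) (p) {d : G.D} (h : G.Pos d) (t : I) :
    G.glue fv p (G.pt d t) = p d t := by
  simp [glue, h]

/-- The path traced by an oriented edge under a map. -/
def edgeImage (f : C(G.Space, X)) (d : G.D) :
    Path (f (G.vert (G.init d))) (f (G.vert (G.term d))) :=
  (G.edgePath d).map f.continuous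

@[simp] theorem edgeImage_apply (f : C(G.Space, X)) (d : G.D) (t : I) :
    G.edgeImage f d t = f (G.pt d t) := rfl

theorem edgeImage_bar (f : C(G.Space, X)) (d : G.D) :
    G.edgeImage f (G.bar d) = (G.edgeImage f d).symm.cast (congrArg (fun v => f (G.vert v)) (G.init_bar d))
      (congrArg (fun v => f (G.vert v)) (G.term_bar d)) := by
  ext t
  exact congrArg f (G.pt_bar d t)

/-- The class of the image of an oriented edge. -/
def edgeClass (f : C(G.Space, X)) (d : G.D) :
    Path.Homotopic.Quotient (f (G.vert (G.init d))) (f (G.vert (G.term d))) :=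
  Path.Homotopic.Quotient.mk (G.edgeImage f d)

/-- `glue` reads `p` only on positively oriented edges. The hypothesis `hp`, compatibility with
reversal up to homotopy, extends the formula to the other orientation. -/
theorem edgeClass_glue (fv : G.V → X) (p : ∀ d, Path (fv (G.init d)) (fv (G.term d)))
    (hp : ∀ d, (p (G.bar d)).Homotopic ((p d).symm.cast (congrArg _ (G.init_bar d))
      (congrArg _ (G.term_bar d)))) (d : G.D) :
    G.edgeClass (G.glue fv p) d = Path.Homotopic.Quotient.mk (p d) := by
  apply Path.Homotopic.Quotient.eq.2
  by_cases h : G.Pos d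
  · have : G.edgeImage (G.glue fv p) d = p d := by
      ext t
      exact G.glue_pt_of_pos fv p h t
    rw [this]
    exact Path.Homotopic.refl _
  · have h' : G.Pos (G.bar d) := (G.pos_bar_iff d).2 h
    have h2 : G.edgeImage (G.glue fv p) d
        = (p (G.bar d)).symm.cast (congrArg fv (G.term_bar d).symm)
          (congrArg fv (G.init_bar d).symm) := by
      ext t
      change G.glue fv p (G.pt d t) = p (G.bar d) (σ t)
      rw [← G.glue_pt_of_pos fv p h', G.pt_bar, unitInterval.symm_symm]
    rw [h2]
    refine ((hp d).symm₂.pathCast (congrArg fv (G.term_bar d).symm)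
          (congrArg fv (G.init_bar d).symm)).trans ?_
    refine Eq.mpr (congrArg (Path.Homotopic · (p d)) ?_) (Path.Homotopic.refl (p d))
    ext t
    change p d (σ (σ t)) = p d t
    rw [unitInterval.symm_symm]

/-- A homotopy is a map of the graph into `C(I, X)`, so `glue` can build it one edge at a time from
squares whose vertical sides agree at the vertices. -/
theorem homotopic_of_family {f g : C(G.Space, X)} (γ : G.V → C(I, X))
    (hγ0 : ∀ v, γ v 0 = f (G.vert v)) (hγ1 : ∀ v, γ v 1 = g (G.vert v))
    (H : ∀ d, G.Pos d → ∃ H : C(I × I, X), (∀ s, H (0, s) = γ (G.init d) s) ∧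
      (∀ s, H (1, s) = γ (G.term d) s) ∧ (∀ t, H (t, 0) = f (G.pt d t)) ∧
      ∀ t, H (t, 1) = g (G.pt d t)) : f.Homotopic g := by
  classical
  choose H h0 h1 hf hg using H
  let q : ∀ d, Path (γ (G.init d)) (γ (G.term d)) := fun d =>
    if h : G.Pos d then
    { toFun := fun t => (H d h).curry t
      continuous_toFun := (H d h).curry.continuous
      source' := by ext s; exact h0 d h s
      target' := by ext s; exact h1 d h s }
    else
    { toFun := fun t => (H (G.bar d) ((G.pos_bar_iff d).2 h)).curry (σ t)
      continuous_toFun := (H _ _).curry.continuous.comp unitInterval.continuous_symm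
      source' := by
        ext s
        rw [unitInterval.symm_zero, ContinuousMap.curry_apply, h1, term_bar]
      target' := by
        ext s
        rw [unitInterval.symm_one, ContinuousMap.curry_apply, h0, init_bar] }
  have hq (d) (h : G.Pos d) (t s : I) : q d t s = H d h (t, s) := by
    simp only [q, dif_pos h]
    rfl
  clear_value q
  let F : C(G.Space, C(I, X)) := G.glue γ q
  have key (d) (h : G.Pos d) (t s : I) : F (G.pt d t) s = H d h (t, s) := by
    rw [← hq]
    exact congrArg (fun z => z s) (G.glue_pt_of_pos γ q h t)
  have aux {k : C(G.Space, X)} {s : I} (hv : ∀ v, γ v s = k (G.vert v))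
      (hk : ∀ d h t, H d h (t, s) = k (G.pt d t)) : ∀ x, F x s = k x := by
    refine congrFun (G.map_ext hv fun d t => ?_)
    by_cases h : G.Pos d
    · rw [key d h, hk]
    · have h' := (G.pos_bar_iff d).2 h
      have h2 : G.pt d t = G.pt (G.bar d) (σ t) := by rw [G.pt_bar, unitInterval.symm_symm]
      rw [h2, key _ h', hk]
  refine ⟨⟨⟨fun z => F z.2 z.1, ?_⟩, ?_, ?_⟩⟩
  · exact continuous_eval.comp ((F.continuous.comp continuous_snd).prodMk continuous_fst)
  · exact aux hγ0 hf
  · exact aux hγ1 hg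

end FinGraph

/-- Two paths bound a square with the given sides. -/
def PathSquare {X : Type*} [TopologicalSpace X] {x y x' y' : X} (a : Path x y) (b : Path x' y')
    (γ : Path x x') (δ : Path y y') : Prop :=
  ∃ H : ContinuousMap.Homotopy a.toContinuousMap b.toContinuousMap,
    (∀ s, H (s, 0) = γ s) ∧ ∀ s, H (s, 1) = δ s

section Squares

variable {X : Type*} [TopologicalSpace X] {x y x' y' x'' y'' : X}

theorem PathSquare.trans {a : Path x y} {b : Path x' y'} {c : Path x'' y''} {γ : Path x x'}
    {δ : Path y y'} {γ' : Path x' x''} {δ' : Path y' y''} (h : PathSquare a b γ δ)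
    (h' : PathSquare b c γ' δ') : PathSquare a c (γ.trans γ') (δ.trans δ') := by
  obtain ⟨H, h0, h1⟩ := h
  obtain ⟨H', h0', h1'⟩ := h'
  refine ⟨H.trans H', fun s => ?_, fun s => ?_⟩
  · rw [ContinuousMap.Homotopy.trans_apply, Path.trans_apply]
    split_ifs
    · exact h0 _
    · exact h0' _
  · rw [ContinuousMap.Homotopy.trans_apply, Path.trans_apply]
    split_ifs
    · exact h1 _
    · exact h1' _

theorem PathSquare.of_homotopic {a b : Path x y} (h : a.Homotopic b) :
    PathSquare a b (Path.refl x) (Path.refl y) := by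
  obtain ⟨H⟩ := h
  exact ⟨H.toHomotopy, fun s => H.source s, fun s => H.target s⟩

/-- At time `s` the path runs back along `γ` from `γ s`, follows `a`, and runs along `δ` up to `δ
s`. -/
theorem PathSquare.conj (a : Path x y) (γ : Path x x') (δ : Path y y') :
    PathSquare (((Path.refl x).symm.trans a).trans (Path.refl y))
      ((γ.symm.trans a).trans δ) γ δ := by
  let γt : ∀ s : I, Path x (γ s) := fun s =>
    { toFun := fun t => γ (s ⊓ t)
      continuous_toFun := by fun_prop
      source' := (congrArg γ (inf_eq_right.2 unitInterval.nonneg')).trans γ.source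
      target' := congrArg γ (inf_eq_left.2 unitInterval.le_one') }
  let δt : ∀ s : I, Path y (δ s) := fun s =>
    { toFun := fun t => δ (s ⊓ t)
      continuous_toFun := by fun_prop
      source' := (congrArg δ (inf_eq_right.2 unitInterval.nonneg')).trans δ.source
      target' := congrArg δ (inf_eq_left.2 unitInterval.le_one') }
  have hγ : Continuous ↿(fun s => (γt s).symm) := by
    change Continuous fun z : I × I => γ (z.1 ⊓ σ z.2)
    fun_prop
  have hδ : Continuous ↿δt := by
    change Continuous fun z : I × I => δ (z.1 ⊓ z.2)
    fun_prop
  have ha : Continuous ↿(fun _ : I => a) := a.continuous.comp continuous_snd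
  have hc := Path.trans_continuous_family _
    (Path.trans_continuous_family (fun s => (γt s).symm) hγ (fun _ => a) ha) δt hδ
  have hγ0 (t : I) : γt 0 t = x :=
    (congrArg γ (inf_eq_left.2 unitInterval.nonneg')).trans γ.source
  have hδ0 (t : I) : δt 0 t = y :=
    (congrArg δ (inf_eq_left.2 unitInterval.nonneg')).trans δ.source
  have hγ1 (t : I) : γt 1 t = γ t := congrArg γ (inf_eq_right.2 unitInterval.le_one')
  have hδ1 (t : I) : δt 1 t = δ t := congrArg δ (inf_eq_right.2 unitInterval.le_one')
  clear_value γt δt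
  refine ⟨⟨⟨fun z => ((γt z.1).symm.trans a).trans (δt z.1) z.2, hc⟩, ?_, ?_⟩, ?_, ?_⟩
  · intro t
    simp only [Path.trans_apply, Path.symm_apply, Function.comp_apply, hγ0, hδ0,
      Path.refl_apply, Path.coe_toContinuousMap]
  · intro t
    simp only [Path.trans_apply, Path.symm_apply, Function.comp_apply, hγ1, hδ1,
      Path.coe_toContinuousMap]
  · exact fun s => (((γt s).symm.trans a).trans (δt s)).source
  · exact fun s => (((γt s).symm.trans a).trans (δt s)).target

/-- The square of `PathSquare.conj` is placed between two homotopies with fixed ends. These add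
constant pieces to the vertical sides, whence the padding by `Path.refl`, which depends only on the
side and thus is the same for all edges at a vertex. -/
theorem PathSquare.of_class {a : Path x y} {b : Path x' y'} {γ : Path x x'} {δ : Path y y'}
    (h : (Path.Homotopic.Quotient.mk a).trans (Path.Homotopic.Quotient.mk δ)
      = (Path.Homotopic.Quotient.mk γ).trans (Path.Homotopic.Quotient.mk b)) :
    PathSquare a b (((Path.refl x).trans γ).trans (Path.refl x'))
      (((Path.refl y).trans δ).trans (Path.refl y')) := by
  refine ((PathSquare.of_homotopic ?_).trans (PathSquare.conj a γ δ)).trans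
    (PathSquare.of_homotopic ?_)
  · apply Path.Homotopic.Quotient.exact
    rw [Path.refl_symm]
    simp
  · apply Path.Homotopic.Quotient.exact
    simp only [Path.Homotopic.Quotient.mk_trans, Path.Homotopic.Quotient.trans_assoc, h]
    rw [← Path.Homotopic.Quotient.trans_assoc, Path.Homotopic.Quotient.mk_symm,
      Path.Homotopic.Quotient.symm_trans, Path.Homotopic.Quotient.refl_trans]

end Squares

/-- Two maps out of a graph are homotopic if the images of the edges correspond to each other under
paths that join the images of the vertices. -/
theorem FinGraph.homotopic_of_edgeClass {X : Type*} [TopologicalSpace X] (G : FinGraph)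
    {f g : C(G.Space, X)}
    (γ : ∀ v, Path.Homotopic.Quotient (f (G.vert v)) (g (G.vert v)))
    (h : ∀ d, (G.edgeClass f d).trans (γ (G.term d)) = (γ (G.init d)).trans (G.edgeClass g d)) :
    f.Homotopic g := by
  choose γ hγ using fun v => Path.Homotopic.Quotient.mk_surjective (γ v)
  simp only [← hγ] at h
  refine G.homotopic_of_family
    (fun v => (((Path.refl _).trans (γ v)).trans (Path.refl _)).toContinuousMap)
    (fun v => Path.source _) (fun v => Path.target _) fun d _ => ?_
  obtain ⟨H, h0, h1⟩ := PathSquare.of_class (h d)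
  exact ⟨H.toContinuousMap.comp ⟨Prod.swap, continuous_swap⟩, h0, h1, fun t => H.apply_zero t,
    fun t => H.apply_one t⟩

end OuterSpace

end

/-! ### Paths in a graph as edge words of bounded length -/

noncomputable section

namespace OuterSpace

/-! ### Paths in a graph -/

theorem homotopic_of_unitInterval {s t : I} (a b : Path s t) : a.Homotopic b := by
  have : ContractibleSpace I := (convex_Icc (0 : ℝ) 1).contractibleSpace ⟨0, by simp⟩
  have : SimplyConnectedSpace I := SimplyConnectedSpace.ofContractible I
  exact SimplyConnectedSpace.paths_homotopic a b

/-- The affine path in the unit interval. -/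
def unitLine (s t : I) : Path s t := Path.id.subpath s t

namespace FinGraph

variable (G : FinGraph) {x y z : G.Space}

/-- The class of the path that runs along the oriented edge `d` from time `s` to time `t`. -/
def seg (d : G.D) {s t : I} (hx : x = G.pt d s) (hy : y = G.pt d t) : Path.Homotopic.Quotient x y :=
  Path.Homotopic.Quotient.mk (((unitLine s t).map (G.continuous_pt d)).cast hx hy)

/-- The interval is simply connected, so the class of a path inside one edge depends only on its end
parameters. -/
theorem mk_map_eq_seg (d : G.D) {s t : I} (a : Path s t) (hx : x = G.pt d s) (hy : y = G.pt d t) :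
    Path.Homotopic.Quotient.mk ((a.map (G.continuous_pt d)).cast hx hy) = G.seg d hx hy :=
  Path.Homotopic.Quotient.eq.2 (((homotopic_of_unitInterval a (unitLine s t)).map
    ⟨G.pt d, G.continuous_pt d⟩).pathCast hx hy)

theorem mk_eq_seg (d : G.D) {s t : I} (p : Path x y) (a : Path s t)
    (h : ∀ u, p u = G.pt d (a u)) (hx : x = G.pt d s) (hy : y = G.pt d t) :
    Path.Homotopic.Quotient.mk p = G.seg d hx hy := by
  rw [← G.mk_map_eq_seg d a hx hy]
  congr 1
  ext u
  exact h u

theorem seg_self (d : G.D) {s : I} (hx : x = G.pt d s) :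
    G.seg d hx hx = Path.Homotopic.Quotient.refl x := by
  subst hx
  exact (G.mk_eq_seg d (Path.refl _) (Path.refl s) (fun _ => rfl) rfl rfl).symm

theorem seg_trans (d : G.D) {s t u : I} (hx : x = G.pt d s) (hy : y = G.pt d t)
    (hz : z = G.pt d u) : (G.seg d hx hy).trans (G.seg d hy hz) = G.seg d hx hz := by
  subst hx hy hz
  exact G.mk_eq_seg d (((unitLine s t).map (G.continuous_pt d)).trans
    ((unitLine t u).map (G.continuous_pt d))) ((unitLine s t).trans (unitLine t u))
    (fun v => by rw [← Path.map_trans]; rfl) rfl rfl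

theorem seg_bar (d : G.D) {s t : I} (hx : x = G.pt (G.bar d) s) (hy : y = G.pt (G.bar d) t)
    (hx' : x = G.pt d (σ s)) (hy' : y = G.pt d (σ t)) :
    G.seg (G.bar d) hx hy = G.seg d hx' hy' := by
  refine G.mk_eq_seg d _ ((unitLine s t).map unitInterval.continuous_symm) (fun u => ?_) _ _
  exact G.pt_bar d _

theorem seg_congr (d : G.D) {s t s' t' : I} (hs : s = s') (ht : t = t') (hx : x = G.pt d s)
    (hy : y = G.pt d t) (hx' : x = G.pt d s') (hy' : y = G.pt d t') :
    G.seg d hx hy = G.seg d hx' hy' := by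
  subst hs ht
  rfl

theorem mk_edgePath (d : G.D) :
    Path.Homotopic.Quotient.mk (G.edgePath d) = G.seg d (G.pt_zero d).symm (G.pt_one d).symm :=
  G.mk_eq_seg d _ Path.id (fun _ => rfl) _ _

/-- The classes that are products of at most `k` segments of edges. -/
inductive SegProd : ℕ → ∀ {x y : G.Space}, Path.Homotopic.Quotient x y → Prop
  | nil (k : ℕ) (x : G.Space) : SegProd k (Path.Homotopic.Quotient.refl x)
  | cons {k : ℕ} {x y z : G.Space} (d : G.D) {s t : I} (hx : x = G.pt d s) (hy : y = G.pt d t)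
      {P : Path.Homotopic.Quotient y z} (h : SegProd k P) : SegProd (k + 1) ((G.seg d hx hy).trans P)

/-- The classes of edge paths of length at most `k`. -/
inductive EdgeWord : ℕ → ∀ {u v : G.V}, Path.Homotopic.Quotient (G.vert u) (G.vert v) → Prop
  | nil (k : ℕ) (u : G.V) : EdgeWord k (Path.Homotopic.Quotient.refl (G.vert u))
  | cons {k : ℕ} (d : G.D) {v : G.V} {P : Path.Homotopic.Quotient (G.vert (G.term d)) (G.vert v)}
      (h : EdgeWord k P) : EdgeWord (k + 1) ((Path.Homotopic.Quotient.mk (G.edgePath d)).trans P)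

variable {G}

theorem SegProd.mono {k l : ℕ} {P : Path.Homotopic.Quotient x y} (h : G.SegProd k P) (hkl : k ≤ l) :
    G.SegProd l P := by
  induction h generalizing l with
  | nil k x => exact .nil l x
  | cons d hx hy _ ih =>
    cases l with
    | zero => omega
    | succ l => exact .cons d hx hy (ih (by omega))

theorem EdgeWord.mono {k l : ℕ} {u v : G.V} {P : Path.Homotopic.Quotient (G.vert u) (G.vert v)}
    (h : G.EdgeWord k P) (hkl : k ≤ l) : G.EdgeWord l P := by
  induction h generalizing l with
  | nil k x => exact .nil l x
  | cons d _ ih =>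
    cases l with
    | zero => omega
    | succ l => exact .cons d (ih (by omega))

theorem SegProd.trans {k l : ℕ} {P : Path.Homotopic.Quotient x y} {Q : Path.Homotopic.Quotient y z} (h : G.SegProd k P)
    (h' : G.SegProd l Q) : G.SegProd (k + l) (P.trans Q) := by
  induction h with
  | nil k x => rw [Path.Homotopic.Quotient.refl_trans]; exact h'.mono (by omega)
  | cons d hx hy _ ih =>
    rw [Path.Homotopic.Quotient.trans_assoc, Nat.add_right_comm]
    exact .cons d hx hy (ih h')

theorem EdgeWord.trans {k l : ℕ} {u v w : G.V} {P : Path.Homotopic.Quotient (G.vert u) (G.vert v)}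
    {Q : Path.Homotopic.Quotient (G.vert v) (G.vert w)} (h : G.EdgeWord k P)
    (h' : G.EdgeWord l Q) : G.EdgeWord (k + l) (P.trans Q) := by
  induction h with
  | nil k x => rw [Path.Homotopic.Quotient.refl_trans]; exact h'.mono (by omega)
  | cons d _ ih =>
    rw [Path.Homotopic.Quotient.trans_assoc, Nat.add_right_comm]
    exact .cons d (ih h')

variable (G)

theorem segProd_seg (d : G.D) {s t : I} (hx : x = G.pt d s) (hy : y = G.pt d t) :
    G.SegProd 1 (G.seg d hx hy) := by
  rw [← Path.Homotopic.Quotient.trans_refl (G.seg d hx hy)]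
  exact .cons d hx hy (.nil 0 _)

theorem edgeWord_edgePath (d : G.D) : G.EdgeWord 1 (Path.Homotopic.Quotient.mk (G.edgePath d)) := by
  rw [← Path.Homotopic.Quotient.trans_refl (Path.Homotopic.Quotient.mk (G.edgePath d))]
  exact .cons d (.nil 0 _)

theorem edgeWord_seg_of_vert {u w : G.V} (d : G.D) {t : I} (ht : t = 0 ∨ t = 1)
    (hu : G.vert u = G.pt d 0) (hw : G.vert w = G.pt d t) : G.EdgeWord 1 (G.seg d hu hw) := by
  obtain rfl : u = G.init d := G.vert_injective (hu.trans (G.pt_zero d))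
  rcases ht with rfl | rfl
  · obtain rfl : w = G.init d := G.vert_injective (hw.trans (G.pt_zero d))
    rw [seg_self]
    exact .nil _ _
  · obtain rfl : w = G.term d := G.vert_injective (hw.trans (G.pt_one d))
    rw [← G.mk_edgePath]
    exact G.edgeWord_edgePath d

theorem edgeWord_seg_to_vert {u w : G.V} (d : G.D) {t : I} (ht : t = 0 ∨ t = 1)
    (hw : G.vert w = G.pt d t) (hu : G.vert u = G.pt d 0) : G.EdgeWord 1 (G.seg d hw hu) := by
  obtain rfl : u = G.init d := G.vert_injective (hu.trans (G.pt_zero d))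
  rcases ht with rfl | rfl
  · obtain rfl : w = G.init d := G.vert_injective (hw.trans (G.pt_zero d))
    rw [seg_self]
    exact .nil _ _
  · obtain rfl : w = G.term d := G.vert_injective (hw.trans (G.pt_one d))
    have h1 : G.vert (G.term d) = G.pt (G.bar d) 0 := (G.pt_zero _).symm
    have h2 : G.vert (G.init d) = G.pt (G.bar d) 1 := by rw [pt_bar]; simpa using hu
    have := G.edgeWord_seg_of_vert (G.bar d) (Or.inr rfl) h1 h2
    rw [G.seg_bar d h1 h2 (by simpa using hw) (by simpa using hu)] at this
    rwa [G.seg_congr d unitInterval.symm_zero unitInterval.symm_one _ _ hw hu] at this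

/-- If `x` is interior to an edge, then `e` is `d` or its reversal and the two segments cancel or
form one edge. Otherwise `x` is a vertex and each segment is trivial or a whole edge. -/
theorem edgeWord_seg_seg {u v : G.V} {x : G.Space} (d e : G.D) {s t : I}
    (hu : G.vert u = G.pt d 0) (hx : x = G.pt d s) (hx' : x = G.pt e t)
    (hv : G.vert v = G.pt e 0) : G.EdgeWord 2 ((G.seg d hu hx).trans (G.seg e hx' hv)) := by
  by_cases ht : 0 < s ∧ s < 1
  · rcases G.eq_of_pt_eq_pt ht.1 ht.2 (hx'.symm.trans hx) with ⟨rfl, rfl⟩ | ⟨rfl, rfl⟩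
    · rw [seg_trans]
      exact (G.edgeWord_seg_of_vert e (Or.inl rfl) hu hv).mono (by omega)
    · have hv' : G.vert v = G.pt d 1 := by rw [hv, pt_bar, unitInterval.symm_zero]
      rw [G.seg_bar d hx' hv (by simpa using hx) (by simpa using hv')]
      obtain rfl : u = G.init d := G.vert_injective (hu.trans (G.pt_zero d))
      obtain rfl : v = G.term d := G.vert_injective (hv'.trans (G.pt_one d))
      have key : ∀ (s' t' : I) (h1 : x = G.pt d s') (h2 : G.vert (G.term d) = G.pt d t')
          (_ : s' = s) (_ : t' = 1),
          G.EdgeWord 2 ((G.seg d hu hx).trans (G.seg d h1 h2)) := by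
        rintro s' t' h1 h2 rfl rfl
        rw [seg_trans]
        exact (G.edgeWord_seg_of_vert d (Or.inr rfl) _ _).mono (by omega)
      exact key _ _ _ _ (unitInterval.symm_symm s) unitInterval.symm_zero
  · have hs : s = 0 ∨ s = 1 := by
      rcases eq_or_ne s 0 with h | h
      · exact Or.inl h
      · refine Or.inr (by_contra fun h' => ht ⟨unitInterval.pos_iff_ne_zero.2 h,
          unitInterval.lt_one_iff_ne_one.2 h'⟩)
    obtain ⟨w, rfl⟩ : ∃ w, x = G.vert w := by
      rcases hs with rfl | rfl
      · exact ⟨_, hx.trans (G.pt_zero d)⟩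
      · exact ⟨_, hx.trans (G.pt_one d)⟩
    have ht' : t = 0 ∨ t = 1 := by
      by_contra h
      rw [not_or] at h
      exact G.pt_ne_vert (unitInterval.pos_iff_ne_zero.2 h.1)
        (unitInterval.lt_one_iff_ne_one.2 h.2) w hx'.symm
    exact (G.edgeWord_seg_of_vert d hs hu hx).trans (G.edgeWord_seg_to_vert e ht' hx' hv)

/-- At each of the `k + 1` break points a detour to the initial vertex of the next edge is inserted.
Between consecutive detours at most two edges remain, by `edgeWord_seg_seg`. -/
theorem SegProd.edgeWord {k : ℕ} {P : Path.Homotopic.Quotient x y} (h : G.SegProd k P) {u v : G.V} (d e : G.D)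
    {s t : I} (hu : G.vert u = G.pt d 0) (hx : x = G.pt d s) (hy : y = G.pt e t)
    (hv : G.vert v = G.pt e 0) :
    G.EdgeWord (2 * k + 2) (((G.seg d hu hx).trans P).trans (G.seg e hy hv)) := by
  induction h generalizing d u s with
  | nil k x =>
    rw [Path.Homotopic.Quotient.trans_refl]
    exact (G.edgeWord_seg_seg d e hu hx hy hv).mono (by omega)
  | @cons k x y z d' s' t' hx' hy' P _ ih =>
    have h1 := G.edgeWord_seg_seg d d' hu hx hx' (v := G.init d') (G.pt_zero d').symm
    have h2 := h1.trans (ih d' (G.pt_zero d').symm hy' hy)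
    rw [Nat.mul_add, show 2 * k + 2 * 1 + 2 = 2 + (2 * k + 2) by omega]
    convert h2 using 1
    rw [← G.seg_trans d' hx' (G.pt_zero d').symm hy']
    simp only [Path.Homotopic.Quotient.trans_assoc]

theorem finite_edgeWord (k : ℕ) (u v : G.V) :
    {P : Path.Homotopic.Quotient (G.vert u) (G.vert v) | G.EdgeWord k P}.Finite := by
  induction k generalizing u with
  | zero =>
    have : {P : Path.Homotopic.Quotient (G.vert u) (G.vert v) | G.EdgeWord 0 P} ⊆
        {P | ∃ h : u = v, P = (Path.Homotopic.Quotient.refl (G.vert u)).cast rfl (by rw [h])} := by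
      rintro P h
      cases h with
      | nil => exact ⟨rfl, by simp⟩
    refine Set.Finite.subset (Set.Subsingleton.finite ?_) this
    rintro P ⟨h, rfl⟩ Q ⟨_, rfl⟩
    rfl
  | succ k ih =>
    let A (d : G.D) : Set (Path.Homotopic.Quotient (G.vert u) (G.vert v)) :=
      {P | ∃ h : u = G.init d, ∃ Q : Path.Homotopic.Quotient (G.vert (G.term d)) (G.vert v), G.EdgeWord k Q ∧
        P = ((Path.Homotopic.Quotient.mk (G.edgePath d)).trans Q).cast (by rw [h]) rfl}
    have hA (d : G.D) : (A d).Finite := by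
      by_cases h : u = G.init d
      · refine ((ih (G.term d)).image
          (fun Q => ((Path.Homotopic.Quotient.mk (G.edgePath d)).trans Q).cast (by rw [h]) rfl)).subset ?_
        rintro P ⟨_, Q, hQ, rfl⟩
        exact ⟨Q, hQ, rfl⟩
      · refine Set.Finite.subset Set.finite_empty ?_
        rintro P ⟨h', -⟩
        exact h h'
    have : {P : Path.Homotopic.Quotient (G.vert u) (G.vert v) | G.EdgeWord (k + 1) P} ⊆
        {P | ∃ h : u = v, P = (Path.Homotopic.Quotient.refl (G.vert u)).cast rfl (by rw [h])} ∪ ⋃ d, A d := by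
      rintro P h
      cases h with
      | nil => exact Or.inl ⟨rfl, by simp⟩
      | cons d h => exact Or.inr (Set.mem_iUnion.2 ⟨d, rfl, _, h, by simp⟩)
    refine Set.Finite.subset (Set.Finite.union (Set.Subsingleton.finite ?_)
      (Set.finite_iUnion hA)) this
    rintro P ⟨h, rfl⟩ Q ⟨_, rfl⟩
    rfl

/-! ### Every path is a product of segments -/

theorem segProd_of_const (p : Path x y) (h : ∀ t, p t = x) : G.SegProd 0 (Path.Homotopic.Quotient.mk p) := by
  obtain rfl : y = x := by rw [← h 1, p.target]
  have : p = Path.refl y := by ext t; exact h t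
  rw [this]
  exact .nil 0 _

theorem segProd_of_openEdge (d : G.D) (p : Path x y) (h : ∀ t, 0 < G.bump d (p t)) :
    G.SegProd 1 (Path.Homotopic.Quotient.mk p) := by
  have hc : Continuous fun t => Set.projIcc (0 : ℝ) 1 zero_le_one (G.edgeCoord d (p t)) :=
    continuous_projIcc.comp ((G.continuousOn_edgeCoord d).comp_continuous p.continuous h)
  have hp (t : I) : p t = G.pt d (Set.projIcc (0 : ℝ) 1 zero_le_one (G.edgeCoord d (p t))) := by
    obtain ⟨s, h0, h1, hs⟩ := G.bump_pos_iff.1 (h t)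
    rw [hs, G.edgeCoord_pt h0 h1, Set.projIcc_val]
  let a : Path (Set.projIcc (0 : ℝ) 1 zero_le_one (G.edgeCoord d (p 0)))
    (Set.projIcc (0 : ℝ) 1 zero_le_one (G.edgeCoord d (p 1))) := ⟨⟨_, hc⟩, rfl, rfl⟩
  rw [G.mk_eq_seg d p a hp (p.source.symm.trans (hp 0)) (p.target.symm.trans (hp 1))]
  exact G.segProd_seg d _ _

/-- The maps of the interval that expand its middle third. -/
def expand : C(I × I, I) where
  -- At time `s` the interval is stretched about its midpoint by the factor `1 + 2 * s` and
  -- truncated. At time `1` this is `3 * t - 1`, which sends the first third to `0`.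
  toFun z := Set.projIcc (0 : ℝ) 1 zero_le_one ((1 + 2 * z.1) * z.2 - z.1)
  continuous_toFun := continuous_projIcc.comp (by fun_prop)

theorem expand_zero (t : I) : expand (0, t) = t := by
  simp [expand]

theorem expand_one {t : I} (h : (t : ℝ) < 1 / 3) : expand (1, t) = 0 := by
  refine Set.projIcc_of_le_left zero_le_one ?_
  simp only [Set.Icc.coe_one]
  linarith

theorem expand_left (s : I) : expand (s, 0) = 0 := by
  refine Set.projIcc_of_le_left zero_le_one ?_
  simp [unitInterval.nonneg]

theorem expand_symm (s t : I) : expand (s, σ t) = σ (expand (s, t)) := by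
  have h := unitInterval.symm_projIcc ((1 + 2 * (s : ℝ)) * t - s)
  change _ = σ (Set.projIcc (0 : ℝ) 1 zero_le_one ((1 + 2 * (s : ℝ)) * t - s))
  rw [h]
  change Set.projIcc (0 : ℝ) 1 zero_le_one ((1 + 2 * (s : ℝ)) * (σ t : I) - s) = _
  congr 1
  rw [unitInterval.coe_symm_eq]
  ring

/-- The homotopy that expands the middle thirds of all edges. -/
def expandFamily : C(G.Space, C(I, G.Space)) :=
  G.lift (fun v => ContinuousMap.const I (G.vert v))
    (fun d => ContinuousMap.curry ⟨fun z : I × I => G.pt d (expand (z.2, z.1)),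
      (G.continuous_pt d).comp (expand.continuous.comp continuous_swap)⟩)
    (by
      intro d t
      ext s
      change G.pt (G.bar d) (expand (s, t)) = G.pt d (expand (s, σ t))
      rw [G.pt_bar, expand_symm])
    (by
      intro d
      ext s
      change G.pt d (expand (s, 0)) = _
      rw [expand_left, pt_zero]
      rfl)

theorem expandFamily_pt (d : G.D) (t s : I) :
    G.expandFamily (G.pt d t) s = G.pt d (expand (s, t)) := rfl

theorem continuous_expandFamily : Continuous fun z : I × G.Space => G.expandFamily z.2 z.1 :=
  continuous_eval.comp ((G.expandFamily.continuous.comp continuous_snd).prodMk continuous_fst)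

/-- The map that collapses the first and last thirds of all edges. -/
def expandMap : C(G.Space, G.Space) :=
  ⟨fun x => G.expandFamily x 1, G.continuous_expandFamily.comp (continuous_const.prodMk continuous_id)⟩

/-- The map that collapses the first and last thirds of all edges is homotopic to the identity. -/
def expandHomotopy : (ContinuousMap.id G.Space).Homotopy G.expandMap where
  toFun z := G.expandFamily z.2 z.1
  continuous_toFun := G.continuous_expandFamily
  map_zero_left x := by
    refine congrFun (G.map_ext (f := fun x => G.expandFamily x 0) (g := id) (fun v => rfl)
      fun d t => ?_) x
    simp only [expandFamily_pt, expand_zero, id]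
  map_one_left x := rfl

theorem segProd_expandHomotopy (x : G.Space) :
    G.SegProd 1 (Path.Homotopic.Quotient.mk (G.expandHomotopy.evalAt x)) := by
  rcases G.eq_vert_or_pt x with ⟨v, rfl⟩ | ⟨d, t, -, -, rfl⟩
  · exact (G.segProd_of_const _ fun t => rfl).mono zero_le_one
  · rw [G.mk_eq_seg d (G.expandHomotopy.evalAt (G.pt d t))
      (⟨⟨fun s => expand (s, t), by fun_prop⟩, expand_zero t, rfl⟩ : Path t (expand (1, t)))
      (fun s => rfl) rfl rfl]
    exact G.segProd_seg d _ _

theorem segProd_symm_expandHomotopy (x : G.Space) :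
    G.SegProd 1 (Path.Homotopic.Quotient.mk (G.expandHomotopy.evalAt x)).symm := by
  rcases G.eq_vert_or_pt x with ⟨v, rfl⟩ | ⟨d, t, -, -, rfl⟩
  · exact (G.segProd_of_const (G.expandHomotopy.evalAt (G.vert v)).symm
      fun t => rfl).mono zero_le_one
  · rw [← Path.Homotopic.Quotient.mk_symm, G.mk_eq_seg d (G.expandHomotopy.evalAt (G.pt d t)).symm
      (⟨⟨fun s => expand (s, t), by fun_prop⟩, expand_zero t, rfl⟩ : Path t (expand (1, t))).symm
      (fun s => rfl) rfl rfl]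
    exact G.segProd_seg d _ _

theorem expandMap_of_starFun_pos {v : G.V} (h : 0 < G.starFun v x) :
    G.expandMap x = G.vert v := by
  rcases G.eq_of_starFun_pos h with rfl | ⟨d, t, rfl, ht, rfl⟩
  · rfl
  · change G.pt d (expand (1, t)) = _
    rw [expand_one ht, pt_zero]

/-- The map `expandMap` takes the star to its vertex, so the image of `p` is constant. Naturality of
the homotopy then writes `p` as the track of one end followed by the reversed track of the other,
and each track is one segment. -/
theorem segProd_of_star (v : G.V) (p : Path x y) (h : ∀ t, 0 < G.starFun v (p t)) :
    G.SegProd 2 (Path.Homotopic.Quotient.mk p) := by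
  have h1 := Path.Homotopic.Quotient.eq.2 (Path.Homotopic.map_trans_evalAt G.expandHomotopy p)
  have h2 : Path.Homotopic.Quotient.mk p = ((Path.Homotopic.Quotient.mk (G.expandHomotopy.evalAt x)).trans
      (Path.Homotopic.Quotient.mk (p.map (map_continuous G.expandMap)))).trans
      (Path.Homotopic.Quotient.mk (G.expandHomotopy.evalAt y)).symm := by
    rw [← Path.Homotopic.Quotient.mk_trans, ← h1, Path.Homotopic.Quotient.mk_trans, Path.Homotopic.Quotient.trans_assoc, Path.Homotopic.Quotient.trans_symm]
    exact (Path.Homotopic.Quotient.trans_refl _).symm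
  have h3 : G.SegProd 0 (Path.Homotopic.Quotient.mk (p.map (map_continuous G.expandMap))) := by
    refine G.segProd_of_const _ fun t => ?_
    change G.expandMap (p t) = G.expandMap x
    rw [G.expandMap_of_starFun_pos (h t)]
    have := h 0
    rw [p.source] at this
    rw [G.expandMap_of_starFun_pos this]
  rw [h2]
  exact ((G.segProd_expandHomotopy x).trans h3).trans (G.segProd_symm_expandHomotopy y)

/-- The open sets on which paths are easy to understand. -/
def chart : G.V ⊕ G.D → Set G.Space
  | Sum.inl v => {x | 0 < G.starFun v x}
  | Sum.inr d => {x | 0 < G.bump d x}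

theorem isOpen_chart (i : G.V ⊕ G.D) : IsOpen (G.chart i) := by
  rcases i with v | d <;> exact isOpen_lt continuous_const (map_continuous _)

theorem exists_mem_chart (x : G.Space) : ∃ i, x ∈ G.chart i := by
  rcases G.eq_vert_or_pt x with ⟨v, rfl⟩ | ⟨d, t, h0, h1, rfl⟩
  · refine ⟨Sum.inl v, ?_⟩
    change 0 < G.starFun v (G.vert v)
    rw [starFun_vert]
    exact one_pos
  · exact ⟨Sum.inr d, G.bump_pos h0 h1⟩

theorem segProd_of_chart (i : G.V ⊕ G.D) (p : Path x y) (h : ∀ t, p t ∈ G.chart i) :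
    G.SegProd 2 (Path.Homotopic.Quotient.mk p) := by
  rcases i with v | d
  · exact G.segProd_of_star v p h
  · exact (G.segProd_of_openEdge d p h).mono one_le_two

theorem segProd_subpath_of_chart (i : G.V ⊕ G.D) (p : Path x y) {s t : I} (hst : s ≤ t)
    (h : ∀ u ∈ Set.Icc s t, p u ∈ G.chart i) : G.SegProd 2 (Path.Homotopic.Quotient.mk (p.subpath s t)) := by
  refine G.segProd_of_chart i _ fun u => ?_
  have h2 : p.subpath s t u ∈ Set.range (p.subpath s t) := ⟨u, rfl⟩
  rw [Path.range_subpath_of_le _ _ _ hst] at h2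
  obtain ⟨w, hw, hw'⟩ := h2
  rw [← hw']
  exact h w hw

theorem SegProd.cast {k : ℕ} {P : Path.Homotopic.Quotient x y} (h : G.SegProd k P) {x' y' : G.Space}
    (hx : x' = x) (hy : y' = y) : G.SegProd k (P.cast hx hy) := by
  subst hx hy
  simpa using h

theorem mk_eq_subpath (p : Path x y) :
    Path.Homotopic.Quotient.mk p = (Path.Homotopic.Quotient.mk (p.subpath 0 1)).cast p.source.symm p.target.symm := by
  rw [Path.subpath_zero_one, Path.Homotopic.Quotient.mk_cast, Path.Homotopic.Quotient.cast_cast, Path.Homotopic.Quotient.cast_rfl_rfl]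

theorem mk_subpath_trans (p : Path x y) (r s t : I) :
    Path.Homotopic.Quotient.mk (p.subpath r t) = (Path.Homotopic.Quotient.mk (p.subpath r s)).trans
      (Path.Homotopic.Quotient.mk (p.subpath s t)) :=
  (Path.Homotopic.Quotient.eq.2 ⟨Path.Homotopy.subpathTransSubpath p r s t⟩).symm

/-- A subdivision adapted to the cover by charts cuts the path into pieces of at most two segments
each. -/
theorem exists_segProd (P : Path.Homotopic.Quotient x y) : ∃ k, G.SegProd k P := by
  induction P with
  | mk p =>
    obtain ⟨t, ht0, htm, ⟨m, hm⟩, ht⟩ := exists_monotone_Icc_subset_open_cover_unitInterval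
      (c := fun i => p ⁻¹' G.chart i) (fun i => (G.isOpen_chart i).preimage p.continuous)
      (fun u _ => Set.mem_iUnion.2 (G.exists_mem_chart (p u)))
    have key (j : ℕ) : G.SegProd (2 * j) (Path.Homotopic.Quotient.mk (p.subpath (t 0) (t j))) := by
      induction j with
      | zero =>
        rw [Path.subpath_self]
        exact .nil _ _
      | succ j ih =>
        rw [G.mk_subpath_trans p (t 0) (t j)]
        obtain ⟨i, hi⟩ := ht j
        exact ih.trans (G.segProd_subpath_of_chart i p (htm j.le_succ) fun u hu => hi hu)
    have h2 := key m
    rw [ht0, hm m le_rfl] at h2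
    refine ⟨2 * m, ?_⟩
    rw [G.mk_eq_subpath p]
    exact h2.cast G _ _

/-- A path whose interior stays in one open edge is the product of five segments. -/
theorem segProd_of_interior (d : G.D) (p : Path x y)
    (h : ∀ t, 0 < t → t < 1 → 0 < G.bump d (p t)) : G.SegProd 5 (Path.Homotopic.Quotient.mk p) := by
  -- The ends may be vertices, outside the open edge. A short piece at either end lies in one chart
  -- and costs two segments; the middle piece costs one.
  have near (s : I) : ∃ i, ∃ ε > 0, ∀ u : I, |(u : ℝ) - s| < ε → p u ∈ G.chart i := by
    obtain ⟨i, hi⟩ := G.exists_mem_chart (p s)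
    have h1 : p ⁻¹' G.chart i ∈ nhds s :=
      ((G.isOpen_chart i).preimage p.continuous).mem_nhds hi
    obtain ⟨ε, hε, h2⟩ := Metric.mem_nhds_iff.1 h1
    exact ⟨i, ε, hε, fun u hu => h2 hu⟩
  obtain ⟨i, ε, hε, hi⟩ := near 0
  obtain ⟨j, δ, hδ, hj⟩ := near 1
  -- Less than both radii, and at most `1 / 2` so that the cut points `r` and `1 - r` are in order.
  let r : ℝ := min (min ε δ) 1 / 2
  have hr0 : 0 < r := by positivity
  have hr1 : r ≤ 1 / 2 := by
    have : min (min ε δ) 1 ≤ 1 := min_le_right _ _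
    simp only [r]; linarith
  have hrε : r < ε := by
    have h1 : min (min ε δ) 1 ≤ ε := (min_le_left _ _).trans (min_le_left _ _)
    simp only [r] at *; linarith
  have hrδ : r < δ := by
    have h1 : min (min ε δ) 1 ≤ δ := (min_le_left _ _).trans (min_le_right _ _)
    simp only [r] at *; linarith
  clear_value r
  let a : I := ⟨r, by constructor <;> linarith⟩
  let b : I := ⟨1 - r, by constructor <;> linarith⟩
  have hab : a ≤ b := by change r ≤ 1 - r; linarith
  have h1 : G.SegProd 2 (Path.Homotopic.Quotient.mk (p.subpath 0 a)) := by
    refine G.segProd_subpath_of_chart i p unitInterval.nonneg' fun u hu => hi u ?_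
    have : (u : ℝ) ≤ r := hu.2
    rw [Set.Icc.coe_zero, sub_zero, abs_of_nonneg u.2.1]
    linarith
  have h2 : G.SegProd 1 (Path.Homotopic.Quotient.mk (p.subpath a b)) := by
    refine G.segProd_of_openEdge d _ fun u => ?_
    have h2 : p.subpath a b u ∈ Set.range (p.subpath a b) := ⟨u, rfl⟩
    rw [Path.range_subpath_of_le _ _ _ hab] at h2
    obtain ⟨w, hw, hw'⟩ := h2
    rw [← hw']
    refine h w (lt_of_lt_of_le ?_ hw.1) (lt_of_le_of_lt hw.2 ?_)
    · exact hr0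
    · change 1 - r < 1; linarith
  have h3 : G.SegProd 2 (Path.Homotopic.Quotient.mk (p.subpath b 1)) := by
    refine G.segProd_subpath_of_chart j p unitInterval.le_one' fun u hu => hj u ?_
    have h4 : 1 - r ≤ (u : ℝ) := hu.1
    rw [Set.Icc.coe_one, abs_sub_comm, abs_of_nonneg (sub_nonneg.2 u.2.2)]
    linarith
  rw [G.mk_eq_subpath p, G.mk_subpath_trans p 0 b 1, G.mk_subpath_trans p 0 a b]
  exact ((h1.trans h2).trans h3).cast G _ _

theorem exists_edgeWord {u v : G.V} (P : Path.Homotopic.Quotient (G.vert u) (G.vert v)) (hu : ∃ d, G.init d = u)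
    (hv : ∃ d, G.init d = v) : ∃ k, G.EdgeWord k P := by
  obtain ⟨d, rfl⟩ := hu
  obtain ⟨e, rfl⟩ := hv
  obtain ⟨k, hk⟩ := G.exists_segProd P
  have h := hk.edgeWord G d e (G.pt_zero d).symm (G.pt_zero d).symm (G.pt_zero e).symm
    (G.pt_zero e).symm
  rw [seg_self, seg_self, Path.Homotopic.Quotient.trans_refl, Path.Homotopic.Quotient.refl_trans] at h
  exact ⟨_, h⟩

end FinGraph

/-! ### The fundamental group of the rose is generated by its loops -/

theorem loopHom_surjective {n : ℕ} (hn : 0 < n) : Function.Surjective (loopHom (roseLoop n)) := by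
  intro P
  induction P using MulOpposite.rec' with
  | h P =>
  have d : (roseGraph n).D := (⟨0, hn⟩, true)
  obtain ⟨k, hk⟩ := (roseGraph n).exists_edgeWord (u := ()) (v := ()) P ⟨d, rfl⟩ ⟨d, rfl⟩
  have key : ∀ (k : ℕ) (u v : (roseGraph n).V)
      (P : Path.Homotopic.Quotient ((roseGraph n).vert u) ((roseGraph n).vert v)),
      (roseGraph n).EdgeWord k P → ∃ g, loopHom (roseLoop n) g = MulOpposite.op P := by
    intro k u v P h
    induction h with
    | nil k u => exact ⟨1, map_one _⟩
    | @cons k d v P _ ih =>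
      obtain ⟨g, hg⟩ := ih
      obtain ⟨i, b⟩ := d
      cases b
      · refine ⟨(FreeGroup.of i)⁻¹ * g, ?_⟩
        rw [map_mul, hg, map_inv]
        have h1 : (loopHom (roseLoop n) (FreeGroup.of i))⁻¹
            = MulOpposite.op (Path.Homotopic.Quotient.mk (roseLoop n i).symm) := by
          simp only [loopHom, FreeGroup.lift_apply_of]
          rfl
        have h2 : (roseLoop n i).symm = (roseGraph n).edgePath (i, false) := by
          ext t
          exact ((roseGraph n).pt_bar (i, true) t).symm
        rw [h1, h2]
        rfl
      · refine ⟨FreeGroup.of i * g, ?_⟩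
        rw [map_mul, hg]
        simp only [loopHom, FreeGroup.lift_apply_of]
        rfl
  exact key k () () P hk

end OuterSpace

end

/-! ### Free homotopy classes of self-maps of the rose -/

noncomputable section

namespace OuterSpace

/-! ### The covering of the rose whose deck group is the free group -/

variable {n : ℕ}

/-- The group element spelled by an oriented edge of the rose. -/
def letter (d : Fin n × Bool) : FreeGroup (Fin n) := FreeGroup.mk [d]

theorem letter_mul_letter (i : Fin n) (b : Bool) : letter (i, b) * letter (i, !b) = 1 := by
  have h : letter (i, !b) = (letter (i, b))⁻¹ := by
    simp [letter, FreeGroup.inv_mk, FreeGroup.invRev]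
  rw [h, mul_inv_cancel]

theorem letter_true (i : Fin n) : letter (i, true) = FreeGroup.of i := rfl

/-- The disjoint union of the cells of the universal covering of the rose. -/
abbrev CayleyPre (n : ℕ) : Type := Σ _ : FreeGroup (Fin n), (roseGraph n).Pre

/-- The identifications of the cells of the universal covering of the rose. -/
inductive CayleyRel (n : ℕ) : CayleyPre n → CayleyPre n → Prop
  | bar (g : FreeGroup (Fin n)) (d : Fin n × Bool) (t : I) :
      CayleyRel n ⟨g, Sum.inr ⟨d, t⟩⟩ ⟨g * letter d, Sum.inr ⟨(d.1, !d.2), σ t⟩⟩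
  | init (g : FreeGroup (Fin n)) (d : Fin n × Bool) :
      CayleyRel n ⟨g, Sum.inr ⟨d, 0⟩⟩ ⟨g, Sum.inl ⟨(), ()⟩⟩

/-- The Cayley graph of the free group, as a space over the rose. -/
def Cayley (n : ℕ) : Type := Quot (CayleyRel n)

namespace Cayley

instance : TopologicalSpace (Cayley n) := inferInstanceAs (TopologicalSpace (Quot (CayleyRel n)))

instance : MulAction (FreeGroup (Fin n)) (Cayley n) where
  smul h := Quot.map (fun z => ⟨h * z.1, z.2⟩) (by
    rintro _ _ (⟨g, d, t⟩ | ⟨g, d⟩)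
    · rw [← mul_assoc]; exact .bar _ d t
    · exact .init _ d)
  one_smul x := by
    induction x using Quot.ind with
    | mk z =>
      change Quot.mk _ (⟨1 * z.1, z.2⟩ : CayleyPre n) = _
      rw [one_mul]
  mul_smul g h x := by
    induction x using Quot.ind with
    | mk z =>
      change Quot.mk _ (⟨g * h * z.1, z.2⟩ : CayleyPre n) = Quot.mk _ ⟨g * (h * z.1), z.2⟩
      rw [mul_assoc]

/-- The image of a point of a cell. -/
def pt (g : FreeGroup (Fin n)) (z : (roseGraph n).Pre) : Cayley n := Quot.mk _ ⟨g, z⟩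

theorem smul_pt (h g : FreeGroup (Fin n)) (z : (roseGraph n).Pre) : h • pt g z = pt (h * g) z := rfl

theorem continuous_pt (g : FreeGroup (Fin n)) : Continuous (pt g) :=
  continuous_quot_mk.comp continuous_sigmaMk

instance : ContinuousConstSMul (FreeGroup (Fin n)) (Cayley n) where
  continuous_const_smul h :=
    continuous_quot_lift _ (continuous_sigma fun g => continuous_pt (h * g))

/-- The covering projection. -/
def proj (n : ℕ) : Cayley n → Rose n :=
  Quot.lift (fun z => Quot.mk _ z.2) (by
    rintro _ _ (⟨g, d, t⟩ | ⟨g, d⟩)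
    · exact Quot.sound (FinGraph.Rel.bar (G := roseGraph n) d t)
    · exact Quot.sound (FinGraph.Rel.init (G := roseGraph n) d))

theorem isQuotientMap_proj : Topology.IsQuotientMap (proj n) := by
  have h1 : Continuous fun z : CayleyPre n => z.2 := continuous_sigma fun g => continuous_id
  have h0 : Continuous fun z => (⟨1, z⟩ : CayleyPre n) :=
    @continuous_sigmaMk _ (fun _ : FreeGroup (Fin n) => (roseGraph n).Pre) _ 1
  have h2 : Topology.IsQuotientMap fun z : CayleyPre n => z.2 :=
    Topology.IsQuotientMap.of_inverse (f := fun z => (⟨1, z⟩ : CayleyPre n))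
      h0 h1 fun z => rfl
  have h3 : Topology.IsQuotientMap (Quot.mk (roseGraph n).Rel) := isQuotientMap_quot_mk
  have h4 := h3.comp h2
  have h5 : Continuous (proj n) := continuous_quot_lift _ h4.continuous
  exact Topology.IsQuotientMap.of_comp (continuous_quot_mk (r := CayleyRel n)) h5 h4

/-- Each elementary identification of the rose lifts to every sheet, with a possible change of
sheet. Induction over the generated equivalence shows that the fibres of `proj` are the orbits. -/
theorem exists_pt_eq_pt {a b : (roseGraph n).Pre} (h : Relation.EqvGen (roseGraph n).Rel a b) :
    (∀ g, ∃ g', pt g a = pt g' b) ∧ ∀ g, ∃ g', pt g b = pt g' a := by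
  induction h with
  | rel a b h =>
    cases h with
    | bar d t =>
      refine ⟨fun g => ⟨_, Quot.sound (.bar g d t)⟩, fun g => ⟨g * letter ((roseGraph n).bar d), ?_⟩⟩
      have h := Quot.sound (CayleyRel.bar (g * letter ((roseGraph n).bar d)) d t)
      refine Eq.trans ?_ h.symm
      have h2 : g * letter ((roseGraph n).bar d) * letter d = g := by
        have := letter_mul_letter d.1 (!d.2)
        rw [Bool.not_not] at this
        rw [mul_assoc]
        exact (congrArg (g * ·) this).trans (mul_one g)
      rw [h2]
      rfl
    | init d =>
      exact ⟨fun g => ⟨_, Quot.sound (.init g d)⟩, fun g => ⟨_, (Quot.sound (.init g d)).symm⟩⟩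
  | refl a => exact ⟨fun g => ⟨g, rfl⟩, fun g => ⟨g, rfl⟩⟩
  | symm a b _ ih => exact ⟨ih.2, ih.1⟩
  | trans a b c _ _ ih1 ih2 =>
    constructor
    · intro g
      obtain ⟨g', h'⟩ := ih1.1 g
      obtain ⟨g'', h''⟩ := ih2.1 g'
      exact ⟨g'', h'.trans h''⟩
    · intro g
      obtain ⟨g', h'⟩ := ih2.2 g
      obtain ⟨g'', h''⟩ := ih1.2 g'
      exact ⟨g'', h'.trans h''⟩

theorem proj_eq_iff {x y : Cayley n} :
    proj n x = proj n y ↔ x ∈ MulAction.orbit (FreeGroup (Fin n)) y := by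
  induction x using Quot.ind with
  | mk z =>
  obtain ⟨g, z⟩ := z
  induction y using Quot.ind with
  | mk w =>
  obtain ⟨h, w⟩ := w
  constructor
  · intro e
    obtain ⟨g', h'⟩ := (exists_pt_eq_pt (Quot.eqvGen_exact e)).1 g
    refine ⟨g' * h⁻¹, ?_⟩
    change pt (g' * h⁻¹ * h) w = pt g z
    rw [inv_mul_cancel_right, h']
  · rintro ⟨k, hk⟩
    change pt (k * h) w = pt g z at hk
    exact (congrArg (proj n) hk).symm

open Classical in
/-- A function that is positive exactly near the vertex `g`. -/
def starFun (g : FreeGroup (Fin n)) : C(Cayley n, ℝ) where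
  toFun := Quot.lift (fun z : CayleyPre n => match z with
      | ⟨h, Sum.inl _⟩ => if h = g then 1 else 0
      | ⟨h, Sum.inr z⟩ => (if h = g then max (1 - 3 * (z.2 : ℝ)) 0 else 0) +
          if h * letter z.1 = g then max (1 - 3 * (σ z.2 : ℝ)) 0 else 0) (by
    rintro _ _ (⟨h, ⟨i, b⟩, t⟩ | ⟨h, d⟩)
    · simp only [mul_assoc, letter_mul_letter, mul_one, unitInterval.symm_symm]
      exact add_comm _ _
    · simp)
  continuous_toFun := by
    refine continuous_quot_lift _ (continuous_sigma fun h => continuous_sum_dom.2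
      ⟨(continuous_const : Continuous fun _ => if h = g then (1 : ℝ) else 0),
        continuous_sigma fun d => ?_⟩)
    change Continuous fun t : I => (if h = g then max (1 - 3 * (t : ℝ)) 0 else 0) +
          if h * letter d = g then max (1 - 3 * (σ t : ℝ)) 0 else 0
    split_ifs <;> fun_prop

theorem starFun_smul (h g : FreeGroup (Fin n)) (x : Cayley n) :
    starFun (h * g) (h • x) = starFun g x := by
  induction x using Quot.ind with
  | mk z =>
    rcases z with ⟨k, v | ⟨d, t⟩⟩
    · change (if h * k = h * g then _ else _) = if k = g then _ else _
      simp
    · change (if h * k = h * g then max (1 - 3 * (t : ℝ)) 0 else 0)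
          + (if h * k * letter d = h * g then max (1 - 3 * (σ t : ℝ)) 0 else 0)
        = (if k = g then max (1 - 3 * (t : ℝ)) 0 else 0)
          + if k * letter d = g then max (1 - 3 * (σ t : ℝ)) 0 else 0
      simp [mul_assoc]

/-- Stars reach only a third of the way along an edge, so at every point one of the two end terms
vanishes. -/
theorem eq_of_starFun_pos {g g' : FreeGroup (Fin n)} {x : Cayley n} (h : 0 < starFun g x)
    (h' : 0 < starFun g' x) : g = g' := by
  classical
  induction x using Quot.ind with
  | mk z =>
    rcases z with ⟨k, v | ⟨d, t⟩⟩
    · change (0 : ℝ) < if k = g then _ else _ at h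
      change (0 : ℝ) < if k = g' then _ else _ at h'
      split_ifs at h h' with h1 h2
      · rw [← h1, h2]
      all_goals simp at h h'
    · change 0 < (if k = g then max (1 - 3 * (t : ℝ)) 0 else 0)
        + if k * letter d = g then max (1 - 3 * (σ t : ℝ)) 0 else 0 at h
      change 0 < (if k = g' then max (1 - 3 * (t : ℝ)) 0 else 0)
        + if k * letter d = g' then max (1 - 3 * (σ t : ℝ)) 0 else 0 at h'
      rcases le_or_gt (1 / 2 : ℝ) t with ht | ht
      · have e : max (1 - 3 * (t : ℝ)) 0 = 0 := max_eq_right (by linarith)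
        rw [e, ite_self, zero_add] at h h'
        split_ifs at h h' with h1 h2
        · rw [← h1, h2]
        all_goals simp at h h'
      · have e : max (1 - 3 * (σ t : ℝ)) 0 = 0 :=
          max_eq_right (by rw [unitInterval.coe_symm_eq]; linarith)
        rw [e, ite_self, add_zero] at h h'
        split_ifs at h h' with h1 h2
        · rw [← h1, h2]
        all_goals simp at h h'

open Classical in
/-- A function that is positive exactly in the interior of the edge `i` that starts at `g`. -/
def bump (g : FreeGroup (Fin n)) (i : Fin n) : C(Cayley n, ℝ) where
  toFun := Quot.lift (fun z : CayleyPre n => match z with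
      | ⟨_, Sum.inl _⟩ => 0
      | ⟨h, Sum.inr z⟩ => if z.1.1 = i ∧ (if z.1.2 then h else h * letter z.1) = g then
          (z.2 : ℝ) * (1 - z.2) else 0) (by
    rintro _ _ (⟨h, ⟨i, b⟩, t⟩ | ⟨h, d⟩)
    · have := letter_mul_letter i b
      cases b <;> simp_all [mul_assoc, mul_comm]
    · simp)
  continuous_toFun := by
    refine continuous_quot_lift _ (continuous_sigma fun h => continuous_sum_dom.2
      ⟨(continuous_const : Continuous fun _ => (0 : ℝ)),
        continuous_sigma fun d => ?_⟩)
    change Continuous fun t : I => if d.1 = i ∧ (if d.2 then h else h * letter d) = g then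
          (t : ℝ) * (1 - t) else 0
    split_ifs <;> fun_prop

theorem bump_smul (h g : FreeGroup (Fin n)) (i : Fin n) (x : Cayley n) :
    bump (h * g) i (h • x) = bump g i x := by
  induction x using Quot.ind with
  | mk z =>
    rcases z with ⟨k, v | ⟨⟨j, b⟩, t⟩⟩
    · rfl
    · change (if j = i ∧ (if b then h * k else h * k * letter (j, b)) = h * g then _ else _)
        = if j = i ∧ (if b then k else k * letter (j, b)) = g then _ else _
      cases b <;> simp [mul_assoc]

theorem eq_of_bump_pos {g g' : FreeGroup (Fin n)} {i : Fin n} {x : Cayley n} (h : 0 < bump g i x)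
    (h' : 0 < bump g' i x) : g = g' := by
  classical
  induction x using Quot.ind with
  | mk z =>
    rcases z with ⟨k, v | ⟨⟨j, b⟩, t⟩⟩
    · exact absurd h (lt_irrefl _)
    · change (0 : ℝ) < if j = i ∧ (if b then k else k * letter (j, b)) = g then _ else _ at h
      change (0 : ℝ) < if j = i ∧ (if b then k else k * letter (j, b)) = g' then _ else _ at h'
      by_cases h1 : j = i ∧ (if b then k else k * letter (j, b)) = g
      · by_cases h2 : j = i ∧ (if b then k else k * letter (j, b)) = g'
        · rw [← h1.2, h2.2]
        · rw [if_neg h2] at h'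
          exact absurd h' (lt_irrefl _)
      · rw [if_neg h1] at h
        exact absurd h (lt_irrefl _)

/-- Every point lies in a vertex star or in an open edge, and each of these is disjoint from its
nontrivial translates, by equivariance of `starFun` and `bump`. -/
theorem isQuotientCoveringMap_proj : IsQuotientCoveringMap (proj n) (FreeGroup (Fin n)) where
  __ := isQuotientMap_proj
  continuous_const_smul := continuous_const_smul
  apply_eq_iff_mem_orbit := proj_eq_iff
  disjoint x := by
    have key : (∃ g, 0 < starFun g x) ∨ ∃ g i, 0 < bump g i x := by
      induction x using Quot.ind with
      | mk z =>
        rcases z with ⟨k, v | ⟨⟨j, b⟩, t⟩⟩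
        · left
          refine ⟨k, ?_⟩
          change (0 : ℝ) < if k = k then 1 else 0
          simp
        · have hbump (h0 : 0 < t) (h1 : t < 1) :
              ∃ g i, 0 < bump g i (Quot.mk (CayleyRel n) ⟨k, Sum.inr ⟨(j, b), t⟩⟩) := by
            refine ⟨if b then k else k * letter (j, b), j, ?_⟩
            change (0 : ℝ) < if j = j ∧ (if b then k else k * letter (j, b)) =
              (if b then k else k * letter (j, b)) then (t : ℝ) * (1 - t) else 0
            rw [if_pos ⟨rfl, rfl⟩]
            exact FinGraph.unit_mul_pos h0 h1
          rcases eq_or_ne t 0 with rfl | h0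
          · left
            refine ⟨k, ?_⟩
            change 0 < (if k = k then max (1 - 3 * ((0 : I) : ℝ)) 0 else 0)
              + if k * letter (j, b) = k then max (1 - 3 * (σ (0 : I) : ℝ)) 0 else 0
            simp
          rcases eq_or_ne t 1 with rfl | h1
          · left
            refine ⟨k * letter (j, b), ?_⟩
            change 0 < (if k = k * letter (j, b) then max (1 - 3 * ((1 : I) : ℝ)) 0 else 0)
              + if k * letter (j, b) = k * letter (j, b) then max (1 - 3 * (σ (1 : I) : ℝ)) 0 else 0
            simp
          · exact Or.inr (hbump (unitInterval.pos_iff_ne_zero.2 h0)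
              (unitInterval.lt_one_iff_ne_one.2 h1))
    rcases key with ⟨g, hg⟩ | ⟨g, i, hg⟩
    · refine ⟨{y | 0 < starFun g y}, (isOpen_lt continuous_const (map_continuous _)).mem_nhds hg, ?_⟩
      rintro h ⟨_, ⟨y, hy, rfl⟩, hy'⟩
      have h1 : 0 < starFun (h * g) (h • y) := by rwa [starFun_smul]
      simpa using eq_of_starFun_pos h1 hy'
    · refine ⟨{y | 0 < bump g i y}, (isOpen_lt continuous_const (map_continuous _)).mem_nhds hg, ?_⟩
      rintro h ⟨_, ⟨y, hy, rfl⟩, hy'⟩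
      have h1 : 0 < bump (h * g) i (h • y) := by rwa [bump_smul]
      simpa using eq_of_bump_pos h1 hy'

/-- The vertex `g` of the Cayley graph, in the fibre over the vertex of the rose. -/
def fiberPt (g : FreeGroup (Fin n)) : proj n ⁻¹' {roseBase n} := ⟨pt g (Sum.inl ⟨(), ()⟩), rfl⟩

/-- The edge of the Cayley graph from `1` to `s_i`. -/
def edge (i : Fin n) : Path (fiberPt (n := n) 1).1 (fiberPt (FreeGroup.of i)).1 where
  toFun t := pt 1 (Sum.inr ⟨(i, true), t⟩)
  continuous_toFun := (continuous_pt 1).comp (continuous_inr.comp continuous_sigmaMk)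
  source' := Quot.sound (.init 1 (i, true))
  target' := by
    have h1 := Quot.sound (CayleyRel.bar 1 (i, true) (1 : I))
    have h2 := Quot.sound (CayleyRel.init (1 * letter (i, true)) (i, false))
    rw [unitInterval.symm_one] at h1
    refine (h1.trans h2).trans ?_
    rw [one_mul, letter_true]
    rfl

/-- The homomorphism from the fundamental group of the rose to the free group. -/
def deckHom (n : ℕ) : (FundamentalGroup (Rose n) (roseBase n))ᵐᵒᵖ →* FreeGroup (Fin n) where
  toFun γ := (isQuotientCoveringMap_proj.fundamentalGroupToMulOpposite (fiberPt 1) γ.unop).unop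
  map_one' := congrArg MulOpposite.unop (map_one _)
  map_mul' a b := congrArg MulOpposite.unop (map_mul _ b.unop a.unop)

/-- The lift of the loop `e_i` that starts at the vertex `1` is `edge i`, which ends at the
translate of that vertex by `s_i`. -/
theorem deckHom_loop (i : Fin n) :
    deckHom n (MulOpposite.op (Path.Homotopic.Quotient.mk (roseLoop n i))) = FreeGroup.of i := by
  apply MulOpposite.op_injective
  refine isQuotientCoveringMap_proj.fundamentalGroupToMulOpposite_apply_eq_Iff.2 ?_
  have h := isQuotientCoveringMap_proj.isCoveringMap.monodromy_eq_of_map_eq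
    (γ := Path.Homotopic.Quotient.mk (roseLoop n i)) (ex := fiberPt 1)
    (ey := fiberPt (FreeGroup.of i)) (Path.Homotopic.Quotient.mk (edge i)) rfl
  refine Eq.trans ?_ (congrArg Subtype.val h).symm
  change FreeGroup.of i • pt 1 (Sum.inl ⟨(), ()⟩) = pt (FreeGroup.of i) (Sum.inl ⟨(), ()⟩)
  rw [smul_pt, mul_one]

end Cayley

theorem deckHom_comp_loopHom : (Cayley.deckHom n).comp (loopHom (roseLoop n)) = MonoidHom.id _ := by
  ext i
  simp only [loopHom, MonoidHom.comp_apply, FreeGroup.lift_apply_of, Cayley.deckHom_loop,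
    MonoidHom.id_apply]

theorem loopHom_injective : Function.Injective (loopHom (roseLoop n)) :=
  Function.LeftInverse.injective (g := Cayley.deckHom n)
    fun g => DFunLike.congr_fun deckHom_comp_loopHom g

/-! ### Self-maps of the rose -/

/-- The self-map of the rose that is given by an endomorphism of the free group. -/
def roseEndo (φ : FreeGroup (Fin n) →* FreeGroup (Fin n)) : C(Rose n, Rose n) :=
  roseMap fun i => wordLoop (roseLoop n) (φ (FreeGroup.of i)).toWord

theorem loopHom_roseEndo (φ : FreeGroup (Fin n) →* FreeGroup (Fin n)) :
    loopHom (fun i => wordLoop (roseLoop n) (φ (FreeGroup.of i)).toWord)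
      = (loopHom (roseLoop n)).comp φ := by
  ext i
  change loopHom _ (FreeGroup.of i) = loopHom (roseLoop n) (φ (FreeGroup.of i))
  rw [loopHom_apply (roseLoop n)]
  simp [loopHom]

theorem roseEndo_comp (φ ψ : FreeGroup (Fin n) →* FreeGroup (Fin n)) :
    ((roseEndo φ).comp (roseEndo ψ)).Homotopic (roseEndo (φ.comp ψ)) := by
  let p : Fin n → Path (roseBase n) (roseBase n) :=
    fun i => wordLoop (roseLoop n) (φ (FreeGroup.of i)).toWord
  have h1 : (roseEndo φ).comp (roseEndo ψ)
      = roseMap (x := roseBase n) fun i => wordLoop p (ψ (FreeGroup.of i)).toWord := by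
    refine ContinuousMap.coe_injective (rose_hom_ext rfl fun i t => ?_)
    exact congrArg (fun q : Path (roseBase n) (roseBase n) => q t)
      (wordLoop_map (roseLoop n) (roseEndo φ) (ψ (FreeGroup.of i)).toWord)
  rw [h1]
  refine roseMap_homotopic_of_loopHom ?_
  rw [loopHom_roseEndo]
  ext i
  have h2 : loopHom (fun i => wordLoop p (ψ (FreeGroup.of i)).toWord) (FreeGroup.of i)
      = loopHom p (ψ (FreeGroup.of i)) := by
    rw [loopHom_apply p]; simp [loopHom]
  refine h2.trans ?_
  have h3 : loopHom p = (loopHom (roseLoop n)).comp φ := loopHom_roseEndo φ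
  rw [h3]
  rfl

/-- Since `loopHom (roseLoop n)` is an isomorphism, any family of loops is given by words up to
homotopy. -/
theorem exists_roseEndo_of_roseMap (hn : 0 < n) (p : Fin n → Path (roseBase n) (roseBase n)) :
    ∃ φ, (roseMap p).Homotopic (roseEndo φ) := by
  let e : FreeGroup (Fin n) ≃* (FundamentalGroup (Rose n) (roseBase n))ᵐᵒᵖ :=
    MulEquiv.ofBijective (loopHom (roseLoop n)) ⟨loopHom_injective, loopHom_surjective hn⟩
  refine ⟨(e.symm : _ →* _).comp (loopHom p), roseMap_homotopic_of_loopHom ?_⟩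
  rw [loopHom_roseEndo]
  ext g
  exact (e.apply_symm_apply _).symm

/-- A free homotopy moves the base point around a loop. The group element `g` of this loop
intertwines the two endomorphisms. -/
theorem conj_of_roseEndo_homotopic (hn : 0 < n) {φ ψ : FreeGroup (Fin n) →* FreeGroup (Fin n)}
    (h : (roseEndo φ).Homotopic (roseEndo ψ)) : ∃ g, ∀ x, φ x * g = g * ψ x := by
  obtain ⟨H⟩ := h
  obtain ⟨g, hg⟩ := loopHom_surjective hn
    (MulOpposite.op (Path.Homotopic.Quotient.mk (H.evalAt (roseBase n))))
  have key (i : Fin n) : φ (FreeGroup.of i) * g = g * ψ (FreeGroup.of i) := by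
    apply loopHom_injective
    have h1 := Path.Homotopic.Quotient.eq.2 (Path.Homotopic.map_trans_evalAt H (roseLoop n i))
    rw [map_mul, map_mul, hg, loopHom_apply, loopHom_apply]
    exact congrArg MulOpposite.op h1
  refine ⟨g, fun x => ?_⟩
  have h2 : φ = (MulAut.conj g).toMonoidHom.comp ψ := by
    ext i
    change φ (FreeGroup.of i) = g * ψ (FreeGroup.of i) * g⁻¹
    rw [← key, mul_inv_cancel_right]
  rw [h2]
  change g * ψ x * g⁻¹ * g = _
  rw [inv_mul_cancel_right]

theorem FinGraph.exists_path_to_vert (G : FinGraph) (x : G.Space) : ∃ v, Nonempty (Path x (G.vert v)) := by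
  rcases G.eq_vert_or_pt x with ⟨v, rfl⟩ | ⟨d, t, -, -, rfl⟩
  · exact ⟨v, ⟨Path.refl _⟩⟩
  · exact ⟨G.init d, ⟨((unitLine t 0).map (G.continuous_pt d)).cast rfl (G.pt_zero d).symm⟩⟩

theorem conj_class {X : Type*} [TopologicalSpace X] {x y x' y' : X}
    (a : Path.Homotopic.Quotient x y) (γ : Path.Homotopic.Quotient x x')
    (δ : Path.Homotopic.Quotient y y') : a.trans δ = γ.trans ((γ.symm.trans a).trans δ) := by
  rw [← Path.Homotopic.Quotient.trans_assoc, ← Path.Homotopic.Quotient.trans_assoc,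
    Path.Homotopic.Quotient.trans_symm, Path.Homotopic.Quotient.refl_trans]

/-- Sliding the image of the vertex along `γ` replaces each image loop by its conjugate. -/
theorem exists_homotopic_roseMap {X : Type*} [TopologicalSpace X] (f : C(Rose n, X)) {x : X}
    (γ : Path (f (roseBase n)) x) :
    ∃ p : Fin n → Path x x, f.Homotopic (roseMap p) := by
  let p : Fin n → Path x x := fun i => (γ.symm.trans ((roseLoop n i).map f.continuous)).trans γ
  refine ⟨p, FinGraph.homotopic_of_edgeClass (roseGraph n)
    (fun _ => Path.Homotopic.Quotient.mk γ) ?_⟩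
  rintro ⟨i, b⟩
  cases b
  · have h1 : (roseGraph n).edgeClass f (i, false)
        = Path.Homotopic.Quotient.mk ((roseLoop n i).map f.continuous).symm :=
      congrArg Path.Homotopic.Quotient.mk ((roseGraph n).edgeImage_bar f (i, true))
    have h2 : (roseGraph n).edgeClass (roseMap p) (i, false) = Path.Homotopic.Quotient.mk (p i).symm :=
      congrArg Path.Homotopic.Quotient.mk ((roseGraph n).edgeImage_bar (roseMap p) (i, true))
    rw [h1, h2, Path.Homotopic.Quotient.eq.2 (show (p i).symm.Homotopic
      (γ.symm.trans (((roseLoop n i).map f.continuous).symm.trans γ)) by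
        simp only [p, Path.trans_symm, Path.symm_symm]; rfl)]
    exact (conj_class _ _ _).trans (congrArg _ (Path.Homotopic.Quotient.trans_assoc _ _ _))
  · have h2 : (roseGraph n).edgeClass (roseMap p) (i, true) = Path.Homotopic.Quotient.mk (p i) := rfl
    have h1 : (roseGraph n).edgeClass f (i, true)
        = Path.Homotopic.Quotient.mk ((roseLoop n i).map f.continuous) := rfl
    rw [h1, h2]
    exact conj_class _ _ _

theorem exists_homotopic_roseEndo (hn : 0 < n) (f : C(Rose n, Rose n)) :
    ∃ φ, f.Homotopic (roseEndo φ) := by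
  obtain ⟨⟨⟩, ⟨γ⟩⟩ := (roseGraph n).exists_path_to_vert (f (roseBase n))
  obtain ⟨p, hp⟩ := exists_homotopic_roseMap f γ
  obtain ⟨φ, hφ⟩ := exists_roseEndo_of_roseMap hn p
  exact ⟨φ, hp.trans hφ⟩

theorem roseEndo_id : (roseEndo (MonoidHom.id (FreeGroup (Fin n)))).Homotopic
    (ContinuousMap.id _) := autMap_one

/-- Every self homotopy equivalence of the rose comes from an automorphism of the free group. -/
theorem exists_autMap (hn : 0 < n) (e : ContinuousMap.HomotopyEquiv (Rose n) (Rose n)) :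
    ∃ Φ : MulAut (FreeGroup (Fin n)), e.toFun.Homotopic (autMap Φ) := by
  obtain ⟨φ, hφ⟩ := exists_homotopic_roseEndo hn e.toFun
  obtain ⟨ψ, hψ⟩ := exists_homotopic_roseEndo hn e.invFun
  have h1 : (roseEndo (ψ.comp φ)).Homotopic (roseEndo (MonoidHom.id _)) :=
    (roseEndo_comp ψ φ).symm.trans (((hψ.symm.comp hφ.symm).trans e.left_inv).trans
      roseEndo_id.symm)
  have h2 : (roseEndo (φ.comp ψ)).Homotopic (roseEndo (MonoidHom.id _)) :=
    (roseEndo_comp φ ψ).symm.trans (((hφ.symm.comp hψ.symm).trans e.right_inv).trans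
      roseEndo_id.symm)
  obtain ⟨g, hg⟩ := conj_of_roseEndo_homotopic hn h1
  obtain ⟨k, hk⟩ := conj_of_roseEndo_homotopic hn h2
  -- The composites of `φ` and `ψ` are only conjugate to the identity, since the homotopies are
  -- free; this still makes `φ` bijective.
  have hinj : Function.Injective φ := by
    intro x y hxy
    have hx := hg x
    rw [MonoidHom.comp_apply, hxy, ← MonoidHom.comp_apply, hg y] at hx
    exact (mul_left_cancel hx).symm
  have hsurj : Function.Surjective φ := by
    intro x
    refine ⟨ψ (k⁻¹ * x * k), ?_⟩
    have hx := hk (k⁻¹ * x * k)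
    rw [MonoidHom.id_apply, MonoidHom.comp_apply] at hx
    have : k * (k⁻¹ * x * k) = x * k := by group
    rw [this] at hx
    exact mul_right_cancel hx
  exact ⟨MulEquiv.ofBijective φ ⟨hinj, hsurj⟩, hφ⟩

theorem mk_eq_mk_of_autMap_homotopic (hn : 0 < n) {Φ Ψ : MulAut (FreeGroup (Fin n))}
    (h : (autMap Φ).Homotopic (autMap Ψ)) : (Φ : OutFree n) = (Ψ : OutFree n) := by
  obtain ⟨g, hg⟩ := conj_of_roseEndo_homotopic hn (φ := Φ.toMonoidHom) (ψ := Ψ.toMonoidHom) h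
  have h1 : MulAut.conj g * Ψ = Φ := by
    ext x
    change g * Ψ x * g⁻¹ = Φ x
    have := hg x
    change Φ x * g = g * Ψ x at this
    rw [← this, mul_inv_cancel_right]
  rw [← h1]
  have h2 : MulAut.conj g * Ψ = Ψ * MulAut.conj (Ψ⁻¹ g) := by
    ext x
    change g * Ψ x * g⁻¹ = Ψ (Ψ⁻¹ g * x * (Ψ⁻¹ g)⁻¹)
    simp
  rw [h2, QuotientGroup.mk_mul,
    (QuotientGroup.eq_one_iff _).2 (MonoidHom.mem_range.2 ⟨Ψ⁻¹ g, rfl⟩), mul_one]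

end OuterSpace

end

/-! ### Forest collapses are determined up to homotopy by finite data -/

noncomputable section

namespace OuterSpace

/-! ### Collapse maps up to homotopy -/

/-- By the intermediate value theorem the arm that climbs higher passes the height at which the
other one ends. -/
theorem false_of_two_arms {c : ℝ} {f g : I → ℝ} (hf : Continuous f) (hg : Continuous g)
    (hf0 : f 0 = c) (hg0 : g 0 = c) (hf1 : c < f 1) (hg1 : c < g 1)
    (h : ∀ s t, 0 < s → 0 < t → f s ≠ g t) : False := by
  wlog hle : f 1 ≤ g 1 generalizing f g
  · exact this hg hf hg0 hf0 hg1 hf1 (fun s t hs ht e => h t s ht hs e.symm) (not_le.1 hle).le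
  have h2 := intermediate_value_univ (0 : I) 1 hg
  rw [hg0] at h2
  obtain ⟨s, hs⟩ := h2 ⟨hf1.le, hle⟩
  refine h 1 s zero_lt_one (unitInterval.pos_iff_ne_zero.2 ?_) hs.symm
  rintro rfl
  rw [hg0] at hs
  exact hf1.ne hs

/-- Of three arms that leave a point of the line, two end on the same side of it. This is the
obstruction to embedding a tripod in an interval. -/
theorem false_of_three_arms {c : ℝ} {f : Fin 3 → I → ℝ} (hf : ∀ j, Continuous (f j))
    (hf0 : ∀ j, f j 0 = c) (hf1 : ∀ j, f j 1 ≠ c)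
    (h : ∀ j k, j ≠ k → ∀ s t, 0 < s → 0 < t → f j s ≠ f k t) : False := by
  obtain ⟨j, k, hjk, hb⟩ := Fintype.exists_ne_map_eq_of_card_lt
    (fun j : Fin 3 => decide (c < f j 1)) (by simp)
  have hb' : c < f j 1 ↔ c < f k 1 := by simpa using hb
  by_cases hj : c < f j 1
  · exact false_of_two_arms (hf j) (hf k) (hf0 j) (hf0 k) hj (hb'.1 hj) (h j k hjk)
  · have hk := fun hk => hj (hb'.2 hk)
    refine false_of_two_arms (c := -c) (hf j).neg (hf k).neg (by simp [hf0]) (by simp [hf0])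
      ?_ ?_ fun s t hs ht e => h j k hjk s t hs ht (neg_injective e)
    · exact neg_lt_neg (lt_of_le_of_ne (not_lt.1 hj) (hf1 j))
    · exact neg_lt_neg (lt_of_le_of_ne (not_lt.1 hk) (hf1 k))

namespace FinGraph

variable {G G' : FinGraph}

/-- The condition on the fibres in the definition of a forest collapse. -/
def HasCollapseFibers (q : C(G.Space, G'.Space)) (S : Set G.D) : Prop :=
  ∀ y : G'.Space, (∃ x ∉ G.edgeUnion S, q ⁻¹' {y} = {x}) ∨
    (∃ x ∈ G.edgeUnion S, q ⁻¹' {y} = connectedComponentIn (G.edgeUnion S) x)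

/-- A closed edge of the forest is connected, hence lies in one component of the forest, and this
component is a fibre. -/
theorem HasCollapseFibers.const {q : C(G.Space, G'.Space)} {S : Set G.D}
    (h : HasCollapseFibers q S) {d : G.D} (hd : d ∈ S) (s t : I) :
    q (G.pt d s) = q (G.pt d t) := by
  have hmem : G.pt d t ∈ G.edgeUnion S := ⟨d, hd, t, rfl⟩
  have hfib : G.pt d t ∈ q ⁻¹' {q (G.pt d t)} := rfl
  rcases h (q (G.pt d t)) with ⟨x, hx, he⟩ | ⟨x, hx, he⟩
  · rw [he] at hfib
    exact absurd (hfib ▸ hmem) hx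
  · rw [he] at hfib
    have h1 : Set.range (G.pt d) ⊆ connectedComponentIn (G.edgeUnion S) (G.pt d t) :=
      (isPreconnected_range (G.continuous_pt d)).subset_connectedComponentIn ⟨t, rfl⟩ (by
        rintro _ ⟨u, rfl⟩
        exact ⟨d, hd, u, rfl⟩)
    rw [← connectedComponentIn_eq hfib, ← he] at h1
    exact h1 ⟨s, rfl⟩

theorem pt_notMem_edgeUnion {S : Set G.D} (hS : ∀ d ∈ S, G.bar d ∈ S) {d : G.D} (hd : d ∉ S)
    {t : I} (h0 : 0 < t) (h1 : t < 1) : G.pt d t ∉ G.edgeUnion S := by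
  rintro ⟨e, he, s, hs⟩
  rcases G.eq_of_pt_eq_pt h0 h1 hs.symm with ⟨rfl, -⟩ | ⟨rfl, -⟩
  · exact hd he
  · exact hd (by simpa [G.bar_bar] using hS _ he)

theorem HasCollapseFibers.eq_of_eq {q : C(G.Space, G'.Space)} {S : Set G.D}
    (h : HasCollapseFibers q S) (hS : ∀ d ∈ S, G.bar d ∈ S) {d : G.D} (hd : d ∉ S)
    {t : I} (h0 : 0 < t) (h1 : t < 1) {x : G.Space} (hx : q x = q (G.pt d t)) : x = G.pt d t := by
  have hmem := pt_notMem_edgeUnion hS hd h0 h1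
  have hfib : G.pt d t ∈ q ⁻¹' {q (G.pt d t)} := rfl
  have hfib' : x ∈ q ⁻¹' {q (G.pt d t)} := hx
  rcases h (q (G.pt d t)) with ⟨z, hz, he⟩ | ⟨z, hz, he⟩
  · rw [he] at hfib hfib'
    rw [Set.mem_singleton_iff] at hfib hfib'
    rw [hfib, hfib']
  · rw [he] at hfib
    exact absurd (connectedComponentIn_subset _ _ hfib) hmem

theorem HasCollapseFibers.surjective {q : C(G.Space, G'.Space)} {S : Set G.D}
    (h : HasCollapseFibers q S) : Function.Surjective q := by
  intro y
  rcases h y with ⟨x, -, he⟩ | ⟨x, hx, he⟩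
  · have : x ∈ q ⁻¹' {y} := by rw [he]; rfl
    exact ⟨x, this⟩
  · have : x ∈ q ⁻¹' {y} := by rw [he]; exact mem_connectedComponentIn hx
    exact ⟨x, this⟩

variable (G) in
theorem isOpen_image_pt (d : G.D) {V : Set I} (hV : IsOpen V) :
    IsOpen {x | ∃ t, 0 < t ∧ t < 1 ∧ t ∈ V ∧ x = G.pt d t} := by
  have h1 : ContinuousOn (fun x => Set.projIcc (0 : ℝ) 1 zero_le_one (G.edgeCoord d x))
      {x | 0 < G.bump d x} := continuous_projIcc.comp_continuousOn (G.continuousOn_edgeCoord d)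
  convert h1.isOpen_inter_preimage (G.isOpen_bump_pos d) hV using 1
  ext x
  constructor
  · rintro ⟨t, h0, h1, ht, rfl⟩
    refine ⟨G.bump_pos h0 h1, ?_⟩
    change Set.projIcc (0 : ℝ) 1 zero_le_one (G.edgeCoord d (G.pt d t)) ∈ V
    rwa [G.edgeCoord_pt h0 h1, Set.projIcc_val]
  · rintro ⟨hx, ht⟩
    obtain ⟨t, h0, h1, rfl⟩ := G.bump_pos_iff.1 hx
    change Set.projIcc (0 : ℝ) 1 zero_le_one (G.edgeCoord d (G.pt d t)) ∈ V at ht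
    rw [G.edgeCoord_pt h0 h1, Set.projIcc_val] at ht
    exact ⟨t, h0, h1, ht, rfl⟩

/-- From a compact space onto a Hausdorff space, `q` is a quotient map. Fibres through an open edge
outside the forest are points, so open subsets of that edge are saturated and have open images. -/
theorem HasCollapseFibers.isOpenEmbedding {q : C(G.Space, G'.Space)} {S : Set G.D}
    (h : HasCollapseFibers q S) (hS : ∀ d ∈ S, G.bar d ∈ S) {d : G.D} (hd : d ∉ S) :
    Topology.IsOpenEmbedding fun t : Set.Ioo (0 : I) 1 => q (G.pt d t) := by
  refine Topology.IsOpenEmbedding.of_continuous_injective_isOpenMap ?_ ?_ ?_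
  · exact q.continuous.comp ((G.continuous_pt d).comp continuous_subtype_val)
  · intro s t hst
    exact Subtype.ext (G.pt_inj t.2.1 t.2.2 (h.eq_of_eq hS hd t.2.1 t.2.2 hst))
  · intro V hV
    obtain ⟨V', hV', rfl⟩ := isOpen_induced_iff.1 hV
    have hq : Topology.IsQuotientMap q :=
      q.continuous.isClosedMap.isQuotientMap q.continuous h.surjective
    rw [← hq.isOpen_preimage]
    convert G.isOpen_image_pt d hV' using 1
    ext x
    constructor
    · rintro ⟨t, ht, hx⟩
      exact ⟨t, t.2.1, t.2.2, ht, h.eq_of_eq hS hd t.2.1 t.2.2 hx.symm⟩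
    · rintro ⟨t, h0, h1, ht, rfl⟩
      exact ⟨⟨t, h0, h1⟩, ht, rfl⟩

/-- No open interval is embedded as a neighbourhood of a vertex of valence at least `3`. -/
theorem not_mem_range_of_valence {θ : Set.Ioo (0 : I) 1 → G'.Space}
    (hθ : Topology.IsOpenEmbedding θ) {w : G'.V} (hw : 3 ≤ G'.valence w) :
    G'.vert w ∉ Set.range θ := by
  intro hmem
  have hcard : Fintype.card (Fin 3) ≤ Nat.card {d : G'.D // G'.init d = w} := by
    rw [Fintype.card_fin]
    exact hw
  have : Fintype {d : G'.D // G'.init d = w} := Fintype.ofFinite _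
  rw [Nat.card_eq_fintype_card] at hcard
  obtain ⟨e⟩ := Function.Embedding.nonempty_of_card_le hcard
  -- Three half-edges at `w` have initial pieces in the image of the interval; read in the interval,
  -- they become three arms that leave one point.
  have hnear (j : Fin 3) : ∃ ε > 0, ∀ u : I, (u : ℝ) < ε → G'.pt (e j) u ∈ Set.range θ := by
    have h1 : G'.pt (e j).1 ⁻¹' Set.range θ ∈ nhds (0 : I) := by
      refine (hθ.isOpen_range.preimage (G'.continuous_pt _)).mem_nhds ?_
      rw [Set.mem_preimage, pt_zero, (e j).2]
      exact hmem
    obtain ⟨ε, hε, h2⟩ := Metric.mem_nhds_iff.1 h1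
    refine ⟨ε, hε, fun u hu => h2 ?_⟩
    change |(u : ℝ) - 0| < ε
    rwa [sub_zero, abs_of_nonneg u.2.1]
  choose ε hε hnear using hnear
  obtain ⟨δ, hδ0, hδ⟩ : ∃ δ > 0, ∀ j, δ < ε j := by
    refine ⟨Finset.univ.inf' Finset.univ_nonempty ε / 2, ?_, fun j => ?_⟩
    · have := (Finset.lt_inf'_iff (s := Finset.univ) Finset.univ_nonempty (f := ε) (a := 0)).2
        fun j _ => hε j
      linarith
    · have h1 := Finset.inf'_le ε (Finset.mem_univ j)
      have := hε j
      have h2 := (Finset.lt_inf'_iff (s := Finset.univ) Finset.univ_nonempty (f := ε) (a := 0)).2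
        fun j _ => hε j
      linarith
  -- The bound `1 / 3` keeps arms apart that are the two ends of one loop: a common point would have
  -- parameters `s` and `1 - s`, both at most `1 / 3`.
  let a : ℝ := min δ (1 / 3)
  have ha0 : 0 < a := lt_min hδ0 (by norm_num)
  have ha1 : a ≤ 1 / 3 := min_le_right _ _
  have haδ : a ≤ δ := min_le_left _ _
  clear_value a
  have hau (u : I) : 0 ≤ a * u ∧ a * u ≤ a :=
    ⟨mul_nonneg ha0.le u.2.1, mul_le_of_le_one_right ha0.le u.2.2⟩
  let r : I → I := fun u => ⟨a * u, by have := hau u; constructor <;> linarith⟩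
  have hr : Continuous r := by fun_prop
  have hr0 {u : I} (hu : 0 < u) : 0 < r u := mul_pos ha0 hu
  have hr1 (u : I) : (r u : ℝ) ≤ 1 / 3 := (hau u).2.trans ha1
  have hr1' (u : I) : r u < 1 := by
    have := hr1 u
    change (r u : ℝ) < 1
    linarith
  have hmem' (j : Fin 3) (u : I) : G'.pt (e j) (r u) ∈ Set.range θ :=
    hnear j _ (((hau u).2.trans haδ).trans_lt (hδ j))
  let φ := hθ.toIsEmbedding.toHomeomorph
  let f : Fin 3 → I → ℝ := fun j u => ((φ.symm ⟨_, hmem' j u⟩ : Set.Ioo (0 : I) 1) : I)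
  have hf (j k : Fin 3) (s t : I) (h : f j s = f k t) : G'.pt (e j) (r s) = G'.pt (e k) (r t) :=
    congrArg Subtype.val (φ.symm.injective (Subtype.ext (Subtype.ext h)))
  have hr00 : r 0 = 0 := Subtype.ext (mul_zero a)
  refine false_of_three_arms (c := f 0 0) (f := f) (fun j => ?_) (fun j => ?_) (fun j => ?_) ?_
  · exact continuous_subtype_val.comp (continuous_subtype_val.comp (φ.symm.continuous.comp
      (Continuous.subtype_mk ((G'.continuous_pt _).comp hr) _)))
  · have h1 : (⟨_, hmem' j 0⟩ : Set.range θ) = ⟨_, hmem' 0 0⟩ :=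
      Subtype.ext (by simp only [hr00, pt_zero, (e j).2, (e 0).2])
    simp only [f, h1]
  · intro h
    have h1 := hf _ _ _ _ h
    rw [hr00, pt_zero] at h1
    exact G'.pt_ne_vert (hr0 zero_lt_one) (hr1' 1) _ h1
  · intro j k hjk s t hs ht h
    rcases G'.eq_of_pt_eq_pt (hr0 ht) (hr1' t) (hf _ _ _ _ h) with ⟨h1, -⟩ | ⟨-, h1⟩
    · exact hjk (e.injective (Subtype.ext h1))
    · have h2 := congrArg (fun u : I => (u : ℝ)) h1
      simp only [unitInterval.coe_symm_eq] at h2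
      have := hr1 s
      have := hr1 t
      linarith

/-- A collapse map takes every open edge into an open edge, or else it is constant on the edge. -/
theorem HasCollapseFibers.segProd {q : C(G.Space, G'.Space)} {S : Set G.D}
    (h : HasCollapseFibers q S) (hS : ∀ d ∈ S, G.bar d ∈ S) (hG' : ∀ v, 3 ≤ G'.valence v)
    (d : G.D) : G'.SegProd 5 (G.edgeClass q d) := by
  by_cases hd : d ∈ S
  · refine (G'.segProd_of_const _ fun t => ?_).mono (Nat.zero_le _)
    rw [edgeImage_apply, ← G.pt_zero]
    exact h.const hd _ _
  have hθ := h.isOpenEmbedding hS hd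
  have hedge (t : I) (h0 : 0 < t) (h1 : t < 1) : ∃ e, 0 < G'.bump e (q (G.pt d t)) := by
    rcases G'.eq_vert_or_pt (q (G.pt d t)) with ⟨w, hw⟩ | ⟨e, s, hs0, hs1, he⟩
    · exact absurd ⟨⟨t, h0, h1⟩, hw⟩ (not_mem_range_of_valence hθ (hG' w))
    · exact ⟨e, by rw [he]; exact G'.bump_pos hs0 hs1⟩
  let m : I := ⟨1 / 2, by norm_num, by norm_num⟩
  have hm0 : 0 < m := by change (0 : ℝ) < 1 / 2; norm_num
  have hm1 : m < 1 := by change (1 / 2 : ℝ) < 1; norm_num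
  obtain ⟨e, he⟩ := hedge m hm0 hm1
  refine G'.segProd_of_interior e _ fun t h0 h1 => ?_
  let s : Set G'.Space := (fun t => q (G.pt d t)) '' Set.Ioo (0 : I) 1
  have hs : IsPreconnected s :=
    isPreconnected_Ioo.image _ (q.continuous.comp (G.continuous_pt d)).continuousOn
  -- The image of the open edge avoids the vertices, so it is covered by the open edge `e` and the
  -- union `v` of the others. Being connected, it stays in `e`.
  let v : Set G'.Space := ⋃ e' : {e' : G'.D // e' ≠ e ∧ e' ≠ G'.bar e}, {x | 0 < G'.bump e' x}
  have hv : IsOpen v := isOpen_iUnion fun e' => G'.isOpen_bump_pos _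
  have key : s ⊆ {x | 0 < G'.bump e x} := by
    refine hs.subset_left_of_subset_union (G'.isOpen_bump_pos e) hv ?_ ?_
      ⟨_, ⟨m, ⟨hm0, hm1⟩, rfl⟩, he⟩
    · rw [Set.disjoint_left]
      intro x hx hx'
      obtain ⟨⟨e', h1, h2⟩, he'⟩ := Set.mem_iUnion.1 hx'
      obtain ⟨u, hu0, hu1, rfl⟩ := G'.bump_pos_iff.1 he'
      have h3 : 0 < G'.bump e (G'.pt e' u) := hx
      rw [G'.bump_pt_of_ne h1 h2] at h3
      exact lt_irrefl _ h3
    · rintro _ ⟨u, hu, rfl⟩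
      obtain ⟨e', he'⟩ := hedge u hu.1 hu.2
      by_cases h1 : e' = e
      · left
        rwa [h1] at he'
      by_cases h2 : e' = G'.bar e
      · left
        obtain ⟨w, hw0, hw1, hw⟩ := G'.bump_pos_iff.1 he'
        change 0 < G'.bump e (q (G.pt d u))
        rw [hw, h2, G'.bump_pt_bar]
        exact unit_mul_pos hw0 hw1
      · exact Or.inr (Set.mem_iUnion.2 ⟨⟨e', h1, h2⟩, he'⟩)
  exact key ⟨t, ⟨h0, h1⟩, rfl⟩

theorem exists_eq_pt (hG : ∀ v, 3 ≤ G.valence v) (x : G.Space) : ∃ d t, x = G.pt d t := by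
  rcases G.eq_vert_or_pt x with ⟨v, rfl⟩ | ⟨d, t, -, -, rfl⟩
  · have h : Nat.card {d : G.D // G.init d = v} ≠ 0 := by
      have := hG v
      rw [valence] at this
      omega
    have := (Nat.card_ne_zero.1 h).1
    obtain ⟨d, rfl⟩ := this
    exact ⟨d, 0, (G.pt_zero d).symm⟩
  · exact ⟨d, t, rfl⟩

/-- A finite amount of information that determines a collapse map up to homotopy. -/
abbrev CollapseData (G G' : FinGraph) : Type :=
  Σ c : G.V → G'.D, ∀ d : G.D,
    {P : Path.Homotopic.Quotient (G'.vert (G'.init (c (G.init d))))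
      (G'.vert (G'.init (c (G.term d)))) // G'.EdgeWord 12 P}

instance (G G' : FinGraph) : Finite (CollapseData G G') := by
  have (u v : G'.V) : Finite {P : Path.Homotopic.Quotient (G'.vert u) (G'.vert v) //
    G'.EdgeWord 12 P} := G'.finite_edgeWord 12 u v
  infer_instance

/-- The relation between a map of graphs and the data that determine it up to homotopy. -/
def HasData (f : C(G.Space, G'.Space)) (τ : CollapseData G G') : Prop :=
  ∃ (t : G.V → I) (h : ∀ v, f (G.vert v) = G'.pt (τ.1 v) (t v)), ∀ d,
    (τ.2 d).1 = ((G'.seg (τ.1 (G.init d)) (G'.pt_zero _).symm (h _)).trans (G.edgeClass f d)).trans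
      (G'.seg (τ.1 (G.term d)) (h _) (G'.pt_zero _).symm)

/-- Valence at least 3 puts the image of every vertex on some edge. Five segments, with links to the
initial vertices of these edges, give an edge word of length at most `2 * 5 + 2 = 12`. -/
theorem exists_hasData (hG' : ∀ v, 3 ≤ G'.valence v) {f : C(G.Space, G'.Space)}
    (hf : ∀ d, G'.SegProd 5 (G.edgeClass f d)) : ∃ τ, HasData f τ := by
  choose c t h using fun v => exists_eq_pt hG' (f (G.vert v))
  exact ⟨⟨c, fun d => ⟨_, (hf d).edgeWord G' (c (G.init d)) (c (G.term d)) (G'.pt_zero _).symm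
    (h _) (h _) (G'.pt_zero _).symm⟩⟩, t, h, fun d => rfl⟩

/-- The data record on which edge the image of a vertex lies, but not its position. The images under
`f` and `g` lie on the same edge and can be slid to each other along it; the equal words make the
slides compatible with the edge images. -/
theorem HasData.homotopic {f g : C(G.Space, G'.Space)} {τ : CollapseData G G'} (hf : HasData f τ)
    (hg : HasData g τ) : f.Homotopic g := by
  obtain ⟨s, hs, hf⟩ := hf
  obtain ⟨t, ht, hg⟩ := hg
  have solve {x y : G'.Space} (d e : G'.D) {u v : I} (hx : x = G'.pt d u) (hy : y = G'.pt e v)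
      -- The recorded word `Q` is the edge class `P` with a link added at either end; the links are
      -- undone by the reversed segments.
      (P : Path.Homotopic.Quotient x y) (Q : Path.Homotopic.Quotient (G'.vert (G'.init d))
        (G'.vert (G'.init e)))
      (h : Q = ((G'.seg d (G'.pt_zero _).symm hx).trans P).trans
        (G'.seg e hy (G'.pt_zero _).symm)) :
      P = ((G'.seg d hx (G'.pt_zero _).symm).trans Q).trans (G'.seg e (G'.pt_zero _).symm hy) := by
    rw [h]
    simp only [Path.Homotopic.Quotient.trans_assoc, seg_trans]
    rw [← Path.Homotopic.Quotient.trans_assoc, seg_trans, seg_self, seg_self,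
      Path.Homotopic.Quotient.refl_trans, Path.Homotopic.Quotient.trans_refl]
  refine G.homotopic_of_edgeClass (fun v => G'.seg (τ.1 v) (hs v) (ht v)) fun d => ?_
  rw [solve _ _ _ _ _ _ (hf d), solve _ _ _ _ _ _ (hg d)]
  rw [Path.Homotopic.Quotient.trans_assoc, seg_trans, ← Path.Homotopic.Quotient.trans_assoc,
    ← Path.Homotopic.Quotient.trans_assoc, seg_trans]

/-- A homeomorphism is a collapse map of the empty forest. -/
theorem hasCollapseFibers_homeomorph (h : G.Space ≃ₜ G'.Space) :
    HasCollapseFibers (h : C(G.Space, G'.Space)) ∅ := by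
  intro y
  refine Or.inl ⟨h.symm y, ?_, ?_⟩
  · rintro ⟨d, hd, -⟩
    exact hd
  · ext x
    exact h.eq_symm_apply.symm

theorem HasCollapseFibers.homeomorph_comp {G'' : FinGraph} {q : C(G.Space, G'.Space)} {S : Set G.D}
    (hq : HasCollapseFibers q S) (h : G'.Space ≃ₜ G''.Space) :
    HasCollapseFibers ((h : C(G'.Space, G''.Space)).comp q) S := by
  intro y
  have : ((h : C(G'.Space, G''.Space)).comp q) ⁻¹' {y} = q ⁻¹' {h.symm y} := by
    ext x
    exact h.eq_symm_apply.symm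
  rw [this]
  exact hq _

end FinGraph

/-- In the applications `b` is a combinatorial label that depends on choices of representatives. It
suffices that some label exists and that a label determines the object. -/
theorem finite_of_rel {α β : Type*} [Finite β] (A : Set α) (R : α → β → Prop)
    (h : ∀ a ∈ A, ∃ b, R a b) (hR : ∀ a a' b, R a b → R a' b → a = a') : A.Finite := by
  choose f hf using fun a : A => h a a.2
  have : Function.Injective f := by
    intro a b hab
    have hb := hf b
    rw [← hab] at hb
    exact Subtype.ext (hR _ _ _ (hf a) hb)
  exact Finite.of_injective f this

end OuterSpace

end

/-! ### Finiteness of orbits, faces, cofaces and transporters -/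

noncomputable section

namespace OuterSpace

/-! ### Isomorphisms of graphs -/

/-- An isomorphism of graphs. -/
structure FinGraph.Iso (G G' : FinGraph) where
  onV : G.V ≃ G'.V
  onD : G.D ≃ G'.D
  init : ∀ d, G'.init (onD d) = onV (G.init d)
  bar : ∀ d, G'.bar (onD d) = onD (G.bar d)

namespace FinGraph

variable {G G' : FinGraph}

/-- The inverse isomorphism. -/
def Iso.symm (e : Iso G G') : Iso G' G where
  onV := e.onV.symm
  onD := e.onD.symm
  init d := by rw [Equiv.eq_symm_apply, ← e.init, Equiv.apply_symm_apply]
  bar d := by rw [Equiv.eq_symm_apply, ← e.bar, Equiv.apply_symm_apply]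

theorem Iso.term (e : Iso G G') (d : G.D) : G'.term (e.onD d) = e.onV (G.term d) := by
  rw [FinGraph.term, e.bar, e.init]
  rfl

/-- The map of spaces that is induced by an isomorphism. -/
def Iso.map (e : Iso G G') : C(G.Space, G'.Space) :=
  G.lift (fun v => G'.vert (e.onV v)) (fun d => ⟨G'.pt (e.onD d), G'.continuous_pt _⟩)
    (fun d t => by
      change G'.pt (e.onD (G.bar d)) t = G'.pt (e.onD d) (σ t)
      rw [← e.bar, pt_bar])
    (fun d => by
      change G'.pt (e.onD d) 0 = _
      rw [pt_zero, e.init])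

theorem Iso.map_pt (e : Iso G G') (d : G.D) (t : I) : e.map (G.pt d t) = G'.pt (e.onD d) t := rfl

theorem Iso.map_vert (e : Iso G G') (v : G.V) : e.map (G.vert v) = G'.vert (e.onV v) := rfl

theorem Iso.symm_map_map (e : Iso G G') (x : G.Space) : e.symm.map (e.map x) = x := by
  refine congrFun (G.map_ext (f := fun x => e.symm.map (e.map x)) (g := id) (fun v => ?_)
    fun d t => ?_) x
  · simp only [map_vert, symm, Equiv.symm_apply_apply, id]
  · simp only [map_pt, symm, Equiv.symm_apply_apply, id]

/-- The homeomorphism of spaces that is induced by an isomorphism. -/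
def Iso.homeomorph (e : Iso G G') : G.Space ≃ₜ G'.Space where
  toFun := e.map
  invFun := e.symm.map
  left_inv := e.symm_map_map
  right_inv := e.symm.symm_map_map
  continuous_toFun := e.map.continuous
  continuous_invFun := e.symm.map.continuous

theorem Iso.valence (e : Iso G G') (v : G.V) : G'.valence (e.onV v) = G.valence v := by
  refine (Nat.card_congr (e.onD.subtypeEquiv fun d => ?_)).symm
  rw [e.init, e.onV.apply_eq_iff_eq]

theorem segProd_comp_iso {G'' : FinGraph} (e : Iso G G') {f : C(G'.Space, G''.Space)} {k : ℕ}
    (hf : ∀ d, G''.SegProd k (G'.edgeClass f d)) (d : G.D) :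
    G''.SegProd k (G.edgeClass (f.comp e.map) d) := by
  have h : G.edgeClass (f.comp e.map) d = (G'.edgeClass f (e.onD d)).cast
      (congrArg (fun v => f (G'.vert v)) (e.init d).symm)
      (congrArg (fun v => f (G'.vert v)) (e.term d).symm) := by
    rw [edgeClass, edgeClass, ← Path.Homotopic.Quotient.mk_cast]
    congr 1
  rw [h]
  exact (hf _).cast G'' _ _

/-- Combinatorial descriptions of small graphs. -/
abbrev Code (N : ℕ) : Type :=
  Σ (a : Fin N) (b : Fin N), {p : (Fin b → Fin a) × (Fin b → Fin b) //
    (∀ d, p.2 (p.2 d) = d) ∧ ∀ d, p.2 d ≠ d}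

/-- The graph with a given description. -/
def ofCode {N : ℕ} (x : Code N) : FinGraph where
  V := Fin x.1
  D := Fin x.2.1
  init := x.2.2.1.1
  bar := x.2.2.1.2
  bar_bar := x.2.2.2.1
  bar_ne := x.2.2.2.2

theorem exists_iso_ofCode (G : FinGraph) {N : ℕ} (hV : Fintype.card G.V < N)
    (hD : Fintype.card G.D < N) : ∃ x : Code N, Nonempty (Iso G (ofCode x)) := by
  let eV := Fintype.equivFin G.V
  let eD := Fintype.equivFin G.D
  refine ⟨⟨⟨_, hV⟩, ⟨_, hD⟩, ⟨(fun d => eV (G.init (eD.symm d)), fun d => eD (G.bar (eD.symm d))),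
    fun d => ?_, fun d h => ?_⟩⟩, ⟨⟨eV, eD, fun d => ?_, fun d => ?_⟩⟩⟩
  · simp [G.bar_bar]
  · exact G.bar_ne (eD.symm d) (eD.injective (by simpa using h))
  · change eV (G.init (eD.symm (eD d))) = _
    rw [Equiv.symm_apply_apply]
    rfl
  · change eD (G.bar (eD.symm (eD d))) = _
    rw [Equiv.symm_apply_apply]
    rfl

theorem sum_valence (G : FinGraph) : ∑ v, G.valence v = Fintype.card G.D := by
  classical
  rw [← Fintype.card_congr (Equiv.sigmaFiberEquiv G.init), Fintype.card_sigma]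
  exact Finset.sum_congr rfl fun v _ => Nat.card_eq_fintype_card

end FinGraph

/-! ### Finiteness properties of the cells -/

/-- A homotopy equivalence can be cancelled on the left. This turns equality of collapse data into
preservation of markings. -/
theorem homotopic_of_comp_left {X Y Z : Type*} [TopologicalSpace X] [TopologicalSpace Y]
    [TopologicalSpace Z] (e : ContinuousMap.HomotopyEquiv Y Z) {f g : C(X, Y)}
    (h : (e.toFun.comp f).Homotopic (e.toFun.comp g)) : f.Homotopic g := by
  have key (k : C(X, Y)) : (e.invFun.comp (e.toFun.comp k)).Homotopic k := by
    rw [← ContinuousMap.comp_assoc]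
    exact e.left_inv.comp (ContinuousMap.Homotopic.refl k)
  exact (key f).symm.trans (((ContinuousMap.Homotopic.refl e.invFun).comp h).trans (key g))

namespace MarkedGraph

variable {n : ℕ}

/-- Counting half-edges gives `3 * #V ≤ #D`. With `#D + 2 = 2 * #V + 2 * n` this forces `#V ≤ 2 * n
- 2` and `#D ≤ 6 * n - 6`. -/
theorem card_lt (M : MarkedGraph n) :
    Fintype.card M.graph.V < 6 * n ∧ Fintype.card M.graph.D < 6 * n := by
  have h1 : ∑ v : M.graph.V, 3 ≤ ∑ v, M.graph.valence v :=
    Finset.sum_le_sum fun v _ => M.valence_ge v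
  rw [M.graph.sum_valence] at h1
  simp only [Finset.sum_const, Finset.card_univ, smul_eq_mul] at h1
  have := M.rank_eq
  omega

/-- The marked graph on an isomorphic graph. -/
def transport (M : MarkedGraph n) {G : FinGraph} (e : M.graph.Iso G) : MarkedGraph n where
  graph := G
  connected := e.homeomorph.connectedSpace_iff.1 M.connected
  valence_ge v := by
    rw [← e.onV.apply_symm_apply v, e.valence]
    exact M.valence_ge _
  rank_eq := by
    rw [← Fintype.card_congr e.onV, ← Fintype.card_congr e.onD]
    exact M.rank_eq
  marking := M.marking.trans e.homeomorph.toHomotopyEquiv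

theorem mk_transport (M : MarkedGraph n) {G : FinGraph} (e : M.graph.Iso G) :
    Cell.mk (M.transport e) = Cell.mk M :=
  have h : MarkedGraph.Equivalent M (M.transport e) :=
    ⟨e.homeomorph, ContinuousMap.Homotopic.refl (M.transport e).marking.toFun⟩
  (Quotient.sound h : Cell.mk M = Cell.mk (M.transport e)).symm

/-- Two marked graphs with the same underlying graph differ by an automorphism of the free group. -/
theorem exists_twist (hn : 0 < n) {M N : MarkedGraph n} (h : M.graph.Space ≃ₜ N.graph.Space) :
    ∃ Φ, Cell.mk (M.twist Φ) = Cell.mk N := by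
  obtain ⟨Φ, hΦ⟩ := exists_autMap hn
    (N.marking.trans (M.marking.trans h.toHomotopyEquiv).symm)
  refine ⟨Φ, Quotient.sound ⟨h, ?_⟩⟩
  have h1 := (ContinuousMap.Homotopic.refl
    (M.marking.trans h.toHomotopyEquiv).toFun).comp hΦ.symm
  refine ContinuousMap.Homotopic.trans h1 ?_
  exact ((M.marking.trans h.toHomotopyEquiv).right_inv).comp
    (ContinuousMap.Homotopic.refl N.marking.toFun)

end MarkedGraph

namespace Cell

variable {n : ℕ}

theorem exists_mk_eq (c : Cell n) : ∃ M, mk M = c := Quotient.exists_rep c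

theorem exists_code (M : MarkedGraph n) :
    ∃ x : FinGraph.Code (6 * n), Nonempty (M.graph.Iso (FinGraph.ofCode x)) :=
  FinGraph.exists_iso_ofCode _ M.card_lt.1 M.card_lt.2

/-- The group acts on the cells with finitely many orbits. -/
theorem exists_finite_representatives (hn : 2 ≤ n) :
    ∃ T : Set (Cell n), T.Finite ∧ ∀ c : Cell n, ∃ φ : (OutFree n)ᵐᵒᵖ, φ • c ∈ T := by
  classical
  let P (x : FinGraph.Code (6 * n)) (M : MarkedGraph n) : Prop :=
    Nonempty (M.graph.Iso (FinGraph.ofCode x))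
  -- One marked graph is chosen for each code that occurs. A marked graph with the same code is
  -- homeomorphic to it, hence equivalent to it after a twist.
  let T : Set (Cell n) := {c | ∃ x, ∃ h : ∃ M, P x M, c = mk h.choose}
  refine ⟨T, ?_, fun c => ?_⟩
  · refine finite_of_rel T (fun c x => ∃ h : ∃ M, P x M, c = mk h.choose) (fun c hc => hc) ?_
    rintro _ _ x ⟨h, rfl⟩ ⟨_, rfl⟩
    rfl
  · obtain ⟨M, rfl⟩ := exists_mk_eq c
    obtain ⟨x, hx⟩ := exists_code M
    have h : ∃ M, P x M := ⟨M, hx⟩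
    obtain ⟨e⟩ := hx
    obtain ⟨e'⟩ := h.choose_spec
    obtain ⟨Φ, hΦ⟩ := MarkedGraph.exists_twist (by omega) (M := M) (N := h.choose)
      (e.homeomorph.trans e'.homeomorph.symm)
    exact ⟨MulOpposite.op (Φ : OutFree n), x, h, hΦ⟩

open FinGraph in
/-- Every cell is a face of finitely many cells. -/
theorem finite_cofaces (c : Cell n) : {c' | IsFace c c'}.Finite := by
  obtain ⟨M, rfl⟩ := exists_mk_eq c
  -- The label of a coface consists of the code of its graph and the homotopy data of the collapse,
  -- read on the standard graph with this code.
  refine finite_of_rel (β := Σ x : Code (6 * n), CollapseData (ofCode x) M.graph) _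
    (fun c' τ => ∃ (N : MarkedGraph n) (e : N.graph.Iso (ofCode τ.1))
      (q : ContinuousMap.HomotopyEquiv N.graph.Space M.graph.Space), mk N = c' ∧
      HasData (q.toFun.comp e.symm.map) τ.2 ∧ (q.toFun.comp N.marking.toFun).Homotopic
      M.marking.toFun) ?_ ?_
  · rintro _ ⟨M₀, N, hM, rfl, _, ⟨q, rfl⟩, hq, S, hS, hfib⟩
    obtain ⟨h, hh⟩ := Quotient.exact hM
    obtain ⟨x, ⟨e⟩⟩ := exists_code N
    have h1 : HasCollapseFibers ((h : C(M₀.graph.Space, M.graph.Space)).comp q.toFun) S :=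
      HasCollapseFibers.homeomorph_comp hfib h
    obtain ⟨τ, hτ⟩ := exists_hasData M.valence_ge
      (segProd_comp_iso e.symm fun d => h1.segProd hS.1 M.valence_ge d)
    exact ⟨⟨x, τ⟩, N, e, q.trans h.toHomotopyEquiv, rfl, hτ, hq.comp hh⟩
  · rintro _ _ ⟨x, τ⟩ ⟨N, e, q, rfl, hτ, hq⟩ ⟨N', e', q', rfl, hτ', hq'⟩
    refine Quotient.sound ⟨e.homeomorph.trans e'.homeomorph.symm, ?_⟩
    -- Equal data make the collapses of `N` and `N'` homotopic under the identification of the two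
    -- graphs. Both carry the marking to that of `M`, and `q'` cancels.
    refine homotopic_of_comp_left q' ?_
    have h1 := (hτ'.homotopic hτ).comp (ContinuousMap.Homotopic.refl
      (e.map.comp N.marking.toFun))
    have h2 : (q.toFun.comp e.symm.map).comp (e.map.comp N.marking.toFun)
        = q.toFun.comp N.marking.toFun := by
      ext x
      exact congrArg q.toFun (e.symm_map_map _)
    rw [h2] at h1
    exact (h1.trans hq).trans hq'.symm

open FinGraph in
/-- Every cell has finitely many faces. -/
theorem finite_faces (c' : Cell n) : {c | IsFace c c'}.Finite := by
  obtain ⟨N, rfl⟩ := exists_mk_eq c'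
  -- The graph `N₀` that collapses need only be equivalent to `N`. The homeomorphism from `N` is
  -- therefore recorded separately, as a collapse of the empty forest, next to the collapse itself.
  refine finite_of_rel (β := Σ (x : Code (6 * n)) (y : Code (6 * n)),
      CollapseData N.graph (ofCode x) × CollapseData (ofCode x) (ofCode y)) _
    (fun c τ => ∃ (M : MarkedGraph n) (e : M.graph.Iso (ofCode τ.2.1))
      (k : C(N.graph.Space, (ofCode τ.1).Space))
      (q : C((ofCode τ.1).Space, (ofCode τ.2.1).Space)), mk M = c ∧
      HasData k τ.2.2.1 ∧ HasData q τ.2.2.2 ∧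
      ((q.comp k).comp N.marking.toFun).Homotopic (e.map.comp M.marking.toFun)) ?_ ?_
  · rintro _ ⟨M, N₀, rfl, hN, _, ⟨q, rfl⟩, hq, S, hS, hfib⟩
    obtain ⟨h, hh⟩ := Quotient.exact hN.symm
    obtain ⟨x, ⟨e⟩⟩ := exists_code N₀
    obtain ⟨y, ⟨e'⟩⟩ := exists_code M
    obtain ⟨τ, hτ⟩ := exists_hasData (N₀.transport e).valence_ge
      (fun d => (hasCollapseFibers_homeomorph (h.trans e.homeomorph)).segProd
        (fun _ h => h.elim) (N₀.transport e).valence_ge d)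
    have h1 : HasCollapseFibers ((e'.homeomorph : C(M.graph.Space, (ofCode y).Space)).comp q.toFun) S :=
      HasCollapseFibers.homeomorph_comp hfib e'.homeomorph
    obtain ⟨τ', hτ'⟩ := exists_hasData (M.transport e').valence_ge
      (segProd_comp_iso e.symm fun d => h1.segProd hS.1 (M.transport e').valence_ge d)
    refine ⟨⟨x, y, τ, τ'⟩, M, e', _, _, rfl, hτ, hτ', ?_⟩
    have h2 := (ContinuousMap.Homotopic.refl e'.map).comp
      (((ContinuousMap.Homotopic.refl q.toFun).comp hh).trans hq)
    refine Eq.mpr (congrArg (ContinuousMap.Homotopic · _) ?_) h2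
    ext z
    exact congrArg (fun z => e'.map (q.toFun z)) (e.symm_map_map _)
  · rintro _ _ ⟨x, y, τ, τ'⟩ ⟨M, e, k, q, rfl, hk, hq, h⟩ ⟨M', e', k', q', rfl, hk', hq', h'⟩
    rw [← M.mk_transport e, ← M'.mk_transport e']
    refine Quotient.sound ⟨Homeomorph.refl _, ?_⟩
    have h1 := ((hq.homotopic hq').comp (hk.homotopic hk')).comp
      (ContinuousMap.Homotopic.refl N.marking.toFun)
    exact (h.symm.trans h1).trans h'

open FinGraph in
/-- Only finitely many elements of the group take a given cell to a given cell. -/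
theorem finite_transporter (hn : 2 ≤ n) (c c' : Cell n) :
    {φ : (OutFree n)ᵐᵒᵖ | φ • c = c'}.Finite := by
  obtain ⟨M, rfl⟩ := exists_mk_eq c
  obtain ⟨N, rfl⟩ := exists_mk_eq c'
  -- An element that takes `c` to `c'` is witnessed by a homeomorphism, which has finitely many
  -- possible homotopy classes. The class fixes `autMap Φ` up to homotopy, hence the outer class of
  -- `Φ`.
  refine finite_of_rel (β := CollapseData M.graph N.graph) _
    (fun φ τ => ∃ (Φ : MulAut (FreeGroup (Fin n))) (h : M.graph.Space ≃ₜ N.graph.Space),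
      φ = MulOpposite.op (Φ : OutFree n) ∧ HasData (h : C(M.graph.Space, N.graph.Space)) τ ∧
      ((h : C(M.graph.Space, N.graph.Space)).comp (M.twist Φ).marking.toFun).Homotopic
        N.marking.toFun) ?_ ?_
  · rintro ⟨φ⟩ hφ
    induction φ using QuotientGroup.induction_on with
    | H Φ =>
      obtain ⟨h, hh⟩ := Quotient.exact (hφ : mk (M.twist Φ) = mk N)
      obtain ⟨τ, hτ⟩ := exists_hasData N.valence_ge
        (fun d => (hasCollapseFibers_homeomorph h).segProd (fun _ h => h.elim) N.valence_ge d)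
      exact ⟨τ, Φ, h, rfl, hτ, hh⟩
  · rintro _ _ τ ⟨Φ, h, rfl, hτ, hh⟩ ⟨Ψ, k, rfl, hτ', hk⟩
    congr 1
    apply mk_eq_mk_of_autMap_homotopic (by omega)
    refine homotopic_of_comp_left (M.marking.trans h.toHomotopyEquiv) ?_
    refine hh.trans (hk.symm.trans ?_)
    exact (hτ'.homotopic hτ).comp
      (ContinuousMap.Homotopic.refl (M.marking.toFun.comp (autMap Ψ)))

end Cell

end OuterSpace

end

/-! ### The homotopy equivalence of a single edge collapse -/

noncomputable section

namespace OuterSpace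

/-! ### The collapse of an edge -/

theorem FinGraph.remaining_bar (G : FinGraph) {d₀ d : G.D} (h : d ≠ d₀ ∧ d ≠ G.bar d₀) :
    G.bar d ≠ d₀ ∧ G.bar d ≠ G.bar d₀ :=
  ⟨fun h' => h.2 (by rw [← h', G.bar_bar]), fun h' => h.1 (G.bar_injective h')⟩

/-- Combinatorial data that present `G'` as the result of the collapse of the edge `d₀` of `G`,
which is not a loop. -/
structure EdgeCollapse (G G' : FinGraph) (d₀ : G.D) where
  onV : G.V → G'.V
  onD : {d : G.D // d ≠ d₀ ∧ d ≠ G.bar d₀} ≃ G'.D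
  surjective : Function.Surjective onV
  onV_eq_iff : ∀ v w, onV v = onV w ↔
    v = w ∨ (v = G.init d₀ ∧ w = G.term d₀) ∨ (v = G.term d₀ ∧ w = G.init d₀)
  init : ∀ d, G'.init (onD d) = onV (G.init d.1)
  bar : ∀ d, G'.bar (onD d) = onD ⟨G.bar d.1, G.remaining_bar d.2⟩
  not_loop : G.init d₀ ≠ G.term d₀

namespace EdgeCollapse

open FinGraph

variable {G G' : FinGraph} {d₀ : G.D} (E : EdgeCollapse G G' d₀)

theorem onV_init_eq : E.onV (G.init d₀) = E.onV (G.term d₀) :=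
  (E.onV_eq_iff _ _).2 (Or.inr (Or.inl ⟨rfl, rfl⟩))

theorem term (d) : G'.term (E.onD d) = E.onV (G.term d.1) := by
  rw [FinGraph.term, E.bar, E.init]
  rfl

theorem onV_bar_of_not {d : G.D} (h : ¬ (d ≠ d₀ ∧ d ≠ G.bar d₀)) :
    E.onV (G.init d) = E.onV (G.init d₀) := by
  by_cases h1 : d = d₀
  · rw [h1]
  · have h2 : d = G.bar d₀ := by_contra fun h2 => h ⟨h1, h2⟩
    rw [h2, init_bar, E.onV_init_eq]

open Classical in
/-- The collapse map. -/
def map : C(G.Space, G'.Space) :=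
  G.lift (fun v => G'.vert (E.onV v))
    (fun d => if h : d ≠ d₀ ∧ d ≠ G.bar d₀ then ⟨G'.pt (E.onD ⟨d, h⟩), G'.continuous_pt _⟩
      else ContinuousMap.const I (G'.vert (E.onV (G.init d₀))))
    (fun d t => by
      by_cases h : d ≠ d₀ ∧ d ≠ G.bar d₀
      · have h' := G.remaining_bar h
        rw [dif_pos h, dif_pos h']
        change G'.pt (E.onD ⟨G.bar d, h'⟩) t = G'.pt (E.onD ⟨d, h⟩) (σ t)
        rw [← G'.pt_bar, E.bar]
      · have h' : ¬ (G.bar d ≠ d₀ ∧ G.bar d ≠ G.bar d₀) := fun h' =>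
          h (by simpa only [G.bar_bar] using G.remaining_bar h')
        rw [dif_neg h, dif_neg h']
        rfl)
    (fun d => by
      by_cases h : d ≠ d₀ ∧ d ≠ G.bar d₀
      · rw [dif_pos h]
        change G'.pt (E.onD ⟨d, h⟩) 0 = _
        rw [pt_zero, E.init]
      · rw [dif_neg h, E.onV_bar_of_not h]
        rfl)

theorem map_vert (v : G.V) : E.map (G.vert v) = G'.vert (E.onV v) := rfl

theorem map_pt {d : G.D} (h : d ≠ d₀ ∧ d ≠ G.bar d₀) (t : I) :
    E.map (G.pt d t) = G'.pt (E.onD ⟨d, h⟩) t := by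
  simp only [map, lift_pt, dif_pos h]
  rfl

theorem map_pt_of_not {d : G.D} (h : ¬ (d ≠ d₀ ∧ d ≠ G.bar d₀)) (t : I) :
    E.map (G.pt d t) = G'.vert (E.onV (G.init d₀)) := by
  simp only [map, lift_pt, dif_neg h]
  rfl

theorem map_pt_self (t : I) : E.map (G.pt d₀ t) = G'.vert (E.onV (G.init d₀)) :=
  E.map_pt_of_not (fun h => h.1 rfl) t

/-- A section of the map of vertices. -/
def sec (v : G'.V) : G.V := (E.surjective v).choose

theorem onV_sec (v : G'.V) : E.onV (E.sec v) = v := (E.surjective v).choose_spec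

include E in
theorem eq_of_vert_eq_pt {w : G.V} {a b : I} (ha : G.vert w = G.pt d₀ a)
    (hb : G.vert w = G.pt d₀ b) : a = b := by
  have key (c : I) (hc : G.vert w = G.pt d₀ c) : (c = 0 ∧ w = G.init d₀) ∨
      (c = 1 ∧ w = G.term d₀) := by
    by_cases h0 : c = 0
    · rw [h0, pt_zero] at hc
      exact Or.inl ⟨h0, G.vert_injective hc⟩
    · by_cases h1 : c = 1
      · rw [h1, pt_one] at hc
        exact Or.inr ⟨h1, G.vert_injective hc⟩
      · exact absurd hc.symm (G.pt_ne_vert (unitInterval.pos_iff_ne_zero.2 h0)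
          (unitInterval.lt_one_iff_ne_one.2 h1) w)
  rcases key a ha with ⟨h1, h2⟩ | ⟨h1, h2⟩ <;> rcases key b hb with ⟨h3, h4⟩ | ⟨h3, h4⟩
  · rw [h1, h3]
  · exact absurd (h2.symm.trans h4) E.not_loop
  · exact absurd (h4.symm.trans h2) E.not_loop
  · rw [h1, h3]

end EdgeCollapse

theorem FinGraph.mk_const_eq_seg (G : FinGraph) {x y : G.Space} (p : Path x y) (h : ∀ t, p t = x)
    (d : G.D) {s : I} (hx : x = G.pt d s) (hy : y = G.pt d s) :
    Path.Homotopic.Quotient.mk p = G.seg d hx hy :=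
  G.mk_eq_seg d p (Path.refl s) (fun u => (h u).trans hx) hx hy

theorem FinGraph.edgePath_bar (G : FinGraph) (d : G.D) :
    G.edgePath (G.bar d) = (G.edgePath d).symm.cast (congrArg G.vert (G.init_bar d))
      (congrArg G.vert (G.term_bar d)) := by
  ext t
  exact G.pt_bar d t

namespace EdgeCollapse

open FinGraph

variable {G G' : FinGraph} {d₀ : G.D} (E : EdgeCollapse G G' d₀)

/-- The path is constant or runs once along `d₀`. Recording its class as a segment of `d₀` in all
cases lets later cancellations take place inside one edge. -/
theorem exists_path (w : G.V) : ∃ p : Path (G.vert w) (G.vert (E.sec (E.onV w))),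
    (∀ t, E.map (p t) = E.map (G.vert w)) ∧ ∀ (a b : I) (ha : G.vert w = G.pt d₀ a)
    (hb : G.vert (E.sec (E.onV w)) = G.pt d₀ b),
    Path.Homotopic.Quotient.mk p = G.seg d₀ ha hb := by
  have key : ∀ v, E.onV w = E.onV v → ∃ p : Path (G.vert w) (G.vert v),
      (∀ t, E.map (p t) = E.map (G.vert w)) ∧ ∀ (a b : I) (ha : G.vert w = G.pt d₀ a)
      (hb : G.vert v = G.pt d₀ b), Path.Homotopic.Quotient.mk p = G.seg d₀ ha hb := by
    intro v hv
    rcases (E.onV_eq_iff _ _).1 hv with rfl | ⟨rfl, rfl⟩ | ⟨rfl, rfl⟩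
    · refine ⟨Path.refl _, fun t => rfl, fun a b ha hb => ?_⟩
      obtain rfl := E.eq_of_vert_eq_pt ha hb
      exact G.mk_const_eq_seg _ (fun t => rfl) _ _ _
    · refine ⟨G.edgePath d₀, fun t => E.map_pt_self t, fun a b ha hb => ?_⟩
      obtain rfl := E.eq_of_vert_eq_pt ha (G.pt_zero d₀).symm
      obtain rfl := E.eq_of_vert_eq_pt hb (G.pt_one d₀).symm
      exact G.mk_edgePath d₀
    · refine ⟨(G.edgePath d₀).symm, fun t => ?_, fun a b ha hb => ?_⟩
      · exact (E.map_pt_self _).trans (congrArg G'.vert E.onV_init_eq)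
      · obtain rfl := E.eq_of_vert_eq_pt ha (G.pt_one d₀).symm
        obtain rfl := E.eq_of_vert_eq_pt hb (G.pt_zero d₀).symm
        exact G.mk_eq_seg d₀ _ Path.id.symm (fun t => rfl) _ _
  exact key _ (E.onV_sec _).symm

/-- A path from a vertex to the chosen vertex with the same image. -/
def toSec (w : G.V) : Path (G.vert w) (G.vert (E.sec (E.onV w))) := (E.exists_path w).choose

theorem map_toSec (w : G.V) (t : I) : E.map (E.toSec w t) = E.map (G.vert w) :=
  (E.exists_path w).choose_spec.1 t

theorem mk_toSec {w : G.V} {a b : I} (ha : G.vert w = G.pt d₀ a)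
    (hb : G.vert (E.sec (E.onV w)) = G.pt d₀ b) :
    Path.Homotopic.Quotient.mk (E.toSec w) = G.seg d₀ ha hb :=
  (E.exists_path w).choose_spec.2 a b ha hb

/-- The modification of a path that moves its ends to the chosen vertices. -/
def between {u v : G.V} (c : Path (G.vert u) (G.vert v)) :
    Path (G.vert (E.sec (E.onV u))) (G.vert (E.sec (E.onV v))) :=
  ((E.toSec u).symm.trans c).trans (E.toSec v)

theorem between_cast {u v u' v' : G.V} (hu : u' = u) (hv : v' = v) (c : Path (G.vert u) (G.vert v)) :
    E.between (c.cast (congrArg G.vert hu) (congrArg G.vert hv)) = (E.between c).cast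
      (congrArg (fun w => G.vert (E.sec (E.onV w))) hu)
      (congrArg (fun w => G.vert (E.sec (E.onV w))) hv) := by
  subst hu hv
  rfl

theorem between_symm {u v : G.V} (c : Path (G.vert u) (G.vert v)) :
    (E.between c.symm).Homotopic (E.between c).symm := by
  apply Path.Homotopic.Quotient.exact
  simp only [between, Path.trans_symm, Path.symm_symm, Path.Homotopic.Quotient.mk_trans,
    Path.Homotopic.Quotient.trans_assoc]

/-- The image of an edge under the homotopy inverse of the collapse map. -/
def invPath (d : G'.D) :
    Path (G.vert (E.sec (G'.init d))) (G.vert (E.sec (G'.term d))) :=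
  (E.between (G.edgePath (E.onD.symm d).1)).cast
    (by rw [← E.init, Equiv.apply_symm_apply]) (by rw [← E.term, Equiv.apply_symm_apply])

theorem invPath_apply (d : G'.D) (t : I) :
    E.invPath d t = E.between (G.edgePath (E.onD.symm d).1) t := rfl

theorem invPath_onD (z) (t : I) : E.invPath (E.onD z) t = E.between (G.edgePath z.1) t := by
  rw [invPath_apply]
  exact congrArg (fun z : {d // d ≠ d₀ ∧ d ≠ G.bar d₀} => E.between (G.edgePath z.1) t)
    (E.onD.symm_apply_apply z)

theorem invPath_bar (d : G'.D) : (E.invPath (G'.bar d)).Homotopic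
    ((E.invPath d).symm.cast (congrArg (fun v => G.vert (E.sec v)) (G'.init_bar d))
      (congrArg (fun v => G.vert (E.sec v)) (G'.term_bar d))) := by
  obtain ⟨⟨e, he⟩, rfl⟩ := E.onD.surjective d
  have h1 := E.between_symm (G.edgePath e)
  have h2 := h1.pathCast (congrArg (fun w => G.vert (E.sec (E.onV w))) (G.init_bar e))
    (congrArg (fun w => G.vert (E.sec (E.onV w))) (G.term_bar e))
  rw [← E.between_cast (G.init_bar e) (G.term_bar e), ← G.edgePath_bar] at h2
  have h3 := h2.pathCast
    (x₂ := G.vert (E.sec (G'.init (G'.bar (E.onD ⟨e, he⟩)))))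
    (x₃ := G.vert (E.sec (G'.term (G'.bar (E.onD ⟨e, he⟩)))))
    (by rw [E.bar, E.init]) (by rw [E.bar, E.term])
  refine (Eq.mpr (congrArg (Path.Homotopic · _) ?_) h3).trans
    (Eq.mpr (congrArg (Path.Homotopic _) ?_) (Path.Homotopic.refl _))
  · ext t
    refine (congrArg (fun d => E.invPath d t) (E.bar ⟨e, he⟩)).trans ?_
    exact E.invPath_onD ⟨G.bar e, G.remaining_bar he⟩ t
  · ext t
    exact E.invPath_onD ⟨e, he⟩ (σ t)

/-- The homotopy inverse of the collapse map. -/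
def inv : C(G'.Space, G.Space) := G'.glue (fun v => G.vert (E.sec v)) E.invPath

theorem edgeClass_inv (d : G'.D) :
    G'.edgeClass E.inv d = Path.Homotopic.Quotient.mk (E.invPath d) :=
  G'.edgeClass_glue _ _ E.invPath_bar d

/-- The homotopy returns each chosen vertex along the reversed path `toSec`. On a surviving edge the
added paths cancel; on `d₀` all classes are segments of `d₀`, so only their end parameters matter.
-/
theorem inv_comp_map : (E.inv.comp E.map).Homotopic (ContinuousMap.id _) := by
  refine G.homotopic_of_edgeClass
    (fun w => (Path.Homotopic.Quotient.mk (E.toSec w)).symm) fun d => ?_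
  by_cases h : d ≠ d₀ ∧ d ≠ G.bar d₀
  · have h1 : G.edgeClass (E.inv.comp E.map) d
        = Path.Homotopic.Quotient.mk (E.between (G.edgePath d)) := by
      have h2 : G.edgeImage (E.inv.comp E.map) d = (G'.edgeImage E.inv (E.onD ⟨d, h⟩)).cast
          (congrArg (fun v => G.vert (E.sec v)) (E.init ⟨d, h⟩).symm)
          (congrArg (fun v => G.vert (E.sec v)) (E.term ⟨d, h⟩).symm) := by
        ext t
        exact congrArg E.inv (E.map_pt h t)
      have h3 := E.edgeClass_inv (E.onD ⟨d, h⟩)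
      refine (congrArg Path.Homotopic.Quotient.mk h2).trans (Eq.trans (congrArg
        (fun P => Path.Homotopic.Quotient.cast P
          (congrArg (fun v => G.vert (E.sec v)) (E.init ⟨d, h⟩).symm)
          (congrArg (fun v => G.vert (E.sec v)) (E.term ⟨d, h⟩).symm)) h3) ?_)
      have h4 : (E.invPath (E.onD ⟨d, h⟩)).cast
          (congrArg (fun v => G.vert (E.sec v)) (E.init ⟨d, h⟩).symm)
          (congrArg (fun v => G.vert (E.sec v)) (E.term ⟨d, h⟩).symm)
          = E.between (G.edgePath d) := Path.ext (funext fun t => E.invPath_onD ⟨d, h⟩ t)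
      exact congrArg Path.Homotopic.Quotient.mk h4
    rw [h1]
    have h4 : G.edgeClass (ContinuousMap.id G.Space) d
        = Path.Homotopic.Quotient.mk (G.edgePath d) := rfl
    rw [h4]
    simp only [between, Path.Homotopic.Quotient.mk_trans, Path.Homotopic.Quotient.mk_symm]
    refine (Path.Homotopic.Quotient.trans_assoc _ _ _).trans ?_
    refine (congrArg _ (Path.Homotopic.Quotient.trans_symm _)).trans ?_
    exact Path.Homotopic.Quotient.trans_refl _
  -- The collapsed edge: `b` is the parameter on `d₀` of the vertex that represents the merged
  -- vertex, namely `0` or `1`.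
  · obtain ⟨b, hb⟩ : ∃ b, G.vert (E.sec (E.onV (G.init d₀))) = G.pt d₀ b := by
      rcases (E.onV_eq_iff _ _).1 (E.onV_sec (E.onV (G.init d₀))) with h1 | ⟨h1, -⟩ | ⟨h1, -⟩
      · exact ⟨0, by rw [h1, pt_zero]⟩
      · exact ⟨0, by rw [h1, pt_zero]⟩
      · exact ⟨1, by rw [h1, pt_one]⟩
    have hconst (t : I) : E.inv (E.map (G.pt d t)) = G.vert (E.sec (E.onV (G.init d₀))) :=
      congrArg E.inv (E.map_pt_of_not h t)
    have hbi : G.vert (E.sec (E.onV (G.init d))) = G.pt d₀ b := by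
      rw [E.onV_bar_of_not h, hb]
    have hbt : G.vert (E.sec (E.onV (G.term d))) = G.pt d₀ b := by
      have := hconst 1
      rw [pt_one] at this
      exact this.trans hb
    have h1 : G.edgeClass (E.inv.comp E.map) d = G.seg d₀ hbi hbt := by
      refine G.mk_const_eq_seg _ (fun t => ?_) d₀ _ _
      exact (hconst t).trans (hb.trans hbi.symm)
    rw [h1]
    have fin {a c : I} (ha : G.vert (G.init d) = G.pt d₀ a) (hc : G.vert (G.term d) = G.pt d₀ c)
        (h2 : Path.Homotopic.Quotient.mk (G.edgePath d) = G.seg d₀ ha hc) :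
        (G.seg d₀ hbi hbt).trans (Path.Homotopic.Quotient.mk (E.toSec (G.term d))).symm =
        (Path.Homotopic.Quotient.mk (E.toSec (G.init d))).symm.trans
          (Path.Homotopic.Quotient.mk (G.edgePath d)) := by
      have hsymm {x y : G.Space} {s t : I} (hx : x = G.pt d₀ s) (hy : y = G.pt d₀ t) :
          (G.seg d₀ hx hy).symm = G.seg d₀ hy hx := by
        subst hx hy
        exact G.mk_eq_seg d₀ ((unitLine s t).map (G.continuous_pt d₀)).symm (unitLine s t).symm
          (fun _ => rfl) rfl rfl
      rw [h2, E.mk_toSec ha hbi, E.mk_toSec hc hbt, hsymm, hsymm, seg_trans, seg_trans]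
    by_cases h2 : d = d₀
    · subst h2
      exact fin _ _ (G.mk_edgePath d)
    · have h3 : d = G.bar d₀ := by_contra fun h3 => h ⟨h2, h3⟩
      subst h3
      refine fin (a := 1) (c := 0) (G.pt_one d₀).symm ?_ ?_
      · rw [term_bar, pt_zero]
      · exact G.mk_eq_seg d₀ _ Path.id.symm (fun t => G.pt_bar d₀ t) _ _

/-- The paths `toSec` become constant after the collapse, so every edge of `G'` comes back to itself
up to homotopy. -/
theorem map_comp_inv : (E.map.comp E.inv).Homotopic (ContinuousMap.id _) := by
  have hv (v : G'.V) : G'.vert v = E.map (E.inv (G'.vert v)) :=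
    (congrArg G'.vert (E.onV_sec v)).symm
  refine G'.homotopic_of_edgeClass
    (fun v => Path.Homotopic.Quotient.mk ((Path.refl (G'.vert v)).cast (hv v).symm rfl)) fun d => ?_
  obtain ⟨⟨e, he⟩, rfl⟩ := E.onD.surjective d
  set d := E.onD ⟨e, he⟩ with hd
  have hi : E.map (E.inv (G'.vert (G'.init d))) = G'.pt d 0 := by rw [← hv, pt_zero]
  have ht : E.map (E.inv (G'.vert (G'.term d))) = G'.pt d 1 := by rw [← hv, pt_one]
  have hei : E.map (G.vert (G.init e)) = G'.pt d 0 := by rw [← G.pt_zero, E.map_pt he]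
  have het : E.map (G.vert (G.term e)) = G'.pt d 1 := by rw [← G.pt_one, E.map_pt he]
  have hsi : E.map (G.vert (E.sec (E.onV (G.init e)))) = G'.pt d 0 := by
    rw [← hei, E.map_vert, E.map_vert, E.onV_sec]
  have hst : E.map (G.vert (E.sec (E.onV (G.term e)))) = G'.pt d 1 := by
    rw [← het, E.map_vert, E.map_vert, E.onV_sec]
  have h1 : G'.edgeClass (E.map.comp E.inv) d = G'.seg d hi ht := by
    have h2 : G'.edgeClass (E.map.comp E.inv) d
        = Path.Homotopic.Quotient.mk ((E.invPath d).map E.map.continuous) :=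
      congrArg (fun P => Path.Homotopic.Quotient.map P E.map) (E.edgeClass_inv d)
    have h3 : Path.Homotopic.Quotient.mk ((E.between (G.edgePath e)).map E.map.continuous)
        = G'.seg d hsi hst := by
      rw [between, Path.map_trans, Path.map_trans, Path.Homotopic.Quotient.mk_trans,
        Path.Homotopic.Quotient.mk_trans]
      rw [G'.mk_const_eq_seg ((E.toSec (G.init e)).symm.map E.map.continuous)
        (fun t => (E.map_toSec _ _).trans (hei.trans hsi.symm)) d hsi hei,
        G'.mk_eq_seg d ((G.edgePath e).map E.map.continuous) Path.id
          (fun t => E.map_pt he t) hei het,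
        G'.mk_const_eq_seg ((E.toSec (G.term e)).map E.map.continuous)
        (fun t => E.map_toSec _ _) d het hst, seg_trans, seg_trans]
    have h4 : (E.invPath d).map E.map.continuous
        = ((E.between (G.edgePath e)).map E.map.continuous).cast
          (hi.trans hsi.symm) (ht.trans hst.symm) := by
      ext t
      change E.map (E.invPath d t) = E.map (E.between (G.edgePath e) t)
      exact congrArg E.map (E.invPath_onD ⟨e, he⟩ t)
    exact h2.trans ((congrArg Path.Homotopic.Quotient.mk h4).trans
      (congrArg (fun P => Path.Homotopic.Quotient.cast P (hi.trans hsi.symm)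
        (ht.trans hst.symm)) h3))
  have h5 : G'.edgeClass (ContinuousMap.id G'.Space) d
      = G'.seg d (G'.pt_zero d).symm (G'.pt_one d).symm := G'.mk_edgePath d
  rw [h1, h5]
  have h6 := G'.mk_const_eq_seg ((Path.refl (G'.vert (G'.init d))).cast (hv _).symm rfl)
    (fun t => hv _) d hi (G'.pt_zero d).symm
  have h7 := G'.mk_const_eq_seg ((Path.refl (G'.vert (G'.term d))).cast (hv _).symm rfl)
    (fun t => hv _) d ht (G'.pt_one d).symm
  refine (congrArg _ h7).trans (Eq.trans ?_ (congrArg (fun P => Path.Homotopic.Quotient.trans P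
    (G'.seg d (G'.pt_zero d).symm (G'.pt_one d).symm)) h6.symm))
  exact (G'.seg_trans d hi ht (G'.pt_one d).symm).trans
    (G'.seg_trans d hi (G'.pt_zero d).symm (G'.pt_one d).symm).symm

/-- The collapse map of an edge is a homotopy equivalence. -/
def homotopyEquiv : ContinuousMap.HomotopyEquiv G.Space G'.Space where
  toFun := E.map
  invFun := E.inv
  left_inv := E.inv_comp_map
  right_inv := E.map_comp_inv

variable (d₀) in
/-- The edge that is collapsed, with both orientations. -/
def edgeSet : Set G.D := {d | ¬ (d ≠ d₀ ∧ d ≠ G.bar d₀)}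

theorem edgeUnion_edgeSet : G.edgeUnion (edgeSet d₀) = Set.range (G.pt d₀) := by
  ext x
  constructor
  · rintro ⟨d, hd, t, rfl⟩
    by_cases h1 : d = d₀
    · exact ⟨t, by rw [h1]⟩
    · have h2 : d = G.bar d₀ := by_contra fun h2 => hd ⟨h1, h2⟩
      exact ⟨σ t, by rw [h2, pt_bar]⟩
  · rintro ⟨t, rfl⟩
    exact ⟨d₀, fun h => h.1 rfl, t, rfl⟩

-- In a circuit the next edge is not the reversal, so within a single edge it must be the same
-- oriented edge again, which would make that edge a loop.
include E in
theorem isForest_edgeSet : G.IsForest (edgeSet d₀) := by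
  refine ⟨fun d hd h => hd (by simpa only [G.bar_bar] using G.remaining_bar h), ?_⟩
  rintro ⟨k, c, -, -, hS, hc⟩
  have key (d e : G.D) (hd : d ∈ edgeSet d₀) (he : e ∈ edgeSet d₀) : e = d ∨ e = G.bar d := by
    have h1 : ∀ d ∈ edgeSet d₀, d = d₀ ∨ d = G.bar d₀ := fun d hd => by
      by_cases h1 : d = d₀
      · exact Or.inl h1
      · exact Or.inr (by_contra fun h2 => hd ⟨h1, h2⟩)
    rcases h1 d hd with rfl | rfl <;> rcases h1 e he with rfl | rfl <;> simp [G.bar_bar]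
  have h1 := (key _ _ (hS 0) (hS 1)).resolve_right (hc 0).2
  have h2 := (hc 0).1
  rw [zero_add, h1] at h2
  have h3 := hS 0
  by_cases h4 : c 0 = d₀
  · rw [h4] at h2
    exact E.not_loop h2
  · have h5 : c 0 = G.bar d₀ := by_contra fun h5 => h3 ⟨h4, h5⟩
    rw [h5, term_bar] at h2
    exact E.not_loop h2.symm

theorem hasCollapseFibers : HasCollapseFibers E.map (edgeSet d₀) := by
  have hcomp : connectedComponentIn (G.edgeUnion (edgeSet d₀)) (G.pt d₀ 0)
      = Set.range (G.pt d₀) := by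
    rw [edgeUnion_edgeSet]
    exact (isPreconnected_range (G.continuous_pt d₀)).connectedComponentIn ⟨0, rfl⟩
  intro y
  rcases G'.eq_vert_or_pt y with ⟨v, rfl⟩ | ⟨d, t, h0, h1, rfl⟩
  · by_cases hv : v = E.onV (G.init d₀)
    · subst hv
      refine Or.inr ⟨G.pt d₀ 0, by rw [edgeUnion_edgeSet]; exact ⟨0, rfl⟩, ?_⟩
      rw [hcomp]
      ext x
      constructor
      · intro hx
        rcases G.eq_vert_or_pt x with ⟨w, rfl⟩ | ⟨d, t, h0, h1, rfl⟩
        · rcases (E.onV_eq_iff _ _).1 (G'.vert_injective hx) with rfl | ⟨rfl, -⟩ | ⟨rfl, -⟩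
          · exact ⟨0, G.pt_zero _⟩
          · exact ⟨0, G.pt_zero _⟩
          · exact ⟨1, G.pt_one _⟩
        · by_cases hd : d ≠ d₀ ∧ d ≠ G.bar d₀
          · rw [Set.mem_preimage, E.map_pt hd] at hx
            exact absurd hx (G'.pt_ne_vert h0 h1 _)
          · rw [← edgeUnion_edgeSet]
            exact ⟨d, hd, t, rfl⟩
      · rintro ⟨t, rfl⟩
        exact E.map_pt_self t
    · obtain ⟨w, rfl⟩ := E.surjective v
      refine Or.inl ⟨G.vert w, ?_, ?_⟩
      · rw [edgeUnion_edgeSet]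
        rintro ⟨t, ht⟩
        have h2 := E.map_pt_self t
        rw [ht, E.map_vert] at h2
        exact hv (G'.vert_injective h2)
      · ext x
        constructor
        · intro hx
          rcases G.eq_vert_or_pt x with ⟨w', rfl⟩ | ⟨d, t, h0, h1, rfl⟩
          · rcases (E.onV_eq_iff _ _).1 (G'.vert_injective hx) with rfl | ⟨rfl, rfl⟩ | ⟨rfl, rfl⟩
            · rfl
            · exact absurd E.onV_init_eq.symm hv
            · exact absurd rfl hv
          · by_cases hd : d ≠ d₀ ∧ d ≠ G.bar d₀
            · rw [Set.mem_preimage, E.map_pt hd] at hx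
              exact absurd hx (G'.pt_ne_vert h0 h1 _)
            · rw [Set.mem_preimage, E.map_pt_of_not hd] at hx
              exact absurd (G'.vert_injective hx).symm hv
        · rintro rfl
          rfl
  · obtain ⟨⟨e, he⟩, rfl⟩ := E.onD.surjective d
    refine Or.inl ⟨G.pt e t, ?_, ?_⟩
    · rw [edgeUnion_edgeSet]
      rintro ⟨s, hs⟩
      have h2 := E.map_pt_self s
      rw [hs, E.map_pt he] at h2
      exact G'.pt_ne_vert h0 h1 _ h2
    · ext x
      constructor
      · intro hx
        rcases G.eq_vert_or_pt x with ⟨w', rfl⟩ | ⟨e', s, hs0, hs1, rfl⟩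
        · exact absurd hx.symm (G'.pt_ne_vert h0 h1 _)
        · by_cases hd : e' ≠ d₀ ∧ e' ≠ G.bar d₀
          · rw [Set.mem_preimage, E.map_pt hd] at hx
            rcases G'.eq_of_pt_eq_pt h0 h1 hx with ⟨h2, rfl⟩ | ⟨h2, rfl⟩
            · have h3 := congrArg Subtype.val (E.onD.injective h2)
              change e' = e at h3
              rw [h3]
              rfl
            · rw [E.bar] at h2
              have h3 := congrArg Subtype.val (E.onD.injective h2)
              change e' = G.bar e at h3
              rw [h3, pt_bar, unitInterval.symm_symm]
              rfl
          · rw [Set.mem_preimage, E.map_pt_of_not hd] at hx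
            exact absurd hx.symm (G'.pt_ne_vert h0 h1 _)
      · rintro rfl
        exact E.map_pt he t

end EdgeCollapse

end OuterSpace

end

/-! ### Joining every marked graph to a rose -/

noncomputable section

namespace OuterSpace

/-! ### Collapses of marked graphs -/

namespace EdgeCollapse

variable {G G' : FinGraph} {d₀ : G.D} (E : EdgeCollapse G G' d₀)

theorem card_init_eq (v : G.V) : G'.valence (E.onV v)
    = Nat.card {d : G.D // (d ≠ d₀ ∧ d ≠ G.bar d₀) ∧ E.onV (G.init d) = E.onV v} := by
  refine Nat.card_congr ((E.onD.subtypeEquiv fun d => ?_).symm.trans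
    (Equiv.subtypeSubtypeEquivSubtypeInter (fun d => d ≠ d₀ ∧ d ≠ G.bar d₀)
      fun d => E.onV (G.init d) = E.onV v))
  rw [E.init]

theorem valence_of_ne {v : G.V} (h : v ≠ G.init d₀) (h' : v ≠ G.term d₀) :
    G'.valence (E.onV v) = G.valence v := by
  rw [E.card_init_eq]
  refine Nat.card_congr (Equiv.subtypeEquivRight fun d => ?_)
  rw [E.onV_eq_iff]
  constructor
  · rintro ⟨-, h1 | ⟨-, h1⟩ | ⟨-, h1⟩⟩
    · exact h1
    · exact absurd h1 h'
    · exact absurd h1 h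
  · rintro rfl
    refine ⟨⟨?_, ?_⟩, Or.inl rfl⟩
    · rintro rfl
      exact h rfl
    · rintro rfl
      exact h' rfl

/-- The half-edges at the merged vertex are those at the two ends of `d₀`, except `d₀` and its
reversal. -/
theorem valence_init :
    G'.valence (E.onV (G.init d₀)) + 2 = G.valence (G.init d₀) + G.valence (G.term d₀) := by
  classical
  rw [E.card_init_eq, FinGraph.valence, FinGraph.valence]
  simp only [Nat.card_eq_fintype_card, Fintype.card_subtype]
  rw [← Finset.card_union_of_disjoint]
  · have h1 : (Finset.univ.filter fun d => G.init d = G.init d₀) ∪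
        (Finset.univ.filter fun d => G.init d = G.term d₀) =
        (Finset.univ.filter fun d => (d ≠ d₀ ∧ d ≠ G.bar d₀) ∧
          E.onV (G.init d) = E.onV (G.init d₀)) ∪ {d₀, G.bar d₀} := by
      ext d
      simp only [Finset.mem_union, Finset.mem_filter, Finset.mem_univ, true_and,
        Finset.mem_insert, Finset.mem_singleton, E.onV_eq_iff]
      by_cases h1 : d = d₀
      · simp [h1]
      · by_cases h2 : d = G.bar d₀
        · simp [h2]
        · simp only [h1, h2, ne_eq, not_false_eq_true, true_and, or_self, or_false]
          constructor
          · rintro (h | h) <;> simp [h]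
          · rintro (h | ⟨h, -⟩ | ⟨h, -⟩) <;> simp [h]
    rw [h1, Finset.card_union_of_disjoint, Finset.card_pair (G.bar_ne d₀).symm]
    rw [Finset.disjoint_left]
    intro d hd
    simp only [Finset.mem_filter] at hd
    simp [hd.2.1]
  · rw [Finset.disjoint_left]
    intro d hd hd'
    simp only [Finset.mem_filter, Finset.mem_univ, true_and] at hd hd'
    exact E.not_loop (hd.symm.trans hd')

include E in
theorem card_D : Fintype.card G.D = Fintype.card G'.D + 2 := by
  classical
  rw [← Fintype.card_congr E.onD, Fintype.card_subtype]
  have h1 : (Finset.univ : Finset G.D) = (Finset.univ.filter fun d => d ≠ d₀ ∧ d ≠ G.bar d₀) ∪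
      {d₀, G.bar d₀} := by
    ext d
    simp
    tauto
  rw [← Finset.card_univ, h1, Finset.card_union_of_disjoint, Finset.card_pair (G.bar_ne d₀).symm]
  · rw [← h1]
  · rw [Finset.disjoint_left]
    intro d hd
    simp only [Finset.mem_filter] at hd
    simp [hd.2.1, hd.2.2]

include E in
theorem card_V : Fintype.card G.V = Fintype.card G'.V + 1 := by
  classical
  have h1 : Function.Bijective fun w : {w // w ≠ G.term d₀} => E.onV w.1 := by
    constructor
    · rintro ⟨v, hv⟩ ⟨w, hw⟩ h
      rcases (E.onV_eq_iff _ _).1 h with h | ⟨-, h⟩ | ⟨h, -⟩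
      · exact Subtype.ext h
      · exact absurd h hw
      · exact absurd h hv
    · intro v
      obtain ⟨w, rfl⟩ := E.surjective v
      by_cases hw : w = G.term d₀
      · exact ⟨⟨G.init d₀, E.not_loop⟩, by rw [hw]; exact E.onV_init_eq⟩
      · exact ⟨⟨w, hw⟩, rfl⟩
  rw [← Fintype.card_of_bijective h1, Fintype.card_subtype_compl, Fintype.card_subtype_eq]
  have : 0 < Fintype.card G.V := Fintype.card_pos_iff.2 ⟨G.term d₀⟩
  omega

end EdgeCollapse

namespace MarkedGraph

variable {n : ℕ}

/-- The marked graph that results from the collapse of an edge. -/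
def collapse (M : MarkedGraph n) {G' : FinGraph} {d₀ : M.graph.D}
    (E : EdgeCollapse M.graph G' d₀) : MarkedGraph n where
  graph := G'
  connected := by
    have := M.connected
    exact E.hasCollapseFibers.surjective.connectedSpace E.map.continuous
  valence_ge v := by
    obtain ⟨w, rfl⟩ := E.surjective v
    have h1 := M.valence_ge (M.graph.init d₀)
    have h2 := M.valence_ge (M.graph.term d₀)
    -- The merged vertex has valence at least `3 + 3 - 2`.
    have h3 := E.valence_init
    by_cases hw : w = M.graph.init d₀
    · rw [hw]
      omega
    · by_cases hw' : w = M.graph.term d₀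
      · rw [hw', ← E.onV_init_eq]
        omega
      · rw [E.valence_of_ne hw hw']
        exact M.valence_ge w
  rank_eq := by
    have h1 := M.rank_eq
    rw [E.card_D, E.card_V] at h1
    omega
  marking := M.marking.trans E.homotopyEquiv

theorem isFace_collapse (M : MarkedGraph n) {G' : FinGraph} {d₀ : M.graph.D}
    (E : EdgeCollapse M.graph G' d₀) : Cell.IsFace (Cell.mk (M.collapse E)) (Cell.mk M) :=
  ⟨M.collapse E, M, rfl, rfl, E.map, ⟨E.homotopyEquiv, rfl⟩, ContinuousMap.Homotopic.refl _,
    EdgeCollapse.edgeSet d₀, E.isForest_edgeSet, E.hasCollapseFibers⟩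

end MarkedGraph

namespace FinGraph

open Classical in
/-- The graph that results from the collapse of an edge. -/
def contract (G : FinGraph) (d₀ : G.D) (h : G.init d₀ ≠ G.term d₀) : FinGraph where
  V := {v // v ≠ G.term d₀}
  D := {d // d ≠ d₀ ∧ d ≠ G.bar d₀}
  init d := if hd : G.init d.1 = G.term d₀ then ⟨G.init d₀, h⟩ else ⟨G.init d.1, hd⟩
  bar d := ⟨G.bar d.1, G.remaining_bar d.2⟩
  bar_bar d := Subtype.ext (G.bar_bar d.1)
  bar_ne d hd := G.bar_ne d.1 (congrArg Subtype.val hd)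

open Classical in
/-- The collapse of an edge that is not a loop. -/
def contraction (G : FinGraph) (d₀ : G.D) (h : G.init d₀ ≠ G.term d₀) :
    EdgeCollapse G (G.contract d₀ h) d₀ where
  onV v := if hv : v = G.term d₀ then ⟨G.init d₀, h⟩ else ⟨v, hv⟩
  onD := Equiv.refl _
  surjective v := ⟨v.1, dif_neg v.2⟩
  onV_eq_iff v w := by
    by_cases hv : v = G.term d₀ <;> by_cases hw : w = G.term d₀
    · simp [hv, hw]
      rfl
    · simp [hv, hw, Ne.symm hw]
      exact Subtype.ext_iff.trans eq_comm
    · simp [hv, hw]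
      exact Subtype.ext_iff
    · simp [hv, hw]
      exact Subtype.ext_iff
  init d := rfl
  bar d := rfl
  not_loop := h

/-- If all edges were loops, the indicator function of one vertex would extend to a continuous
nonconstant function with values in `Bool`. -/
theorem exists_not_loop (G : FinGraph) [ConnectedSpace G.Space] (h : 1 < Fintype.card G.V) :
    ∃ d, G.init d ≠ G.term d := by
  classical
  by_contra! hloop
  obtain ⟨v, w, hvw⟩ := Fintype.one_lt_card_iff.1 h
  let f : C(G.Space, Bool) := G.lift (fun u => decide (u = v))
    (fun d => ContinuousMap.const I (decide (G.init d = v)))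
    (fun d t => by
      change decide (G.init (G.bar d) = v) = decide (G.init d = v)
      rw [init_bar, hloop])
    (fun d => rfl)
  have h1 : f (G.vert v) = f (G.vert w) := PreconnectedSpace.constant inferInstance f.continuous
  have h2 : decide (v = v) = decide (w = v) := h1
  simp [hvw.symm] at h2

theorem nonempty_of_connected (G : FinGraph) [ConnectedSpace G.Space] : Nonempty G.V := by
  obtain ⟨x⟩ := (inferInstance : Nonempty G.Space)
  obtain ⟨v, -⟩ := G.exists_path_to_vert x
  exact ⟨v⟩

theorem connectedSpace_of_joined (G : FinGraph) (v₀ : G.V)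
    (h : ∀ v, Joined (G.vert v₀) (G.vert v)) : ConnectedSpace G.Space := by
  have : PathConnectedSpace G.Space := by
    refine ⟨⟨G.vert v₀⟩, fun x y => ?_⟩
    have key (x : G.Space) : Joined x (G.vert v₀) := by
      obtain ⟨v, hv⟩ := G.exists_path_to_vert x
      exact Joined.trans hv (h v).symm
    exact (key x).trans (key y).symm
  infer_instance

open Classical in
/-- A graph with one vertex is a rose. -/
theorem exists_iso_rose (G : FinGraph) {n : ℕ} (hV : Fintype.card G.V = 1)
    (hD : Fintype.card G.D = 2 * n) : Nonempty (G.Iso (roseGraph n)) := by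
  let e : G.D ≃ {d // G.Pos d} × Bool :=
    { toFun d := if h : G.Pos d then (⟨d, h⟩, true) else (⟨G.bar d, (G.pos_bar_iff d).2 h⟩, false)
      invFun p := if p.2 then p.1.1 else G.bar p.1.1
      left_inv d := by
        by_cases h : G.Pos d <;> simp [h, G.bar_bar]
      right_inv := by
        rintro ⟨⟨d, hd⟩, b⟩
        cases b
        · have h : ¬ G.Pos (G.bar d) := fun h => (G.pos_bar_iff d).1 h hd
          simp [h, G.bar_bar]
        · simp [hd] }
  have hc : Fintype.card {d // G.Pos d} = n := by
    have h1 := Fintype.card_congr e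
    rw [Fintype.card_prod, Fintype.card_bool] at h1
    omega
  let e' : G.D ≃ Fin n × Bool := e.trans ((Fintype.equivFinOfCardEq hc).prodCongr (Equiv.refl Bool))
  have hbar (d : G.D) : e (G.bar d) = ((e d).1, !(e d).2) := by
    by_cases h : G.Pos d
    · have h' : ¬ G.Pos (G.bar d) := fun h' => (G.pos_bar_iff d).1 h' h
      simp [e, h, h', G.bar_bar]
    · have h' : G.Pos (G.bar d) := (G.pos_bar_iff d).2 h
      simp [e, h, h']
  obtain ⟨v₀, hv₀⟩ := Fintype.card_eq_one_iff.1 hV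
  refine ⟨⟨⟨fun _ => (), fun _ => v₀, fun v => (hv₀ v).symm, fun _ => rfl⟩, e', fun d => rfl,
    fun d => ?_⟩⟩
  change ((Fintype.equivFinOfCardEq hc (e d).1, !(e d).2) : Fin n × Bool)
    = (Fintype.equivFinOfCardEq hc (e (G.bar d)).1, (e (G.bar d)).2)
  rw [hbar]

end FinGraph

/-- The base rose as a marked graph. -/
def roseMarked {n : ℕ} (hn : 2 ≤ n) : MarkedGraph n where
  graph := roseGraph n
  connected := (roseGraph n).connectedSpace_of_joined () fun _ => Joined.refl _
  valence_ge v := by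
    have h : (roseGraph n).valence v = Nat.card (Fin n × Bool) :=
      Nat.card_congr (Equiv.subtypeUnivEquiv fun d => rfl)
    rw [h, Nat.card_eq_fintype_card, Fintype.card_prod, Fintype.card_fin, Fintype.card_bool]
    omega
  rank_eq := by
    have h : Fintype.card (roseGraph n).D = Fintype.card (Fin n × Bool) := rfl
    have h' : Fintype.card (roseGraph n).V = Fintype.card Unit := rfl
    rw [h, h', Fintype.card_prod, Fintype.card_fin, Fintype.card_bool, Fintype.card_unit]
    omega
  marking := ContinuousMap.HomotopyEquiv.refl _

namespace Cell

variable {n : ℕ}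

/-- Two cells that are linked by a sequence of faces and cofaces. -/
abbrev Linked : Cell n → Cell n → Prop := Relation.EqvGen IsFace

theorem Linked.smul {c c' : Cell n} (h : Linked c c') (φ : (OutFree n)ᵐᵒᵖ) :
    Linked (φ • c) (φ • c') := by
  induction h with
  | rel c c' h => exact .rel _ _ (h.smul φ)
  | refl c => exact .refl _
  | symm _ _ _ ih => exact .symm _ _ ih
  | trans _ _ _ _ _ ih ih' => exact .trans _ _ _ ih ih'

/-- As long as there are two vertices, connectedness provides an edge that is not a loop, and its
collapse removes one vertex. -/
theorem exists_linked_one_vertex (M : MarkedGraph n) :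
    ∃ N : MarkedGraph n, Fintype.card N.graph.V = 1 ∧ Linked (mk M) (mk N) := by
  induction h : Fintype.card M.graph.V using Nat.strong_induction_on generalizing M with
  | _ k ih =>
    have := M.connected
    have hpos : 0 < Fintype.card M.graph.V := Fintype.card_pos_iff.2 M.graph.nonempty_of_connected
    by_cases h1 : Fintype.card M.graph.V = 1
    · exact ⟨M, h1, .refl _⟩
    · obtain ⟨d, hd⟩ := M.graph.exists_not_loop (by omega)
      let E := M.graph.contraction d hd
      have hcard := E.card_V
      obtain ⟨N, hN, hMN⟩ := ih (Fintype.card (M.collapse E).graph.V)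
        (by change Fintype.card (M.graph.contract d hd).V < k; omega) (M.collapse E) rfl
      exact ⟨N, hN, .trans _ _ _ (.symm _ _ (.rel _ _ (M.isFace_collapse E))) hMN⟩

/-- Every cell is linked to a translate of the cell of the base rose. -/
theorem exists_linked_rose (hn : 2 ≤ n) (c : Cell n) :
    ∃ φ : (OutFree n)ᵐᵒᵖ, Linked c (φ • mk (roseMarked hn)) := by
  obtain ⟨M, rfl⟩ := exists_mk_eq c
  obtain ⟨N, hN, hMN⟩ := exists_linked_one_vertex M
  have hD := N.rank_eq
  rw [hN] at hD
  obtain ⟨e⟩ := N.graph.exists_iso_rose (n := n) hN (by omega)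
  obtain ⟨Φ, hΦ⟩ := MarkedGraph.exists_twist (by omega) (M := roseMarked hn) (N := N)
    e.homeomorph.symm
  exact ⟨MulOpposite.op (Φ : OutFree n), by rw [smul_mk, hΦ]; exact hMN⟩

end Cell

end OuterSpace

end

/-! ### Joining the base rose to its translates by generators -/

noncomputable section

namespace OuterSpace

/-! ### The cells that are linked to the base rose -/

variable {n : ℕ}

/-- The class of a loop of the rose. -/
def loopClass (p : Path (roseBase n) (roseBase n)) :
    (FundamentalGroup (Rose n) (roseBase n))ᵐᵒᵖ :=
  MulOpposite.op (Path.Homotopic.Quotient.mk p)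

theorem loopHom_letter (d : Fin n × Bool) :
    loopHom (roseLoop n) (letter d) = loopClass ((roseGraph n).edgePath d) := by
  rw [letter, loopHom_mk]
  obtain ⟨k, b⟩ := d
  refine congrArg MulOpposite.op ?_
  cases b
  · have h : (roseLoop n k).symm = (roseGraph n).edgePath (k, false) := by
      ext t
      exact ((roseGraph n).pt_bar (k, true) t).symm
    change Path.Homotopic.Quotient.mk ((roseLoop n k).symm.trans (Path.refl _)) = _
    rw [Path.Homotopic.Quotient.mk_trans]
    refine (Path.Homotopic.Quotient.trans_refl _).trans (congrArg _ h)
  · change Path.Homotopic.Quotient.mk ((roseLoop n k).trans (Path.refl _)) = _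
    rw [Path.Homotopic.Quotient.mk_trans]
    exact Path.Homotopic.Quotient.trans_refl _

theorem roseMap_homotopic_autMap {p : Fin n → Path (roseBase n) (roseBase n)}
    (Φ : MulAut (FreeGroup (Fin n))) (h : ∀ k, loopClass (p k) = loopHom (roseLoop n) (Φ (FreeGroup.of k))) : (roseMap p).Homotopic (autMap Φ) := by
  refine roseMap_homotopic_of_loopHom ?_
  rw [loopHom_autMap]
  ext k
  exact Eq.trans (by simp [loopHom, loopClass]) (h k)

/-- The automorphisms that permute the basis up to inversion. -/
def IsSigned (Φ : MulAut (FreeGroup (Fin n))) : Prop :=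
  ∀ k, ∃ d, Φ (FreeGroup.of k) = letter d

/-- The automorphism that takes `s_i` to `s_j s_i` and fixes the other generators. -/
def transvection (i j : Fin n) (h : i ≠ j) : MulAut (FreeGroup (Fin n)) :=
  MonoidHom.toMulEquiv
    (FreeGroup.lift fun k => if k = i then FreeGroup.of j * FreeGroup.of i else FreeGroup.of k)
    (FreeGroup.lift fun k => if k = i then (FreeGroup.of j)⁻¹ * FreeGroup.of i else FreeGroup.of k)
    (by
      ext k
      by_cases hk : k = i
      · subst hk
        simp [h.symm]
      · simp [hk])
    (by
      ext k
      by_cases hk : k = i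
      · subst hk
        simp [h.symm]
      · simp [hk])

theorem transvection_of (i j : Fin n) (h : i ≠ j) (k : Fin n) : transvection i j h (FreeGroup.of k)
    = if k = i then FreeGroup.of j * FreeGroup.of i else FreeGroup.of k := by
  simp [transvection]

/-- The graph with two vertices that has the rose as its collapse in two ways. -/
abbrev blowUp (i j : Fin n) : FinGraph where
  V := Bool
  D := (Fin n × Bool) ⊕ Bool
  -- With the orientation `true`, the edges labelled `i` and `j` start at the vertex `true` and the
  -- other labelled edges at `false`; all of them end at `false`. The unlabelled edge `Sum.inr true`
  -- runs from `false` to `true`.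
  init := Sum.elim (fun d => d.2 && decide (d.1 = i ∨ d.1 = j)) (fun b => !b)
  bar := Sum.map (fun d => (d.1, !d.2)) (fun b => !b)
  bar_bar := by rintro (⟨k, b⟩ | b) <;> simp
  bar_ne := by rintro (⟨k, b⟩ | b) <;> simp

namespace blowUp

variable {i j : Fin n}

theorem eq_or_swap : ∀ x y : Bool, x ≠ y → ∀ v w : Bool,
    v = w ∨ (v = x ∧ w = y) ∨ (v = y ∧ w = x) := by
  decide

theorem onV_eq_iff {d : (blowUp i j).D} (h : (blowUp i j).init d ≠ (blowUp i j).term d)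
    (v w : (blowUp i j).V) : (() : (roseGraph n).V) = () ↔
    v = w ∨ (v = (blowUp i j).init d ∧ w = (blowUp i j).term d) ∨
      (v = (blowUp i j).term d ∧ w = (blowUp i j).init d) := by
  exact iff_of_true rfl (eq_or_swap _ _ h v w)

/-- The collapse of the edge between the vertices that is not labelled. -/
def collapseNew : EdgeCollapse (blowUp i j) (roseGraph n) (Sum.inr true) where
  onV _ := ()
  onD :=
    { toFun d := match d with
        | ⟨Sum.inl d, _⟩ => d
        | ⟨Sum.inr true, h⟩ => absurd rfl h.1
        | ⟨Sum.inr false, h⟩ => absurd rfl h.2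
      invFun d := ⟨Sum.inl d, by rintro ⟨⟩, by rintro ⟨⟩⟩
      left_inv := by
        rintro ⟨d | b, h⟩
        · rfl
        · cases b
          · exact absurd rfl h.2
          · exact absurd rfl h.1
      right_inv d := rfl }
  surjective _ := ⟨true, rfl⟩
  onV_eq_iff := onV_eq_iff (by change (false : Bool) ≠ true; decide)
  init _ := rfl
  bar := by
    rintro ⟨d | b, h⟩
    · rfl
    · cases b
      · exact absurd rfl h.2
      · exact absurd rfl h.1
  not_loop := by change (false : Bool) ≠ true; decide

/-- The collapse of the edge with label `j`. -/
def collapseOld : EdgeCollapse (blowUp i j) (roseGraph n) (Sum.inl (j, true)) where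
  onV _ := ()
  onD :=
    { toFun d := match d with
        | ⟨Sum.inl d, _⟩ => d
        -- The unlabelled edge takes over the label `j` of the collapsed edge.
        | ⟨Sum.inr b, h⟩ => (j, b)
      invFun d := if h : d.1 = j then ⟨Sum.inr d.2, by rintro ⟨⟩, by rintro ⟨⟩⟩ else
        ⟨Sum.inl d, by rintro ⟨⟩; exact h rfl, by rintro ⟨⟩; exact h rfl⟩
      left_inv := by
        rintro ⟨⟨k, b⟩ | b, h⟩
        · have hk : k ≠ j := by
            rintro rfl
            cases b
            · exact h.2 rfl
            · exact h.1 rfl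
          simp [hk]
        · simp
      right_inv := by
        rintro ⟨k, b⟩
        by_cases hk : k = j
        · subst hk
          simp
          rfl
        · simp [hk]
          rfl }
  surjective _ := ⟨true, rfl⟩
  onV_eq_iff := onV_eq_iff (by
    change (true && decide (j = i ∨ j = j)) ≠ (false && decide (j = i ∨ j = j))
    simp)
  init _ := rfl
  bar := by
    rintro ⟨d | b, h⟩ <;> rfl
  not_loop := by
    change (true && decide (j = i ∨ j = j)) ≠ (false && decide (j = i ∨ j = j))
    simp

/-- The marked graph that collapses to the base rose. -/
def marked (h : i ≠ j) : MarkedGraph n where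
  graph := blowUp i j
  connected := by
    refine (blowUp i j).connectedSpace_of_joined false fun v => ?_
    change Bool at v
    cases v
    · exact Joined.refl _
    · exact ⟨(blowUp i j).edgePath (Sum.inr true)⟩
  valence_ge b := by
    classical
    change Bool at b
    change 3 ≤ Nat.card {d : (blowUp i j).D // (blowUp i j).init d = b}
    rw [Nat.card_eq_fintype_card, Fintype.card_subtype]
    -- Three distinct half-edges at the vertex `b`; distinctness of the last two needs `i ≠ j`.
    have h1 : ({Sum.inr !b, Sum.inl (i, b), Sum.inl (j, b)} : Finset ((Fin n × Bool) ⊕ Bool)).card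
        = 3 := by
      rw [Finset.card_insert_of_notMem (by simp), Finset.card_pair (by simp [h])]
    rw [← h1]
    refine Finset.card_le_card fun d hd => ?_
    refine Finset.mem_filter.2 ⟨Finset.mem_univ (α := (blowUp i j).D) d, ?_⟩
    simp only [Finset.mem_insert, Finset.mem_singleton] at hd
    rcases hd with rfl | rfl | rfl
    · change (!!b) = b
      simp
    · change (b && decide (i = i ∨ i = j)) = b
      simp
    · change (b && decide (j = i ∨ j = j)) = b
      simp
  rank_eq := by
    have h1 : Fintype.card (blowUp i j).D = Fintype.card ((Fin n × Bool) ⊕ Bool) := rfl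
    have h2 : Fintype.card (blowUp i j).V = Fintype.card Bool := rfl
    rw [h1, h2]
    simp only [Fintype.card_sum, Fintype.card_prod, Fintype.card_fin, Fintype.card_bool]
    omega
  marking := (collapseNew (i := i) (j := j)).homotopyEquiv.symm

/-- The loops that are taken to the petals of the rose. -/
def loop (i j k : Fin n) : Path ((blowUp i j).vert false) ((blowUp i j).vert false) :=
  if h : k = i ∨ k = j then
    ((blowUp i j).edgePath (Sum.inr true)).trans (((blowUp i j).edgePath (Sum.inl (k, true))).cast
      (congrArg (blowUp i j).vert (by
        change true = (true && decide (k = i ∨ k = j))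
        simp [h])) rfl)
  else ((blowUp i j).edgePath (Sum.inl (k, true))).cast (congrArg (blowUp i j).vert (by
        change false = (true && decide (k = i ∨ k = j))
        simp [h])) rfl

theorem map_edgePath {G : FinGraph} {d₀ : G.D} (E : EdgeCollapse G (roseGraph n) d₀) {d : G.D}
    (h : d ≠ d₀ ∧ d ≠ G.bar d₀) : ((G.edgePath d).map E.map.continuous : Path (roseBase n) (roseBase n))
    = (roseGraph n).edgePath (E.onD ⟨d, h⟩) :=
  Path.ext (funext fun t => E.map_pt h t)

theorem map_edgePath_self {G : FinGraph} {d₀ : G.D} (E : EdgeCollapse G (roseGraph n) d₀) :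
    ((G.edgePath d₀).map E.map.continuous : Path (roseBase n) (roseBase n))
    = Path.refl (roseBase n) :=
  Path.ext (funext fun t => E.map_pt_self t)

theorem map_loop_of_mem {d₀ : (blowUp i j).D} (E : EdgeCollapse (blowUp i j) (roseGraph n) d₀)
    {k : Fin n} (h : k = i ∨ k = j) :
    loopClass ((loop i j k).map E.map.continuous)
    = loopClass (((blowUp i j).edgePath (Sum.inr true)).map E.map.continuous) *
      loopClass (((blowUp i j).edgePath (Sum.inl (k, true))).map E.map.continuous) := by
  have h1 : loop i j k = _ := dif_pos h
  rw [h1]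
  exact congrArg loopClass (Path.map_trans _ _ _)

theorem map_loop_of_not_mem {d₀ : (blowUp i j).D} (E : EdgeCollapse (blowUp i j) (roseGraph n) d₀)
    {k : Fin n} (h : ¬ (k = i ∨ k = j)) :
    ((loop i j k).map E.map.continuous : Path (roseBase n) (roseBase n))
    = ((blowUp i j).edgePath (Sum.inl (k, true))).map E.map.continuous := by
  have h1 : loop i j k = _ := dif_neg h
  rw [h1]
  rfl

theorem comp_roseMap_loop {d₀ : (blowUp i j).D} (E : EdgeCollapse (blowUp i j) (roseGraph n) d₀) :
    E.map.comp (roseMap (loop i j)) = roseMap (x := roseBase n)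
      fun k => (loop i j k).map E.map.continuous :=
  ContinuousMap.coe_injective (rose_hom_ext rfl fun _ _ => rfl)

theorem collapseNew_comp : ((collapseNew (i := i) (j := j)).map.comp (roseMap (loop i j))).Homotopic
    (ContinuousMap.id _) := by
  rw [comp_roseMap_loop]
  refine (roseMap_homotopic_autMap 1 fun k => ?_).trans autMap_one
  have hk : (Sum.inl (k, true) : (blowUp i j).D) ≠ Sum.inr true ∧
      (Sum.inl (k, true) : (blowUp i j).D) ≠ (blowUp i j).bar (Sum.inr true) :=
    ⟨by rintro ⟨⟩, by rintro ⟨⟩⟩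
  have h2 := map_edgePath (collapseNew (i := i) (j := j)) hk
  by_cases h : k = i ∨ k = j
  · rw [map_loop_of_mem _ h, map_edgePath_self, h2]
    exact (one_mul _).trans (loopHom_letter (k, true)).symm
  · rw [map_loop_of_not_mem _ h, h2]
    exact (loopHom_letter (k, true)).symm

/-- After this collapse the unlabelled edge reads `s_j` and the old edge `j` reads nothing. The loop
of `i` reads `s_j s_i`, that of `j` reads `s_j`, and the others keep their letters. -/
theorem collapseOld_comp (hij : i ≠ j) :
    ((collapseOld (i := i) (j := j)).map.comp (roseMap (loop i j))).Homotopic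
      (autMap (transvection i j hij)) := by
  rw [comp_roseMap_loop]
  refine roseMap_homotopic_autMap _ fun k => ?_
  have h1 := map_edgePath (collapseOld (i := i) (j := j)) (d := Sum.inr true)
    ⟨by rintro ⟨⟩, by rintro ⟨⟩⟩
  rw [transvection_of]
  by_cases hkj : k = j
  · subst hkj
    rw [map_loop_of_mem _ (Or.inr rfl), map_edgePath_self, h1, if_neg hij.symm]
    exact (mul_one _).trans (loopHom_letter (k, true)).symm
  · have h2 := map_edgePath (collapseOld (i := i) (j := j)) (d := Sum.inl (k, true))
      ⟨by rintro ⟨⟩; exact hkj rfl, by rintro ⟨⟩⟩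
    by_cases hki : k = i
    · subst hki
      rw [map_loop_of_mem _ (Or.inl rfl), h1, h2, if_pos rfl, map_mul]
      exact (congrArg₂ (· * ·) (loopHom_letter (j, true)) (loopHom_letter (k, true))).symm
    · rw [map_loop_of_not_mem _ (not_or.2 ⟨hki, hkj⟩), h2, if_neg hki]
      exact (loopHom_letter (k, true)).symm

end blowUp

namespace Cell

/-- Both roses are collapses of the marked graph `blowUp.marked`: the unlabelled edge gives the base
rose, the edge `j` gives the twisted one. -/
theorem linked_transvection (hn : 2 ≤ n) (i j : Fin n) (hij : i ≠ j) :
    Linked (mk (roseMarked hn)) (mk ((roseMarked hn).twist (transvection i j hij))) := by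
  let E := blowUp.collapseNew (i := i) (j := j)
  let E' := blowUp.collapseOld (i := i) (j := j)
  let B := blowUp.marked hij
  have h1 : mk (B.collapse E) = mk (roseMarked hn) :=
    Quotient.sound ⟨Homeomorph.refl _, E.map_comp_inv⟩
  have h2 : mk (B.collapse E') = mk ((roseMarked hn).twist (transvection i j hij)) := by
    refine Quotient.sound ⟨Homeomorph.refl _, ?_⟩
    have h3 : (E'.map.comp E.inv).Homotopic (autMap (transvection i j hij)) := by
      -- The map `roseMap (blowUp.loop i j)` is inserted; it is homotopic to `E.inv`, as a right
      -- inverse of `E.map` up to homotopy.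
      have h4 := (ContinuousMap.Homotopic.refl (E'.map.comp E.inv)).comp
        (blowUp.collapseNew_comp (i := i) (j := j)).symm
      have h5 := ((ContinuousMap.Homotopic.refl E'.map).comp E.inv_comp_map).comp
        (ContinuousMap.Homotopic.refl (roseMap (blowUp.loop i j)))
      exact (h4.trans h5).trans (blowUp.collapseOld_comp hij)
    exact h3
  rw [← h1, ← h2]
  exact .trans _ _ _ (.rel _ _ (B.isFace_collapse E)) (.symm _ _ (.rel _ _ (B.isFace_collapse E')))

/-- A signed permutation of the basis is realised by a symmetry of the rose, and this homeomorphism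
absorbs the twist. -/
theorem twist_of_isSigned (hn : 2 ≤ n) {Φ : MulAut (FreeGroup (Fin n))} (h : IsSigned Φ) :
    mk ((roseMarked hn).twist Φ) = mk (roseMarked hn) := by
  choose d hd using h
  have hinj : Function.Injective fun x : Fin n × Bool => ((d x.1).1, if x.2 then (d x.1).2
      else !(d x.1).2) := by
    have key (x : Fin n × Bool) : Φ (letter x) = letter ((d x.1).1, if x.2 then (d x.1).2
        else !(d x.1).2) := by
      obtain ⟨k, b⟩ := x
      cases b
      · have h1 : letter (k, false) = (FreeGroup.of k)⁻¹ := by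
          rw [eq_inv_iff_mul_eq_one]
          exact letter_mul_letter k false
        rw [h1, map_inv, hd, inv_eq_iff_mul_eq_one]
        exact letter_mul_letter (d k).1 (d k).2
      · exact hd k
    have hl : Function.Injective (letter : Fin n × Bool → FreeGroup (Fin n)) := by
      intro x y hxy
      have := congrArg FreeGroup.toWord hxy
      simpa [letter] using this
    intro x y hxy
    apply hl
    apply Φ.injective
    rw [key, key]
    exact congrArg letter hxy
  let e : (roseGraph n).Iso (roseGraph n) :=
    { onV := Equiv.refl _
      onD := Equiv.ofBijective _ (Finite.injective_iff_bijective.1 hinj)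
      init := fun _ => rfl
      bar := by
        rintro ⟨k, b⟩
        cases b
        · exact Prod.ext rfl (Bool.not_not _)
        · rfl }
  refine Quotient.sound (Setoid.symm ⟨e.homeomorph, ?_⟩)
  have h1 : e.map = roseMap (x := roseBase n) fun k => (roseGraph n).edgePath (d k) :=
    ContinuousMap.coe_injective (rose_hom_ext rfl fun _ _ => rfl)
  have h2 : e.map.Homotopic (autMap Φ) := by
    rw [h1]
    exact roseMap_homotopic_autMap Φ fun k => by rw [hd]; exact (loopHom_letter (d k)).symm
  exact h2

/-- The automorphisms that take the base rose to a linked cell. -/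
def linkedSubgroup (hn : 2 ≤ n) : Subgroup (MulAut (FreeGroup (Fin n))) where
  carrier := {Φ | Linked (mk (roseMarked hn)) (mk ((roseMarked hn).twist Φ))}
  one_mem' := by
    have h : mk ((roseMarked hn).twist 1) = mk (roseMarked hn) :=
      one_smul (OutFree n)ᵐᵒᵖ (mk (roseMarked hn))
    change Linked _ (mk ((roseMarked hn).twist 1))
    rw [h]
    exact .refl _
  mul_mem' {Φ Ψ} hΦ hΨ := by
    have h : mk ((roseMarked hn).twist (Φ * Ψ)) = MulOpposite.op (Ψ : OutFree n) •
        mk ((roseMarked hn).twist Φ) :=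
      mul_smul (MulOpposite.op (Ψ : OutFree n)) (MulOpposite.op (Φ : OutFree n))
        (mk (roseMarked hn))
    change Linked _ (mk ((roseMarked hn).twist (Φ * Ψ)))
    rw [h]
    -- The chain from the rose to its translate by `Ψ` is followed by the chain for `Φ` translated
    -- by `Ψ`.
    exact .trans _ _ _ hΨ (Linked.smul hΦ (MulOpposite.op (Ψ : OutFree n)))
  inv_mem' {Φ} hΦ := by
    have h := Linked.smul hΦ (MulOpposite.op (Φ : OutFree n))⁻¹
    rw [← smul_mk, inv_smul_smul] at h
    exact .symm _ _ h

end Cell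

end OuterSpace

end

/-! ### Nielsen reduction and generators of the automorphism group -/

noncomputable section

namespace OuterSpace

/-! ### Common prefixes of reduced words -/

section CommonPrefix

variable {α : Type*} [DecidableEq α]

/-- The length of the longest common prefix of two lists. -/
def commonPrefix : List α → List α → ℕ
  | a :: l, b :: m => if a = b then commonPrefix l m + 1 else 0
  | [], _ => 0
  | _ :: _, [] => 0

theorem commonPrefix_nil_left (l : List α) : commonPrefix [] l = 0 := by
  cases l <;> rfl

theorem commonPrefix_nil_right (l : List α) : commonPrefix l [] = 0 := by
  cases l <;> rfl

theorem commonPrefix_comm (l m : List α) : commonPrefix l m = commonPrefix m l := by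
  induction l generalizing m with
  | nil => rw [commonPrefix_nil_left, commonPrefix_nil_right]
  | cons a l ih =>
    cases m with
    | nil => rfl
    | cons b m => simp only [commonPrefix, eq_comm (a := a), ih]

/-- The ultrametric inequality for common prefixes. It is what transfers overlaps from the image of
a letter to the image of a word. -/
theorem min_commonPrefix_le (l m k : List α) :
    min (commonPrefix l m) (commonPrefix m k) ≤ commonPrefix l k := by
  induction l generalizing m k with
  | nil => simp [commonPrefix_nil_left]
  | cons a l ih =>
    cases m with
    | nil => simp [commonPrefix_nil_left, commonPrefix_nil_right]
    | cons b m =>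
      cases k with
      | nil => simp [commonPrefix_nil_right]
      | cons c k =>
        have := ih m k
        simp only [commonPrefix]
        split_ifs <;> first | omega | simp_all

theorem take_commonPrefix (l m : List α) :
    l.take (commonPrefix l m) = m.take (commonPrefix l m) := by
  induction l generalizing m with
  | nil => simp [commonPrefix_nil_left]
  | cons a l ih =>
    cases m with
    | nil => simp [commonPrefix]
    | cons b m =>
      simp only [commonPrefix]
      split_ifs with h
      · simp [h, ih m]
      · simp

end CommonPrefix

section FreeGroupLength

open FreeGroup

variable {α : Type*} [DecidableEq α]

theorem isReduced_invRev {L : List (α × Bool)} (h : IsReduced L) : IsReduced (invRev L) :=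
  IsReduced.of_reduce_eq (by rw [reduce_invRev, h.reduce_eq])

theorem norm_mk_of_isReduced {L : List (α × Bool)} (h : IsReduced L) : (mk L).norm = L.length := by
  rw [FreeGroup.norm, toWord_mk, h.reduce_eq]

/-- In the product of the inverse of one reduced word with another exactly the common prefix
cancels, two letters at a time; once the first letters differ, the concatenation is reduced. -/
theorem norm_inv_mk_mul_mk {L M : List (α × Bool)} (hL : IsReduced L) (hM : IsReduced M) :
    ((mk L)⁻¹ * mk M).norm + 2 * commonPrefix L M = L.length + M.length := by
  induction L generalizing M with
  | nil =>
    rw [commonPrefix_nil_left, ← one_eq_mk, inv_one, one_mul, norm_mk_of_isReduced hM]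
    simp
  | cons a L ih =>
    cases M with
    | nil =>
      rw [commonPrefix_nil_right, ← one_eq_mk, mul_one, norm_inv_eq, norm_mk_of_isReduced hL]
      simp
    | cons b M =>
      by_cases h : a = b
      · subst h
        have h1 : (mk (a :: L))⁻¹ * mk (a :: M) = (mk L)⁻¹ * mk M := by
          have h2 (L : List (α × Bool)) : mk (a :: L) = mk [a] * mk L := by rw [mul_mk]; rfl
          rw [h2 L, h2 M]
          group
        have := ih (M := M) (List.IsChain.tail hL) (List.IsChain.tail hM)
        simp only [h1, commonPrefix, if_true, List.length_cons]
        omega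
      · have h1 : IsReduced (invRev (a :: L) ++ b :: M) := by
          have h2 := isReduced_invRev hL
          rw [invRev_cons] at h2 ⊢
          refine List.isChain_append.2 ⟨h2, hM, ?_⟩
          intro x hx y hy
          obtain ⟨a₁, a₂⟩ := a
          simp [invRev] at hx hy
          subst hx hy
          intro h3
          obtain ⟨b₁, b₂⟩ := b
          simp only at h3 ⊢
          subst h3
          cases a₂ <;> cases b₂ <;> simp_all
        rw [inv_mk, mul_mk, norm_mk_of_isReduced h1]
        simp [commonPrefix, h]

/-- Twice the length of the common prefix of two reduced words. -/
theorem norm_inv_mul (x y : FreeGroup α) :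
    (x⁻¹ * y).norm + 2 * commonPrefix x.toWord y.toWord = x.norm + y.norm := by
  have h := norm_inv_mk_mul_mk (isReduced_toWord (x := x)) (isReduced_toWord (x := y))
  rwa [mk_toWord, mk_toWord] at h

/-- If a word agreed with its inverse on at least half of its length, then either it would be `u *
u⁻¹` (even length), or its middle letter would be its own inverse (odd length). -/
theorem two_mul_commonPrefix_inv_lt {y : FreeGroup α} (hy : y ≠ 1) :
    2 * commonPrefix y.toWord y⁻¹.toWord < y.norm := by
  by_contra! h
  rw [toWord_inv] at h
  set w := y.toWord with hw
  have hlen : y.norm = w.length := rfl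
  have h0 : 0 < w.length := by
    rw [← hlen]
    exact Nat.pos_of_ne_zero fun h => hy (norm_eq_zero.1 h)
  have h1 := take_commonPrefix w (invRev w)
  have h2 (m : ℕ) (hm : m ≤ commonPrefix w (invRev w)) : w.take m = (invRev w).take m := by
    have := congrArg (List.take m) h1
    rwa [List.take_take, List.take_take, min_eq_left hm] at this
  rcases Nat.even_or_odd' w.length with ⟨m, hm | hm⟩
  · have h3 := h2 m (by omega)
    have h4 : w.drop m = invRev (w.take m) := by
      have h5 : (w.take m ++ w.drop m) = w := List.take_append_drop m w
      have h6 : invRev w = invRev (w.drop m) ++ invRev (w.take m) := by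
        rw [← invRev_append, h5]
      have h7 : (invRev (w.drop m)).length = m := by
        rw [invRev_length, List.length_drop]
        omega
      have h8 : (invRev w).take m = invRev (w.drop m) := by
        rw [h6, List.take_append_of_le_length h7.ge, List.take_of_length_le h7.le]
      rw [h3, h8, invRev_invRev]
    apply hy
    have h5 : y = mk (w.take m ++ w.drop m) := by rw [List.take_append_drop, hw, mk_toWord]
    rw [h5, h4, ← mul_mk, ← inv_mk, mul_inv_cancel]
  · have h3 := h2 (m + 1) (by omega)
    have h4 := congrArg (fun l => l[m]?) h3
    simp only [List.getElem?_take_of_succ, invRev] at h4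
    rw [List.getElem?_reverse (by simp; omega)] at h4
    have h5 : (List.map (fun g : α × Bool => (g.1, !g.2)) w).length - 1 - m = m := by
      simp
      omega
    rw [h5, List.getElem?_map, List.getElem?_eq_getElem (by omega)] at h4
    simp at h4
    have := congrArg Prod.snd h4
    simp at this

theorem toWord_mk_of_norm {L : List (α × Bool)} (h : (mk L).norm = L.length) :
    (mk L).toWord = L := by
  rw [FreeGroup.norm, toWord_mk] at h
  rw [toWord_mk]
  exact (reduce.red.sublist).eq_of_length h

end FreeGroupLength

/-! ### Nielsen reduced bases -/

open FreeGroup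

variable {n : ℕ}

/-- A number that determines a word of given length. -/
def wordValue (w : List (Fin n × Bool)) : ℕ :=
  Nat.ofDigits (2 * n + 2) (w.map fun d => (Fintype.equivFin (Fin n × Bool) d : ℕ))

theorem wordValue_append (p q : List (Fin n × Bool)) :
    wordValue (p ++ q) = wordValue p + (2 * n + 2) ^ p.length * wordValue q := by
  rw [wordValue, List.map_append, Nat.ofDigits_append, List.length_map]
  rfl

theorem eq_of_wordValue_eq {p q : List (Fin n × Bool)} (h : p.length = q.length)
    (hv : wordValue p = wordValue q) : p = q := by
  have hlt (w : List (Fin n × Bool)) : ∀ l ∈ w.map fun d => (Fintype.equivFin (Fin n × Bool) d : ℕ),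
      l < 2 * n + 2 := by
    intro l hl
    obtain ⟨d, -, rfl⟩ := List.mem_map.1 hl
    have h1 := (Fintype.equivFin (Fin n × Bool) d).2
    have h2 : Fintype.card (Fin n × Bool) = n * 2 := by simp
    omega
  have h1 := Nat.ofDigits_inj_of_len_eq (by omega : 1 < 2 * n + 2) (by simpa using h) (hlt p)
    (hlt q) hv
  exact List.map_injective_iff.2 (fun d e hde => (Fintype.equivFin (Fin n × Bool)).injective
    (Fin.ext hde)) h1

/-- The value of the first half of a word. -/
def halfValue (w : List (Fin n × Bool)) : ℕ := wordValue (w.take ((w.length + 1) / 2))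

/-- The sum of the values of the first halves of a reduced word and of its inverse. -/
def tieValue (x : FreeGroup (Fin n)) : ℕ := halfValue x.toWord + halfValue x⁻¹.toWord

theorem tieValue_inv (x : FreeGroup (Fin n)) : tieValue x⁻¹ = tieValue x := by
  rw [tieValue, tieValue, inv_inv, add_comm]

/-- Multiplication by `y⁻¹` replaces the prefix `p` of `x` by `q`. This prefix lies in the first
half of the word, so one summand of the tie value drops; the other one depends on the opposite half,
which does not change. -/
theorem tieValue_lt {x y : FreeGroup (Fin n)} {p q r : List (Fin n × Bool)}
    (hy : y = mk (p ++ invRev q)) (hpq : p.length = q.length) (hx : x.toWord = p ++ r)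
    (hxn : 2 * p.length ≤ x.norm) (hn : (y⁻¹ * x).norm = x.norm)
    (hlt : wordValue q < wordValue p) : tieValue (y⁻¹ * x) < tieValue x := by
  have hx' : x = mk (p ++ r) := by rw [← hx, mk_toWord]
  have hlen : x.norm = p.length + r.length := by rw [FreeGroup.norm, hx, List.length_append]
  have h1 : y⁻¹ * x = mk (q ++ r) := by
    rw [hx', hy, ← mul_mk, ← mul_mk, ← mul_mk, ← inv_mk]
    group
  have h2 : (y⁻¹ * x).toWord = q ++ r := by
    rw [h1]
    refine toWord_mk_of_norm ?_
    rw [← h1, hn, hlen, List.length_append, hpq]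
  have h3 : halfValue (q ++ r) < halfValue (p ++ r) := by
    have h5 : p.length ≤ (p.length + r.length + 1) / 2 := by omega
    rw [halfValue, halfValue, List.take_append, List.take_append, List.length_append,
      List.length_append, ← hpq, List.take_of_length_le h5,
      List.take_of_length_le (hpq ▸ h5), wordValue_append, wordValue_append, ← hpq]
    exact Nat.add_lt_add_right hlt _
  -- Since `p` is at most half of `x`, it is at most as long as `r`, and the first half of the
  -- inverse word lies within `invRev r`.
  have h4 (s : List (Fin n × Bool)) (hs : s.length = p.length) : halfValue (invRev (s ++ r))
      = wordValue ((invRev r).take ((p.length + r.length + 1) / 2)) := by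
    rw [halfValue, invRev_append, List.take_append_of_le_length]
    · simp [invRev_length, hs, add_comm]
    · simp [invRev_length, hs]
      omega
  rw [tieValue, tieValue, toWord_inv, toWord_inv, h2, hx, h4 q hpq.symm, h4 p rfl]
  omega

/-- The amount of cancellation in the product of `x⁻¹` and `y`. -/
def overlap (x y : FreeGroup (Fin n)) : ℕ := commonPrefix x.toWord y.toWord

theorem overlap_comm (x y : FreeGroup (Fin n)) : overlap x y = overlap y x :=
  commonPrefix_comm _ _

theorem letter_bar (k : Fin n) (b : Bool) : letter (k, !b) = (letter (k, b))⁻¹ := by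
  rw [eq_inv_iff_mul_eq_one]
  have h := letter_mul_letter k (!b)
  rwa [Bool.not_not] at h

theorem apply_letter (Φ : MulAut (FreeGroup (Fin n))) (d : Fin n × Bool) :
    Φ (letter d) = if d.2 then Φ (FreeGroup.of d.1) else (Φ (FreeGroup.of d.1))⁻¹ := by
  obtain ⟨k, b⟩ := d
  cases b
  · rw [show (k, false) = (k, !true) from rfl, letter_bar, _root_.map_inv]
    rfl
  · rfl

theorem eq_or_eq_bar {d e : Fin n × Bool} (h : d.1 = e.1) : d = e ∨ d = (e.1, !e.2) := by
  obtain ⟨k, b⟩ := d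
  obtain ⟨l, c⟩ := e
  obtain rfl : k = l := h
  cases b <;> cases c <;> simp

/-- A family of generators that admits no shortening by a Nielsen move and is minimal among the
families of the same length. -/
structure IsNielsenReduced (Φ : MulAut (FreeGroup (Fin n))) : Prop where
  norm_le : ∀ d e : Fin n × Bool, d.1 ≠ e.1 →
    (Φ (letter d)).norm ≤ (Φ (letter e) * Φ (letter d)).norm
  tieValue_le : ∀ d e : Fin n × Bool, d.1 ≠ e.1 →
    (Φ (letter e) * Φ (letter d)).norm = (Φ (letter d)).norm →
    tieValue (Φ (letter d)) ≤ tieValue (Φ (letter e) * Φ (letter d))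

namespace IsNielsenReduced

variable {Φ : MulAut (FreeGroup (Fin n))}

theorem letter_ne_one (Φ : MulAut (FreeGroup (Fin n))) (d : Fin n × Bool) : Φ (letter d) ≠ 1 := by
  rw [Ne, map_eq_one_iff Φ Φ.injective]
  intro h
  have := congrArg FreeGroup.norm h
  rw [letter, norm_mk_of_isReduced (by simp [FreeGroup.IsReduced])] at this
  simp at this

theorem apply_bar (Φ : MulAut (FreeGroup (Fin n))) (d : Fin n × Bool) :
    Φ (letter (d.1, !d.2)) = (Φ (letter d))⁻¹ := by
  rw [letter_bar, _root_.map_inv]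

/-- The move that replaces the image of `e` by its product with the inverse image of `d` does not
shorten, so at most half of the image of `d` cancels. -/
theorem two_mul_overlap_le_of_ne (h : IsNielsenReduced Φ) {d e : Fin n × Bool} (hde : d.1 ≠ e.1) :
    2 * overlap (Φ (letter d)) (Φ (letter e)) ≤ (Φ (letter d)).norm := by
  have h1 := h.norm_le e (d.1, !d.2) hde.symm
  rw [apply_bar] at h1
  have h2 := norm_inv_mul (Φ (letter d)) (Φ (letter e))
  rw [overlap]
  omega

theorem two_mul_overlap_le (h : IsNielsenReduced Φ) {d e : Fin n × Bool} (hde : d ≠ e) :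
    2 * overlap (Φ (letter d)) (Φ (letter e)) ≤ (Φ (letter d)).norm := by
  by_cases h1 : d.1 = e.1
  · have h2 := (eq_or_eq_bar h1.symm).resolve_left hde.symm
    rw [h2, apply_bar]
    exact (two_mul_commonPrefix_inv_lt (letter_ne_one Φ d)).le
  · exact h.two_mul_overlap_le_of_ne h1

/-- Here the image of `e` is `p` followed by the inverse of `q`, and the image of `d` starts with
`p`. The move that exchanges `p` for `q` in the image of `d` preserves its length, so minimality of
the tie value forbids a smaller value of `q`. -/
theorem tie_le (h : IsNielsenReduced Φ) {d e : Fin n × Bool} (hde : d.1 ≠ e.1)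
    {p q : List (Fin n × Bool)} (hp : p.length = q.length)
    (he : (Φ (letter e)).toWord = p ++ invRev q)
    (hov : overlap (Φ (letter e)) (Φ (letter d)) = p.length) : wordValue p ≤ wordValue q := by
  by_contra! hlt
  have h1 := norm_inv_mul (Φ (letter e)) (Φ (letter d))
  have h2 : (Φ (letter e)).norm = 2 * p.length := by
    rw [FreeGroup.norm, he, List.length_append, invRev_length, ← hp, two_mul]
  have h3 : 2 * p.length ≤ (Φ (letter d)).norm := by
    have := h.two_mul_overlap_le_of_ne hde
    rwa [overlap_comm, hov] at this
  have h4 : (Φ (letter d)).toWord = p ++ (Φ (letter d)).toWord.drop p.length := by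
    have h5 := take_commonPrefix (Φ (letter e)).toWord (Φ (letter d)).toWord
    rw [overlap] at hov
    rw [hov, he, List.take_left'  rfl] at h5
    conv_lhs => rw [← List.take_append_drop p.length (Φ (letter d)).toWord, ← h5]
  have h5 : ((Φ (letter e))⁻¹ * Φ (letter d)).norm = (Φ (letter d)).norm := by
    rw [overlap] at hov
    omega
  have h6 := tieValue_lt (by rw [← he, mk_toWord]) hp h4 h3 h5 hlt
  have h7 := h.tieValue_le d (e.1, !e.2) hde
  rw [apply_bar] at h7
  exact absurd (h7 h5) (not_le.2 h6)

/-- The image of a letter is never consumed entirely by the cancellation at its two ends. Each end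
consumes at most half. If both consumed exactly half, the two tie conditions would force the halves
`p` and `q` to coincide, and the image of `e` would be trivial. -/
theorem overlap_add_lt (h : IsNielsenReduced Φ) {d e f : Fin n × Bool} (hde : d ≠ e)
    (hf : f ≠ (e.1, !e.2)) : overlap (Φ (letter d)) (Φ (letter e)) +
      overlap (Φ (letter e))⁻¹ (Φ (letter f)) < (Φ (letter e)).norm := by
  have h1 := h.two_mul_overlap_le hde.symm
  have h2 := h.two_mul_overlap_le hf.symm
  have hlt := two_mul_commonPrefix_inv_lt (letter_ne_one Φ e)
  rw [apply_bar, norm_inv_eq] at h2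
  rw [overlap_comm] at h1
  -- With a neighbour of the same index, the overlap in question is that of an element with its
  -- inverse, where the bound by half is strict.
  by_cases hd : d.1 = e.1
  · have h3 := (eq_or_eq_bar hd).resolve_left hde
    rw [h3, apply_bar, overlap_comm (Φ (letter e))⁻¹ (Φ (letter e)), overlap] at h1 ⊢
    omega
  by_cases hf' : f.1 = e.1
  · have h3 : f = e := (eq_or_eq_bar hf').resolve_right hf
    rw [h3, overlap_comm (Φ (letter e))⁻¹ (Φ (letter e))] at h2 ⊢
    simp only [overlap] at *
    omega
  by_contra! hge
  have h3 : 2 * overlap (Φ (letter d)) (Φ (letter e)) = (Φ (letter e)).norm := by omega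
  have h4 : 2 * overlap (Φ (letter e))⁻¹ (Φ (letter f)) = (Φ (letter e)).norm := by omega
  set w := (Φ (letter e)).toWord with hw
  set m := overlap (Φ (letter d)) (Φ (letter e)) with hm
  have hlen : w.length = 2 * m := h3.symm
  have he : w = w.take m ++ invRev (invRev (w.drop m)) := by
    rw [invRev_invRev, List.take_append_drop]
  have hp : (w.take m).length = m := by
    rw [List.length_take]
    omega
  have hq : (invRev (w.drop m)).length = m := by
    rw [invRev_length, List.length_drop]
    omega
  have h5 := h.tie_le hd (hp.trans hq.symm) he (by rw [overlap_comm, hp])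
  have h6 := h.tie_le (d := f) (e := (e.1, !e.2)) hf' (p := invRev (w.drop m)) (q := w.take m)
    (hq.trans hp.symm) (by
      rw [apply_bar, toWord_inv, ← hw, ← invRev_append, List.take_append_drop])
    (by rw [apply_bar, hq]; omega)
  have h7 := eq_of_wordValue_eq (hp.trans hq.symm) (le_antisymm h5 h6)
  apply letter_ne_one Φ e
  rw [← mk_toWord (x := Φ (letter e)), ← hw, he, ← h7, ← mul_mk, ← inv_mk, mul_inv_cancel]

/-- By `overlap_add_lt`, the rest of the word does not cancel the image of `d` as far as the image
of `a` overlaps it, nor the next letter after that. So `a` sees only the first letter, and each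
further letter of the word adds at least one to the length of the image. -/
theorem overlap_word (h : IsNielsenReduced Φ) (L : List (Fin n × Bool)) :
    ∀ d, IsReduced (d :: L) → ∀ a, a ≠ d →
      overlap (Φ (letter a)) (Φ (FreeGroup.mk (d :: L))) = overlap (Φ (letter a)) (Φ (letter d)) ∧
      overlap (Φ (letter a)) (Φ (letter d)) + (L.length + 1) ≤ (Φ (FreeGroup.mk (d :: L))).norm := by
  induction L with
  | nil =>
    intro d _ a ha
    refine ⟨rfl, ?_⟩
    have h1 := h.two_mul_overlap_le ha.symm
    rw [overlap_comm] at h1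
    have h2 : (Φ (letter d)).norm ≠ 0 := fun h2 => letter_ne_one Φ d (norm_eq_zero.1 h2)
    change _ + (0 + 1) ≤ (Φ (letter d)).norm
    omega
  | cons e L ih =>
    intro d hd a ha
    have hde : (d.1, !d.2) ≠ e := by
      rintro rfl
      have := (List.isChain_cons_cons.1 hd).1 rfl
      simp at this
    obtain ⟨h1, h2⟩ := ih e (List.IsChain.tail hd) _ hde
    have h3 : Φ (FreeGroup.mk (d :: e :: L)) = Φ (letter d) * Φ (FreeGroup.mk (e :: L)) := by
      rw [← _root_.map_mul, letter, mul_mk]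
      rfl
    have h4 := h.overlap_add_lt ha hde.symm
    rw [apply_bar] at h1 h2
    rw [h3]
    set w := Φ (FreeGroup.mk (e :: L))
    have h5 := norm_inv_mul (Φ (letter d))⁻¹ w
    have h6 := norm_inv_mul (Φ (letter d)) (Φ (letter d) * w)
    rw [inv_inv, norm_inv_eq] at h5
    rw [inv_mul_cancel_left] at h6
    -- The overlap of `a` with the image of `d` is shorter than the part of the latter that
    -- survives, so both ultrametric inequalities together give equality of overlaps.
    have h7 := min_commonPrefix_le (Φ (letter a)).toWord (Φ (letter d)).toWord
      (Φ (letter d) * w).toWord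
    have h8 := min_commonPrefix_le (Φ (letter a)).toWord (Φ (letter d) * w).toWord
      (Φ (letter d)).toWord
    rw [commonPrefix_comm (Φ (letter d) * w).toWord] at h8
    rw [List.length_cons]
    simp only [overlap] at *
    omega

/-- A reduced family of generators is the given basis, up to order and inversion. -/
theorem isSigned_inv (h : IsNielsenReduced Φ) : IsSigned Φ⁻¹ := by
  intro k
  have h0 : Φ (Φ⁻¹ (FreeGroup.of k)) = FreeGroup.of k := MulAut.apply_inv_self _ Φ _
  have h1 : FreeGroup.mk (Φ⁻¹ (FreeGroup.of k)).toWord = Φ⁻¹ (FreeGroup.of k) := mk_toWord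
  have h2 := isReduced_toWord (x := Φ⁻¹ (FreeGroup.of k))
  rcases hL : (Φ⁻¹ (FreeGroup.of k)).toWord with _ | ⟨d, L⟩
  · rw [toWord_eq_nil_iff] at hL
    rw [hL, _root_.map_one] at h0
    exact absurd h0 (one_ne_of k)
  · rw [hL] at h1 h2
    -- The preimage of a generator is a word whose image has length 1. The length bound leaves a
    -- single letter.
    have h3 := (h.overlap_word L d h2 (d.1, !d.2) (by
      intro h4
      have := congrArg Prod.snd h4
      simp at this)).2
    rw [h1, h0, norm_of] at h3
    obtain rfl : L = [] := List.eq_nil_of_length_eq_zero (by omega)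
    exact ⟨d, h1.symm⟩

end IsNielsenReduced

/-- The automorphism that inverts some of the generators. -/
def signFlip (ε : Fin n → Bool) : MulAut (FreeGroup (Fin n)) :=
  have h : (FreeGroup.lift fun k => letter (k, ε k)).comp (FreeGroup.lift fun k => letter (k, ε k))
      = MonoidHom.id (FreeGroup (Fin n)) := by
    ext k
    cases hk : ε k
    · have h1 : letter (k, false) = (FreeGroup.of k)⁻¹ := letter_bar k true
      simp [hk, h1]
    · have h1 : letter (k, true) = FreeGroup.of k := rfl
      simp [hk, h1]
  MonoidHom.toMulEquiv (FreeGroup.lift fun k => letter (k, ε k))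
    (FreeGroup.lift fun k => letter (k, ε k)) h h

theorem signFlip_of (ε : Fin n → Bool) (k : Fin n) :
    signFlip ε (FreeGroup.of k) = letter (k, ε k) := by
  simp [signFlip]

theorem signFlip_letter (ε : Fin n → Bool) (k : Fin n) :
    signFlip ε (letter (k, ε k)) = FreeGroup.of k := by
  rw [apply_letter, signFlip_of]
  cases hk : ε k
  · exact inv_eq_of_mul_eq_one_right (letter_mul_letter k false)
  · rfl

section Generation

variable {H : Subgroup (MulAut (FreeGroup (Fin n)))}

/-- A transvection conjugated by a change of signs realises every elementary Nielsen move; `ε`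
carries the signs of `d` and `e`. -/
theorem exists_move (hs : ∀ Φ, IsSigned Φ → Φ ∈ H) (ht : ∀ i j h, transvection i j h ∈ H)
    (d e : Fin n × Bool) (hde : d.1 ≠ e.1) : ∃ T ∈ H, T (letter d) = letter e * letter d ∧
      ∀ k, k ≠ d.1 → T (FreeGroup.of k) = FreeGroup.of k := by
  let ε : Fin n → Bool := fun k => if k = d.1 then d.2 else if k = e.1 then e.2 else true
  have hd : letter d = letter (d.1, ε d.1) := by simp [ε]
  have he : letter e = letter (e.1, ε e.1) := by simp [ε, hde.symm]
  have hε : signFlip ε ∈ H := hs _ fun k => ⟨_, signFlip_of ε k⟩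
  refine ⟨signFlip ε * transvection d.1 e.1 hde * signFlip ε,
    H.mul_mem (H.mul_mem hε (ht _ _ _)) hε, ?_, fun k hk => ?_⟩
  · rw [MulAut.mul_apply, MulAut.mul_apply, hd, signFlip_letter, transvection_of, if_pos rfl,
      _root_.map_mul, signFlip_of, signFlip_of, he]
  · rw [MulAut.mul_apply, MulAut.mul_apply, signFlip_of, apply_letter, transvection_of, if_neg hk]
    have h1 := signFlip_letter ε k
    rw [apply_letter] at h1
    cases h2 : ε k
    · simpa [h2] using h1
    · simpa [h2] using h1

/-- Only the summand at `d.1` changes, and invariance of `f` under inversion makes the orientation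
of `d` irrelevant. -/
theorem sum_move (f : FreeGroup (Fin n) → ℕ) (hf : ∀ x, f x⁻¹ = f x)
    {Φ T : MulAut (FreeGroup (Fin n))} {d e : Fin n × Bool} (hd : T (letter d) = letter e * letter d)
    (hT : ∀ k, k ≠ d.1 → T (FreeGroup.of k) = FreeGroup.of k) :
    ∑ k, f ((Φ * T) (FreeGroup.of k)) + f (Φ (letter d))
      = ∑ k, f (Φ (FreeGroup.of k)) + f (Φ (letter e) * Φ (letter d)) := by
  have key (Ψ : MulAut (FreeGroup (Fin n))) : f (Ψ (FreeGroup.of d.1)) = f (Ψ (letter d)) := by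
    rw [apply_letter]
    split_ifs <;> simp [hf]
  rw [← Finset.add_sum_erase _ _ (Finset.mem_univ d.1),
    ← Finset.add_sum_erase _ (fun k => f (Φ (FreeGroup.of k))) (Finset.mem_univ d.1)]
  have h1 : ∑ k ∈ Finset.univ.erase d.1, f ((Φ * T) (FreeGroup.of k))
      = ∑ k ∈ Finset.univ.erase d.1, f (Φ (FreeGroup.of k)) :=
    Finset.sum_congr rfl fun k hk => by rw [MulAut.mul_apply, hT k (Finset.ne_of_mem_erase hk)]
  rw [h1, key, key, MulAut.mul_apply, hd, _root_.map_mul]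
  ring

/-- The automorphism group of a free group is generated by the transvections and the automorphisms
that permute the basis up to inversion. -/
theorem eq_top_of_transvection_mem (hs : ∀ Φ, IsSigned Φ → Φ ∈ H)
    (ht : ∀ i j h, transvection i j h ∈ H) : H = ⊤ := by
  rw [Subgroup.eq_top_iff']
  intro Φ
  -- Total length, with ties broken by the total tie value. A lexicographic minimum over the coset
  -- of `Φ` modulo `H` is Nielsen reduced, because moves multiply on the right by elements of `H`.
  let P (Ψ : MulAut (FreeGroup (Fin n))) : ℕ × ℕ :=
    (∑ k, (Ψ (FreeGroup.of k)).norm, ∑ k, tieValue (Ψ (FreeGroup.of k)))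
  obtain ⟨Ψ, hΨ, hmin⟩ := (InvImage.wf P (WellFounded.prod_lex Nat.lt_wfRel.wf
    Nat.lt_wfRel.wf)).has_min {Ψ | Φ⁻¹ * Ψ ∈ H} ⟨Φ, by simp [H.one_mem]⟩
  have hred : IsNielsenReduced Ψ := by
    constructor
    · intro d e hde
      obtain ⟨T, hT, h1, h2⟩ := exists_move hs ht d e hde
      have h3 := sum_move (fun x => x.norm) (fun x => norm_inv_eq) (Φ := Ψ) h1 h2
      by_contra! h4
      refine hmin (Ψ * T) (by
        change Φ⁻¹ * (Ψ * T) ∈ H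
        rw [← mul_assoc]
        exact H.mul_mem hΨ hT) (Prod.Lex.left _ _ ?_)
      change ∑ k, ((Ψ * T) (FreeGroup.of k)).norm < ∑ k, (Ψ (FreeGroup.of k)).norm
      omega
    · intro d e hde heq
      obtain ⟨T, hT, h1, h2⟩ := exists_move hs ht d e hde
      have h3 := sum_move (fun x => x.norm) (fun x => norm_inv_eq) (Φ := Ψ) h1 h2
      have h4 := sum_move tieValue tieValue_inv (Φ := Ψ) h1 h2
      by_contra! h5
      refine hmin (Ψ * T) (by
        change Φ⁻¹ * (Ψ * T) ∈ H
        rw [← mul_assoc]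
        exact H.mul_mem hΨ hT) ?_
      refine Prod.lex_def.2 (Or.inr ⟨?_, ?_⟩)
      · change ∑ k, ((Ψ * T) (FreeGroup.of k)).norm = ∑ k, (Ψ (FreeGroup.of k)).norm
        omega
      · change ∑ k, tieValue ((Ψ * T) (FreeGroup.of k)) < ∑ k, tieValue (Ψ (FreeGroup.of k))
        omega
  -- The reduced representative has a signed inverse, which lies in `H`; hence the coset of `Φ` is
  -- trivial.
  have h1 := H.mul_mem hΨ (hs _ hred.isSigned_inv)
  rw [mul_assoc, mul_inv_cancel, mul_one] at h1
  exact (H.inv_mem_iff).1 h1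

end Generation

/-- Both families of generators are finite: a signed automorphism is determined by the letters to
which it sends the basis, a transvection by two indices. -/
theorem fg_mulAut_freeGroup : Group.FG (MulAut (FreeGroup (Fin n))) := by
  have h1 : {Φ : MulAut (FreeGroup (Fin n)) | IsSigned Φ}.Finite := by
    refine Set.Finite.subset (Set.finite_range fun d : Fin n → Fin n × Bool =>
      open Classical in if h : ∃ Φ : MulAut (FreeGroup (Fin n)),
        ∀ k, Φ (FreeGroup.of k) = letter (d k) then h.choose else 1) ?_
    intro Φ hΦ
    choose d hd using hΦ
    have h : ∃ Φ : MulAut (FreeGroup (Fin n)), ∀ k, Φ (FreeGroup.of k) = letter (d k) := ⟨Φ, hd⟩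
    refine ⟨d, ?_⟩
    simp only [dif_pos h]
    refine MulEquiv.toMonoidHom_injective (FreeGroup.ext_hom _ _ fun k => ?_)
    exact (h.choose_spec k).trans (hd k).symm
  have h2 : {Φ : MulAut (FreeGroup (Fin n)) | ∃ i j h, transvection i j h = Φ}.Finite := by
    refine Set.Finite.subset (Set.finite_range fun p : {p : Fin n × Fin n // p.1 ≠ p.2} =>
      transvection p.1.1 p.1.2 p.2) ?_
    rintro _ ⟨i, j, h, rfl⟩
    exact ⟨⟨(i, j), h⟩, rfl⟩
  refine Group.fg_iff.2 ⟨_, eq_top_of_transvection_mem (fun Φ h => Subgroup.subset_closure ?_)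
    (fun i j h => Subgroup.subset_closure ?_), h1.union h2⟩
  · exact Or.inl h
  · exact Or.inr ⟨i, j, h, rfl⟩

instance fg_outFree : Group.FG (OutFree n) :=
  have := fg_mulAut_freeGroup (n := n)
  Group.fg_of_surjective (QuotientGroup.mk'_surjective (MulAut.conj (G := FreeGroup (Fin n))).range)

namespace Cell

/-- All cells are linked. -/
theorem linked (hn : 2 ≤ n) (c c' : Cell n) : Linked c c' := by
  have htop : linkedSubgroup hn = ⊤ := by
    refine eq_top_of_transvection_mem (fun Φ h => ?_) (fun i j h => linked_transvection hn i j h)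
    change Linked _ _
    rw [twist_of_isSigned hn h]
    exact .refl _
  have key (c : Cell n) : Linked c (mk (roseMarked hn)) := by
    obtain ⟨⟨φ⟩, hφ⟩ := exists_linked_rose hn c
    induction φ using QuotientGroup.induction_on with
    | H Φ =>
      have h : Φ ∈ linkedSubgroup hn := htop ▸ Subgroup.mem_top Φ
      exact .trans _ _ _ hφ (.symm _ _ h)
  exact .trans _ _ _ (key c) (.symm _ _ (key c'))

end Cell

end OuterSpace

end

/-! ### Lengths of piecewise linear paths in the spine -/

noncomputable section

namespace OuterSpace

/-! ### Piecewise linear paths in the spine -/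

namespace Spine

variable {n : ℕ}

theorem sq_segLength_eq (x y : Spine n) {S : Finset (Cell n)} (hx : x.coord.support ⊆ S)
    (hy : y.coord.support ⊆ S) :
    segLength x y = Real.sqrt ((∑ c ∈ S, (x.coord c - y.coord c) ^ 2) / 2) := by
  classical
  rw [segLength, Finsupp.sum_of_support_subset _
    (Finsupp.support_sub.trans (Finset.union_subset hx hy)) _ (by simp)]
  rfl

theorem segLength_nonneg (x y : Spine n) : 0 ≤ segLength x y := Real.sqrt_nonneg _

/-- The coordinates in a finite set of cells. -/
def euclid (S : Finset (Cell n)) (x : Spine n) : EuclideanSpace ℝ S :=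
  WithLp.toLp 2 fun c => x.coord c

theorem segLength_eq_dist (x y : Spine n) {S : Finset (Cell n)} (hx : x.coord.support ⊆ S)
    (hy : y.coord.support ⊆ S) : segLength x y = dist (euclid S x) (euclid S y) / Real.sqrt 2 := by
  rw [sq_segLength_eq x y hx hy, Real.sqrt_div' _ (by norm_num), EuclideanSpace.dist_eq,
    ← Finset.sum_coe_sort]
  simp only [Real.dist_eq, sq_abs]
  rfl

theorem segLength_self (x : Spine n) : segLength x x = 0 := by
  simp [segLength]

theorem segLength_comm (x y : Spine n) : segLength x y = segLength y x := by
  classical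
  rw [segLength_eq_dist x y Finset.subset_union_left Finset.subset_union_right, dist_comm,
    ← segLength_eq_dist y x Finset.subset_union_right Finset.subset_union_left]

theorem segLength_triangle (x y z : Spine n) :
    segLength x z ≤ segLength x y + segLength y z := by
  classical
  let S := x.coord.support ∪ (y.coord.support ∪ z.coord.support)
  have hx : x.coord.support ⊆ S := Finset.subset_union_left
  have hy : y.coord.support ⊆ S := Finset.subset_union_left.trans Finset.subset_union_right
  have hz : z.coord.support ⊆ S := Finset.subset_union_right.trans Finset.subset_union_right
  rw [segLength_eq_dist x z hx hz, segLength_eq_dist x y hx hy, segLength_eq_dist y z hy hz,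
    ← add_div]
  gcongr
  exact dist_triangle _ _ _

/-- A single coordinate difference is at most `√2` times the length; the constant `2` avoids the
root. -/
theorem abs_sub_le_segLength (x y : Spine n) (c : Cell n) :
    |x.coord c - y.coord c| ≤ 2 * segLength x y := by
  classical
  let S := insert c (x.coord.support ∪ y.coord.support)
  have hx : x.coord.support ⊆ S := Finset.subset_union_left.trans (Finset.subset_insert _ _)
  have hy : y.coord.support ⊆ S := Finset.subset_union_right.trans (Finset.subset_insert _ _)
  have h1 : (x.coord c - y.coord c) ^ 2 ≤ ∑ c ∈ S, (x.coord c - y.coord c) ^ 2 :=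
    Finset.single_le_sum (f := fun c => (x.coord c - y.coord c) ^ 2)
      (fun c _ => sq_nonneg _) (Finset.mem_insert_self _ _)
  have h2 : segLength x y ^ 2 = (∑ c ∈ S, (x.coord c - y.coord c) ^ 2) / 2 := by
    rw [sq_segLength_eq x y hx hy, Real.sq_sqrt]
    exact div_nonneg (Finset.sum_nonneg fun c _ => sq_nonneg _) (by norm_num)
  have h3 := segLength_nonneg x y
  refine abs_le_of_sq_le_sq ?_ (by positivity)
  nlinarith

theorem eq_of_segLength_eq_zero {x y : Spine n} (h : segLength x y = 0) : x = y := by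
  ext c
  have h1 := abs_sub_le_segLength x y c
  rw [h, mul_zero] at h1
  exact sub_eq_zero.1 (abs_nonpos_iff.1 h1)

theorem InCommonSimplex.symm {x y : Spine n} (h : InCommonSimplex x y) : InCommonSimplex y x := by
  rw [InCommonSimplex, Set.union_comm]
  exact h

theorem sum_coord (x : Spine n) {S : Finset (Cell n)} (hS : x.coord.support ⊆ S) :
    ∑ c ∈ S, x.coord c = 1 := by
  rw [← x.sum_eq_one, Finsupp.sum_of_support_subset _ hS _ fun _ _ => rfl]

/-- The point with given coordinates in a simplex. -/
def ofSimplex (S : Finset (Cell n)) (hS : IsChain Cell.IsFace (S : Set (Cell n))) (a : Cell n → ℝ)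
    (h0 : ∀ c, 0 ≤ a c) (h1 : ∑ c ∈ S, a c = 1) : Spine n where
  coord := Finsupp.indicator S fun c _ => a c
  nonneg c := by
    classical
    rw [Finsupp.indicator_apply]
    split_ifs
    · exact h0 c
    · exact le_rfl
  sum_eq_one := by
    rw [Finsupp.sum_of_support_subset _ (Finsupp.support_indicator_subset _ _) _ (by simp), ← h1]
    exact Finset.sum_congr rfl fun c hc => Finsupp.indicator_of_mem hc _
  chain := hS.mono (Finset.coe_subset.2 (Finsupp.support_indicator_subset _ _))

theorem ofSimplex_coord {S : Finset (Cell n)} (hS : IsChain Cell.IsFace (S : Set (Cell n)))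
    {a : Cell n → ℝ} (h0 : ∀ c, 0 ≤ a c) (h1 : ∑ c ∈ S, a c = 1) {c : Cell n} (hc : c ∈ S) :
    (ofSimplex S hS a h0 h1).coord c = a c :=
  Finsupp.indicator_of_mem hc fun c _ => a c

theorem ofSimplex_support {S : Finset (Cell n)} (hS : IsChain Cell.IsFace (S : Set (Cell n)))
    {a : Cell n → ℝ} (h0 : ∀ c, 0 ≤ a c) (h1 : ∑ c ∈ S, a c = 1) :
    (ofSimplex S hS a h0 h1).coord.support ⊆ S := Finsupp.support_indicator_subset _ _

theorem segLength_ofSimplex {S : Finset (Cell n)} (hS : IsChain Cell.IsFace (S : Set (Cell n)))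
    {a b : Cell n → ℝ} (h0 : ∀ c, 0 ≤ a c) (h1 : ∑ c ∈ S, a c = 1) (h0' : ∀ c, 0 ≤ b c)
    (h1' : ∑ c ∈ S, b c = 1) : segLength (ofSimplex S hS a h0 h1) (ofSimplex S hS b h0' h1')
      = Real.sqrt ((∑ c ∈ S, (a c - b c) ^ 2) / 2) := by
  rw [sq_segLength_eq _ _ (ofSimplex_support hS h0 h1) (ofSimplex_support hS h0' h1')]
  congr 2
  exact Finset.sum_congr rfl fun c hc => by rw [ofSimplex_coord hS _ _ hc, ofSimplex_coord hS _ _ hc]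

/-- Points with support in a common chain lie in a common simplex. -/
theorem inCommonSimplex_of_subset {x y : Spine n} {S : Finset (Cell n)}
    (hS : IsChain Cell.IsFace (S : Set (Cell n))) (hx : x.coord.support ⊆ S)
    (hy : y.coord.support ⊆ S) : InCommonSimplex x y :=
  hS.mono (Set.union_subset (Finset.coe_subset.2 hx) (Finset.coe_subset.2 hy))

open Classical in
/-- A segment in a simplex is parametrised proportionally to arc length. -/
theorem exists_segment {x y : Spine n} (h : InCommonSimplex x y) :
    ∃ γ : I → Spine n, γ 0 = x ∧ γ 1 = y ∧ ∀ s t, InCommonSimplex (γ s) (γ t) ∧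
      segLength (γ s) (γ t) = |(s : ℝ) - t| * segLength x y := by
  let S := x.coord.support ∪ y.coord.support
  have hS : IsChain Cell.IsFace (S : Set (Cell n)) := by
    rw [Finset.coe_union]
    exact h
  have hx : x.coord.support ⊆ S := Finset.subset_union_left
  have hy : y.coord.support ⊆ S := Finset.subset_union_right
  let a (t : I) (c : Cell n) : ℝ := (1 - t) * x.coord c + t * y.coord c
  have h0 (t : I) (c : Cell n) : 0 ≤ a t c :=
    add_nonneg (mul_nonneg (sub_nonneg.2 t.2.2) (x.nonneg c)) (mul_nonneg t.2.1 (y.nonneg c))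
  have h1 (t : I) : ∑ c ∈ S, a t c = 1 := by
    rw [Finset.sum_add_distrib, ← Finset.mul_sum, ← Finset.mul_sum, sum_coord x hx, sum_coord y hy]
    ring
  have hcoord (t : I) (c : Cell n) : (ofSimplex S hS (a t) (h0 t) (h1 t)).coord c = a t c := by
    by_cases hc : c ∈ S
    · exact ofSimplex_coord hS _ _ hc
    · rw [Finsupp.notMem_support_iff.1 fun h => hc (ofSimplex_support hS _ _ h)]
      simp only [a]
      rw [Finsupp.notMem_support_iff.1 fun h => hc (hx h),
        Finsupp.notMem_support_iff.1 fun h => hc (hy h)]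
      simp
  refine ⟨fun t => ofSimplex S hS (a t) (h0 t) (h1 t), ?_, ?_, fun s t =>
    ⟨inCommonSimplex_of_subset hS (ofSimplex_support hS _ _) (ofSimplex_support hS _ _), ?_⟩⟩
  · ext c
    rw [hcoord]
    simp [a]
  · ext c
    rw [hcoord]
    simp [a]
  · rw [segLength_ofSimplex, sq_segLength_eq x y hx hy, ← Real.sqrt_sq_eq_abs,
      ← Real.sqrt_mul (sq_nonneg _), ← mul_div_assoc, Finset.mul_sum]
    congr 2
    refine Finset.sum_congr rfl fun c _ => ?_
    simp only [a]
    ring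

/-- There is a piecewise linear path of length `L` from `x` to `y`. -/
inductive PLPath : Spine n → Spine n → ℝ → Prop
  | nil (x : Spine n) : PLPath x x 0
  | cons {x y z : Spine n} {L : ℝ} (h : InCommonSimplex x y) (h' : PLPath y z L) :
      PLPath x z (segLength x y + L)

namespace PLPath

variable {x y z : Spine n} {L M : ℝ}

theorem of_inCommonSimplex (h : InCommonSimplex x y) : PLPath x y (segLength x y) := by
  have := cons h (nil y)
  rwa [add_zero] at this

theorem trans (h : PLPath x y L) (h' : PLPath y z M) : PLPath x z (L + M) := by
  induction h with
  | nil x => rwa [zero_add]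
  | cons h _ ih => rw [add_assoc]; exact cons h (ih h')

theorem symm (h : PLPath x y L) : PLPath y x L := by
  induction h with
  | nil x => exact nil x
  | cons h _ ih =>
    rw [add_comm, segLength_comm]
    exact ih.trans (of_inCommonSimplex h.symm)

/-- Although it is a distance in the spine only within a simplex, `segLength` obeys the triangle
inequality for all points. The resulting lower bound makes the path metric separate points and agree
with the Euclidean metric on simplices. -/
theorem segLength_le (h : PLPath x y L) : segLength x y ≤ L := by
  induction h with
  | nil x => exact (segLength_self x).le
  | cons h _ ih => exact (segLength_triangle _ _ _).trans (by gcongr)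

theorem nonneg (h : PLPath x y L) : 0 ≤ L := (segLength_nonneg x y).trans h.segLength_le

theorem exists_sequence (h : PLPath x y L) : ∃ (m : ℕ) (p : ℕ → Spine n),
    (p 0 = x ∧ p m = y ∧ ∀ k < m, InCommonSimplex (p k) (p (k + 1))) ∧
    ∑ k ∈ Finset.range m, ENNReal.ofReal (segLength (p k) (p (k + 1))) = ENNReal.ofReal L := by
  induction h with
  | nil x => exact ⟨0, fun _ => x, ⟨rfl, rfl, by simp⟩, by simp⟩
  | @cons x y z L h h' ih =>
    obtain ⟨m, p, ⟨h0, hm, hp⟩, hsum⟩ := ih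
    refine ⟨m + 1, fun k => Nat.casesOn k x p, ⟨rfl, hm, ?_⟩, ?_⟩
    · rintro (_ | k) hk
      · change InCommonSimplex x (p 0)
        rwa [h0]
      · exact hp k (by omega)
    · rw [Finset.sum_range_succ', ENNReal.ofReal_add (segLength_nonneg _ _) h'.nonneg, ← hsum,
        add_comm]
      change ENNReal.ofReal (segLength x (p 0)) + _ = _
      rw [h0]

end PLPath

theorem simplicialEDist_le {x y : Spine n} {L : ℝ} (h : PLPath x y L) :
    simplicialEDist x y ≤ ENNReal.ofReal L := by
  obtain ⟨m, p, hp, hsum⟩ := h.exists_sequence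
  rw [← hsum]
  exact iInf_le_of_le m (iInf_le_of_le p (iInf_le _ hp))

theorem plPath_of_sequence (m : ℕ) (p : ℕ → Spine n)
    (h : ∀ k < m, InCommonSimplex (p k) (p (k + 1))) : ∃ L, PLPath (p 0) (p m) L ∧
    ∑ k ∈ Finset.range m, ENNReal.ofReal (segLength (p k) (p (k + 1))) = ENNReal.ofReal L := by
  induction m with
  | zero => exact ⟨0, .nil _, by simp⟩
  | succ m ih =>
    obtain ⟨L, hL, hsum⟩ := ih fun k hk => h k (by omega)
    refine ⟨L + segLength (p m) (p (m + 1)), hL.trans (.of_inCommonSimplex (h m (by omega))), ?_⟩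
    rw [Finset.sum_range_succ, hsum, ENNReal.ofReal_add hL.nonneg (segLength_nonneg _ _)]

theorem exists_plPath {x y : Spine n} {r : ENNReal} (h : simplicialEDist x y < r) :
    ∃ L, PLPath x y L ∧ ENNReal.ofReal L < r := by
  simp only [simplicialEDist, iInf_lt_iff] at h
  obtain ⟨m, p, ⟨rfl, rfl, hp⟩, hlt⟩ := h
  obtain ⟨L, hL, hsum⟩ := plPath_of_sequence m p hp
  exact ⟨L, hL, hsum ▸ hlt⟩

theorem ofReal_segLength_le (x y : Spine n) :
    ENNReal.ofReal (segLength x y) ≤ simplicialEDist x y := by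
  by_contra! h
  obtain ⟨L, hL, hlt⟩ := exists_plPath h
  exact absurd (ENNReal.ofReal_le_ofReal hL.segLength_le) (not_le.2 hlt)

theorem simplicialEDist_self (x : Spine n) : simplicialEDist x x = 0 := by
  have := simplicialEDist_le (.nil x)
  rwa [ENNReal.ofReal_zero, nonpos_iff_eq_zero] at this

theorem simplicialEDist_comm (x y : Spine n) : simplicialEDist x y = simplicialEDist y x := by
  have key (x y : Spine n) : simplicialEDist x y ≤ simplicialEDist y x := by
    by_contra! h
    obtain ⟨L, hL, hlt⟩ := exists_plPath h
    exact absurd (simplicialEDist_le hL.symm) (not_le.2 hlt)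
  exact le_antisymm (key x y) (key y x)

theorem simplicialEDist_triangle (x y z : Spine n) :
    simplicialEDist x z ≤ simplicialEDist x y + simplicialEDist y z := by
  by_contra! h
  obtain ⟨a, ha, hlt⟩ := ENNReal.lt_iff_exists_add_pos_lt.1 h
  have ha' : (0 : ENNReal) < ((a / 2 : NNReal) : ENNReal) := by
    exact_mod_cast half_pos ha
  have hne := h.ne_top
  rw [ENNReal.add_ne_top] at hne
  obtain ⟨L, hL, h1⟩ := exists_plPath (ENNReal.lt_add_right hne.1 ha'.ne')
  obtain ⟨M, hM, h2⟩ := exists_plPath (ENNReal.lt_add_right hne.2 ha'.ne')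
  have h3 := simplicialEDist_le (hL.trans hM)
  rw [ENNReal.ofReal_add hL.nonneg hM.nonneg] at h3
  refine absurd (h3.trans (add_le_add h1.le h2.le)) (not_le.2 (lt_of_eq_of_lt ?_ hlt))
  rw [add_add_add_comm, ← ENNReal.coe_add, add_halves]

theorem eq_of_simplicialEDist_eq_zero {x y : Spine n} (h : simplicialEDist x y = 0) : x = y := by
  have h1 := ofReal_segLength_le x y
  rw [h, nonpos_iff_eq_zero, ENNReal.ofReal_eq_zero] at h1
  exact eq_of_segLength_eq_zero (le_antisymm h1 (segLength_nonneg x y))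

theorem smul_coord_eq (φ : (OutFree n)ᵐᵒᵖ) (x : Spine n) (c : Cell n) :
    (φ • x).coord c = x.coord (φ⁻¹ • c) := rfl

theorem mem_support_smul {φ : (OutFree n)ᵐᵒᵖ} {x : Spine n} {c : Cell n} :
    c ∈ (φ • x).coord.support ↔ φ⁻¹ • c ∈ x.coord.support := by
  rw [Finsupp.mem_support_iff, Finsupp.mem_support_iff, smul_coord_eq]

theorem support_smul_subset (φ : (OutFree n)ᵐᵒᵖ) (x : Spine n) {c : Cell n}
    (hc : c ∈ x.coord.support) : φ • c ∈ (φ • x).coord.support := by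
  rw [mem_support_smul, inv_smul_smul]
  exact hc

theorem segLength_smul (φ : (OutFree n)ᵐᵒᵖ) (x y : Spine n) :
    segLength (φ • x) (φ • y) = segLength x y := by
  have h : (φ • x).coord - (φ • y).coord
      = (x.coord - y.coord).equivMapDomain (MulAction.toPerm φ) := by
    ext c
    rfl
  rw [segLength, h, Finsupp.sum_equivMapDomain]
  rfl

theorem InCommonSimplex.smul {x y : Spine n} (h : InCommonSimplex x y) (φ : (OutFree n)ᵐᵒᵖ) :
    InCommonSimplex (φ • x) (φ • y) := by
  have hmem {c : Cell n} (hc : c ∈ ((φ • x).coord.support : Set (Cell n)) ∪ (φ • y).coord.support) :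
      φ⁻¹ • c ∈ (x.coord.support : Set (Cell n)) ∪ y.coord.support :=
    hc.imp mem_support_smul.1 mem_support_smul.1
  intro c hc c' hc' hne
  refine (h (hmem hc) (hmem hc') fun h3 => hne (smul_left_cancel _ h3)).imp (fun h3 => ?_)
    (fun h3 => ?_)
  · simpa using h3.smul φ
  · simpa using h3.smul φ

theorem PLPath.smul {x y : Spine n} {L : ℝ} (h : PLPath x y L) (φ : (OutFree n)ᵐᵒᵖ) :
    PLPath (φ • x) (φ • y) L := by
  induction h with
  | nil x => exact .nil _
  | cons h _ ih =>
    rw [← segLength_smul φ]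
    exact .cons (h.smul φ) ih

theorem simplicialEDist_smul (φ : (OutFree n)ᵐᵒᵖ) (x y : Spine n) :
    simplicialEDist (φ • x) (φ • y) = simplicialEDist x y := by
  have key (φ : (OutFree n)ᵐᵒᵖ) (x y : Spine n) :
      simplicialEDist (φ • x) (φ • y) ≤ simplicialEDist x y := by
    by_contra! h
    obtain ⟨L, hL, hlt⟩ := exists_plPath h
    exact absurd (simplicialEDist_le (hL.smul φ)) (not_le.2 hlt)
  refine le_antisymm (key φ x y) ?_
  have h := key φ⁻¹ (φ • x) (φ • y)
  rwa [inv_smul_smul, inv_smul_smul] at h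

/-- The vertex of a cell. -/
def vertex (c : Cell n) : Spine n where
  coord := Finsupp.single c 1
  nonneg d := by
    classical
    rw [Finsupp.single_apply]
    split_ifs <;> norm_num
  sum_eq_one := by simp
  chain := by
    rw [Finsupp.support_single _ one_ne_zero, Finset.coe_singleton]
    exact Set.subsingleton_singleton.isChain

theorem support_vertex (c : Cell n) : (vertex c).coord.support = {c} :=
  Finsupp.support_single _ one_ne_zero

theorem support_nonempty (x : Spine n) : x.coord.support.Nonempty := by
  rw [Finset.nonempty_iff_ne_empty]
  intro h
  have := x.sum_coord h.subset
  simp at this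

/-- Every two points of the spine are joined by a piecewise linear path. -/
theorem exists_plPath_of_two_le (hn : 2 ≤ n) (x y : Spine n) : ∃ L, PLPath x y L := by
  have h1 (x : Spine n) : ∃ c L, PLPath x (vertex c) L := by
    obtain ⟨c, hc⟩ := x.support_nonempty
    refine ⟨c, _, .of_inCommonSimplex (inCommonSimplex_of_subset x.chain subset_rfl ?_)⟩
    rw [support_vertex]
    exact Finset.singleton_subset_iff.2 hc
  -- Linked cells have vertices joined by paths along edges of the spine, and all cells are linked.
  have h2 {c c' : Cell n} (h : Cell.Linked c c') : ∃ L, PLPath (vertex c) (vertex c') L := by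
    induction h with
    | rel c c' h =>
      classical
      refine ⟨_, .of_inCommonSimplex (inCommonSimplex_of_subset (S := {c, c'}) ?_ ?_ ?_)⟩
      · rw [Finset.coe_pair]
        exact IsChain.pair h
      · rw [support_vertex]
        simp
      · rw [support_vertex]
        simp
    | refl c => exact ⟨0, .nil _⟩
    | symm _ _ _ ih => exact ⟨_, ih.choose_spec.symm⟩
    | trans _ _ _ _ _ ih ih' => exact ⟨_, ih.choose_spec.trans ih'.choose_spec⟩
  obtain ⟨c, L, hL⟩ := h1 x
  obtain ⟨c', M, hM⟩ := h1 y
  obtain ⟨N, hN⟩ := h2 (Cell.linked hn c c')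
  exact ⟨_, (hL.trans hN).trans hM.symm⟩

end Spine

end OuterSpace

end

/-! ### Compact balls, geodesics and the geometric action -/

noncomputable section

namespace OuterSpace

namespace Spine

/-! ### The metric of the spine -/

variable {n : ℕ} [hn : Fact (2 ≤ n)]

/-- The simplicial metric. -/
instance metricSpace : MetricSpace (Spine n) :=
  letI : EMetricSpace (Spine n) :=
    { edist := simplicialEDist
      edist_self := simplicialEDist_self
      edist_comm := simplicialEDist_comm
      edist_triangle := simplicialEDist_triangle
      eq_of_edist_eq_zero := eq_of_simplicialEDist_eq_zero }
  EMetricSpace.toMetricSpace fun x y => by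
    obtain ⟨L, hL⟩ := exists_plPath_of_two_le hn.out x y
    exact ne_top_of_le_ne_top ENNReal.ofReal_ne_top (simplicialEDist_le hL)

theorem edist_eq (x y : Spine n) : edist x y = simplicialEDist x y := rfl

theorem segLength_le_dist (x y : Spine n) : segLength x y ≤ dist x y := by
  have h := ofReal_segLength_le x y
  rw [← edist_eq, edist_dist] at h
  exact (ENNReal.ofReal_le_ofReal_iff dist_nonneg).1 h

theorem PLPath.dist_le {x y : Spine n} {L : ℝ} (h : PLPath x y L) : dist x y ≤ L := by
  have h1 := simplicialEDist_le h
  rw [← edist_eq, edist_dist] at h1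
  exact (ENNReal.ofReal_le_ofReal_iff h.nonneg).1 h1

theorem dist_eq_segLength {x y : Spine n} (h : InCommonSimplex x y) : dist x y = segLength x y :=
  le_antisymm (PLPath.of_inCommonSimplex h).dist_le (segLength_le_dist x y)

theorem exists_plPath_of_dist_lt {x y : Spine n} {r : ℝ} (h : dist x y < r) :
    ∃ L < r, PLPath x y L := by
  have h1 : simplicialEDist x y < ENNReal.ofReal r := by
    rw [← edist_eq, edist_dist]
    exact (ENNReal.ofReal_lt_ofReal_iff (dist_nonneg.trans_lt h)).2 h
  obtain ⟨L, hL, hlt⟩ := exists_plPath h1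
  exact ⟨L, (ENNReal.ofReal_lt_ofReal_iff (dist_nonneg.trans_lt h)).1 hlt, hL⟩

theorem isometry_smul (φ : (OutFree n)ᵐᵒᵖ) : Isometry fun x : Spine n => φ • x :=
  fun x y => simplicialEDist_smul φ x y

/-- A piecewise linear path has a parametrisation with Lipschitz constant `1`. -/
theorem PLPath.exists_lipschitz {x y : Spine n} {L : ℝ} (h : PLPath x y L) :
    ∃ γ : ℝ → Spine n, γ 0 = x ∧ γ L = y ∧
      ∀ s ∈ Set.Icc 0 L, ∀ t ∈ Set.Icc 0 L, dist (γ s) (γ t) ≤ |s - t| := by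
  induction h with
  | nil x =>
    exact ⟨fun _ => x, rfl, rfl, fun s _ t _ => by rw [dist_self]; exact abs_nonneg _⟩
  | @cons x y z L h h' ih =>
    obtain ⟨γ, h0, hL, hγ⟩ := ih
    rcases (segLength_nonneg x y).eq_or_lt with ha | ha
    · obtain rfl := eq_of_segLength_eq_zero ha.symm
      rw [← ha, zero_add]
      exact ⟨γ, h0, hL, hγ⟩
    -- The first segment has positive length `a` here, so it can be parametrised by arc length as `δ
    -- (s / a)`.
    obtain ⟨δ, hδ0, hδ1, hδ⟩ := exists_segment h
    set a := segLength x y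
    have hproj {s : ℝ} (hs : s ∈ Set.Icc 0 a) :
        (Set.projIcc (0 : ℝ) 1 zero_le_one (s / a) : ℝ) = s / a := by
      rw [Set.projIcc_of_mem zero_le_one
        (⟨div_nonneg hs.1 ha.le, (div_le_one ha).2 hs.2⟩ : s / a ∈ Set.Icc (0 : ℝ) 1)]
    have hleft {s t : ℝ} (hs : s ∈ Set.Icc 0 a) (ht : t ∈ Set.Icc 0 a) :
        dist (δ (Set.projIcc (0 : ℝ) 1 zero_le_one (s / a)))
          (δ (Set.projIcc (0 : ℝ) 1 zero_le_one (t / a))) = |s - t| := by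
      rw [dist_eq_segLength (hδ _ _).1, (hδ _ _).2, hproj hs, hproj ht, ← sub_div, abs_div,
        abs_of_pos ha, div_mul_cancel₀ _ ha.ne']
    have hend : δ (Set.projIcc (0 : ℝ) 1 zero_le_one (a / a)) = γ 0 := by
      rw [div_self ha.ne', Set.projIcc_right, h0]
      exact hδ1
    refine ⟨fun s => if s ≤ a then δ (Set.projIcc (0 : ℝ) 1 zero_le_one (s / a)) else γ (s - a),
      ?_, ?_, ?_⟩
    · beta_reduce
      rw [if_pos ha.le, zero_div, Set.projIcc_left]
      exact hδ0
    · beta_reduce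
      -- If the remaining path has length zero, the end time falls in the first branch of the
      -- definition.
      rcases h'.nonneg.eq_or_lt with h1 | h1
      · rw [← h1, add_zero, if_pos le_rfl, hend, ← hL, ← h1]
      · rw [if_neg (by linarith), add_sub_cancel_left, hL]
    · intro s hs t ht
      wlog hst : s ≤ t generalizing s t
      · rw [dist_comm, abs_sub_comm]
        exact this t ht s hs (not_le.1 hst).le
      beta_reduce
      by_cases h1 : t ≤ a
      · rw [if_pos (hst.trans h1), if_pos h1, hleft ⟨hs.1, hst.trans h1⟩ ⟨ht.1, h1⟩]
      · rw [if_neg h1]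
        have ht' : t - a ∈ Set.Icc 0 L := ⟨by linarith, by linarith [ht.2]⟩
        by_cases h2 : s ≤ a
        · rw [if_pos h2]
          refine (dist_triangle _ (γ 0) _).trans ?_
          rw [← hend, hleft ⟨hs.1, h2⟩ ⟨ha.le, le_rfl⟩, hend]
          refine (add_le_add_right (hγ 0 ⟨le_rfl, h'.nonneg⟩ _ ht') _).trans ?_
          rw [abs_of_nonpos (by linarith), abs_of_nonpos (by linarith [ht'.1]),
            abs_of_nonpos (by linarith)]
          linarith
        · rw [if_neg h2]
          refine (hγ _ ⟨by linarith, by linarith [hs.2]⟩ _ ht').trans ?_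
          rw [sub_sub_sub_cancel_right]

end Spine

/-! ### Local finiteness -/

variable {n : ℕ}

namespace Cell

/-- The cells that span a simplex with a given cell. -/
def neighbors (c : Cell n) : Set (Cell n) := {c' | c' = c ∨ IsFace c c' ∨ IsFace c' c}

theorem finite_neighbors (c : Cell n) : (neighbors c).Finite :=
  (Set.finite_singleton c).union ((finite_cofaces c).union (finite_faces c))

theorem smul_mem_neighbors {c c' : Cell n} (h : c' ∈ neighbors c) (φ : (OutFree n)ᵐᵒᵖ) :
    φ • c' ∈ neighbors (φ • c) := by
  rcases h with rfl | h | h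
  · exact Or.inl rfl
  · exact Or.inr (Or.inl (h.smul φ))
  · exact Or.inr (Or.inr (h.smul φ))

theorem ncard_neighbors_le_smul (c : Cell n) (φ : (OutFree n)ᵐᵒᵖ) :
    (neighbors c).ncard ≤ (neighbors (φ • c)).ncard :=
  Set.ncard_le_ncard_of_injOn (φ • ·) (fun _ h => smul_mem_neighbors h φ)
    (MulAction.injective φ).injOn (finite_neighbors _)

end Cell

namespace Spine

open Cell

theorem support_subset_neighbors {x : Spine n} {c : Cell n} (hc : c ∈ x.coord.support) :
    (x.coord.support : Set (Cell n)) ⊆ neighbors c := by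
  intro c' hc'
  by_cases h : c' = c
  · exact Or.inl h
  · rcases x.chain hc' hc h with h1 | h1
    · exact Or.inr (Or.inr h1)
    · exact Or.inr (Or.inl h1)

variable [hn : Fact (2 ≤ n)]

-- A support consists of neighbours of any one of its cells. The number of neighbours does not
-- decrease under translation, so the finitely many orbit representatives bound it.
include hn in
theorem exists_card_support_le : ∃ N : ℕ, 0 < N ∧ ∀ x : Spine n, x.coord.support.card ≤ N := by
  obtain ⟨T, hT, hφ⟩ := exists_finite_representatives hn.out
  refine ⟨(∑ c ∈ hT.toFinset, (neighbors c).ncard) + 1, by omega, fun x => ?_⟩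
  obtain ⟨c, hc⟩ := x.support_nonempty
  obtain ⟨φ, h⟩ := hφ c
  have h1 : x.coord.support.card ≤ (neighbors c).ncard := by
    rw [← Set.ncard_coe_finset]
    exact Set.ncard_le_ncard (support_subset_neighbors hc) (finite_neighbors c)
  have h2 : (neighbors (φ • c)).ncard ≤ ∑ c ∈ hT.toFinset, (neighbors c).ncard :=
    Finset.single_le_sum (f := fun c => (neighbors c).ncard) (fun _ _ => Nat.zero_le _)
      (hT.mem_toFinset.2 h)
  have h3 := ncard_neighbors_le_smul c φ
  omega

/-- Points that are near to each other have a cell in common. -/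
theorem exists_common_cell : ∃ r > 0, ∀ x y : Spine n, dist x y < r →
    ∃ c ∈ x.coord.support, c ∈ y.coord.support := by
  obtain ⟨N, hN, hcard⟩ := exists_card_support_le (n := n)
  have hN' : (0 : ℝ) < N := by exact_mod_cast hN
  -- Coordinates sum to 1, so some coordinate of `x` is at least `1 / N`. If `y` vanished there, the
  -- distance would be at least `1 / (2 * N)`.
  refine ⟨1 / (2 * N), by positivity, fun x y hxy => ?_⟩
  have hpos : (0 : ℝ) < x.coord.support.card := by
    exact_mod_cast Finset.card_pos.2 x.support_nonempty
  obtain ⟨c, hc, hle⟩ := Finset.exists_le_of_sum_le (f := fun _ => 1 / (x.coord.support.card : ℝ))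
    (g := fun c => x.coord c) x.support_nonempty (by
      rw [sum_coord x subset_rfl, Finset.sum_const, nsmul_eq_mul, mul_one_div_cancel hpos.ne'])
  refine ⟨c, hc, ?_⟩
  rw [Finsupp.mem_support_iff]
  intro h0
  have h1 := abs_sub_le_segLength x y c
  rw [h0, sub_zero, abs_of_nonneg (x.nonneg c)] at h1
  have h2 := segLength_le_dist x y
  have h3 : 1 / (N : ℝ) ≤ 1 / (x.coord.support.card : ℝ) :=
    one_div_le_one_div_of_le hpos (by exact_mod_cast hcard x)
  have h4 : 2 * (1 / (2 * (N : ℝ))) = 1 / N := by field_simp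
  linarith

/-- Only finitely many cells are involved in a ball. -/
theorem exists_finite_cells (x : Spine n) (R : ℝ) : ∃ F : Set (Cell n), F.Finite ∧
    ∀ y, dist x y ≤ R → (y.coord.support : Set (Cell n)) ⊆ F := by
  obtain ⟨r, hr, hcell⟩ := exists_common_cell (n := n)
  have step (F : Set (Cell n)) (hF : F.Finite) : (⋃ c ∈ F, neighbors c).Finite :=
    hF.biUnion fun c _ => finite_neighbors c
  have near {z y : Spine n} {F : Set (Cell n)} (hz : (z.coord.support : Set (Cell n)) ⊆ F)
      (h : dist z y < r) : (y.coord.support : Set (Cell n)) ⊆ ⋃ c ∈ F, neighbors c := by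
    obtain ⟨c, hc, hc'⟩ := hcell z y h
    exact (support_subset_neighbors hc').trans (Set.subset_biUnion_of_mem (hz hc))
  have key (k : ℕ) : ∃ F : Set (Cell n), F.Finite ∧
      ∀ y, dist x y < (k + 1) * r → (y.coord.support : Set (Cell n)) ⊆ F := by
    induction k with
    | zero =>
      refine ⟨_, step _ x.coord.support.finite_toSet, fun y hy => near subset_rfl ?_⟩
      simpa using hy
    | succ k ih =>
      obtain ⟨F, hF, hsub⟩ := ih
      refine ⟨_, step F hF, fun y hy => ?_⟩
      -- A path shorter than `(k + 2) * r` is cut after the fraction `(k + 1) / (k + 2)`. The cut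
      -- point is closer than `(k + 1) * r` to `x` and closer than `r` to `y`.
      obtain ⟨L, hL, hpath⟩ := exists_plPath_of_dist_lt hy
      obtain ⟨γ, h0, h1, hγ⟩ := hpath.exists_lipschitz
      have hL0 := hpath.nonneg
      push_cast at hL
      have hk : (0 : ℝ) < k + 2 := by positivity
      have hk' : L / (k + 2) < r := by
        rw [div_lt_iff₀ hk]
        linarith
      have hk'' : L / (k + 2) * (k + 2) = L := div_mul_cancel₀ _ hk.ne'
      have hk0 : 0 ≤ L / (k + 2) := by positivity
      set a := L / (k + 2)
      have hs : (k + 1) * a ∈ Set.Icc 0 L := ⟨by positivity, by linarith⟩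
      have h2 := hγ 0 ⟨le_rfl, hL0⟩ _ hs
      have h3 := hγ _ hs L ⟨hL0, le_rfl⟩
      rw [h0, zero_sub, abs_neg, abs_of_nonneg hs.1] at h2
      rw [h1, abs_of_nonpos (by linarith [hs.2])] at h3
      refine near (hsub (γ ((k + 1) * a)) (h2.trans_lt ?_)) (h3.trans_lt ?_)
      · gcongr
      · linarith
  obtain ⟨k, hk⟩ := exists_nat_gt (R / r)
  obtain ⟨F, hF, hsub⟩ := key k
  refine ⟨F, hF, fun y hy => hsub y (hy.trans_lt ?_)⟩
  rw [div_lt_iff₀ hr] at hk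
  linarith

/-- Closed simplices are compact. -/
theorem isCompact_simplex {S : Finset (Cell n)} (hS : IsChain IsFace (S : Set (Cell n))) :
    IsCompact {y : Spine n | y.coord.support ⊆ S} := by
  classical
  have : CompactSpace (stdSimplex ℝ S) := isCompact_iff_compactSpace.1 (isCompact_stdSimplex ℝ S)
  let a (p : stdSimplex ℝ S) (c : Cell n) : ℝ := if h : c ∈ S then p.1 ⟨c, h⟩ else 0
  have h0 (p : stdSimplex ℝ S) (c : Cell n) : 0 ≤ a p c := by
    simp only [a]
    split_ifs
    · exact p.2.1 _
    · exact le_rfl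
  have h1 (p : stdSimplex ℝ S) : ∑ c ∈ S, a p c = 1 := by
    rw [← p.2.2, ← Finset.sum_coe_sort]
    exact Finset.sum_congr rfl fun c _ => dif_pos c.2
  let f (p : stdSimplex ℝ S) : Spine n := ofSimplex S hS (a p) (h0 p) (h1 p)
  have hf : Continuous f := by
    refine continuous_iff_continuousAt.2 fun q => tendsto_iff_dist_tendsto_zero.2 ?_
    have h2 (p : stdSimplex ℝ S) :
        dist (f p) (f q) = Real.sqrt ((∑ c ∈ S, (a p c - a q c) ^ 2) / 2) := by
      rw [dist_eq_segLength (inCommonSimplex_of_subset hS (ofSimplex_support hS _ _)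
        (ofSimplex_support hS _ _))]
      exact segLength_ofSimplex hS _ _ _ _
    have h3 : Continuous fun p => Real.sqrt ((∑ c ∈ S, (a p c - a q c) ^ 2) / 2) := by
      have ha (c : Cell n) : Continuous fun p => a p c := by
        by_cases h : c ∈ S
        · simp only [a, dif_pos h]
          exact (continuous_apply _).comp continuous_subtype_val
        · simp only [a, dif_neg h]
          exact continuous_const
      fun_prop
    have h4 := h3.tendsto q
    simp only [sub_self, ne_eq, OfNat.ofNat_ne_zero, not_false_eq_true, zero_pow,
      Finset.sum_const_zero, zero_div, Real.sqrt_zero] at h4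
    simpa only [h2] using h4
  have h2 : {y : Spine n | y.coord.support ⊆ S} = Set.range f := by
    ext y
    constructor
    · intro hy
      refine ⟨⟨fun c => y.coord c, fun c => y.nonneg c, ?_⟩, ?_⟩
      · rw [Finset.sum_coe_sort S (fun c => y.coord c), sum_coord y hy]
      · ext c
        by_cases hc : c ∈ S
        · exact (ofSimplex_coord hS _ _ hc).trans (dif_pos hc)
        · rw [Finsupp.notMem_support_iff.1 fun h => hc (hy h),
            Finsupp.notMem_support_iff.1 fun h => hc (ofSimplex_support hS _ _ h)]
    · rintro ⟨p, rfl⟩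
      exact ofSimplex_support hS _ _
  rw [h2]
  exact isCompact_range hf

theorem isCompact_of_finite {F : Set (Cell n)} (hF : F.Finite) :
    IsCompact {y : Spine n | (y.coord.support : Set (Cell n)) ⊆ F} := by
  have h : {y : Spine n | (y.coord.support : Set (Cell n)) ⊆ F}
      = ⋃ S ∈ {S : Finset (Cell n) | S ⊆ hF.toFinset ∧ IsChain IsFace (S : Set (Cell n))},
        {y : Spine n | y.coord.support ⊆ S} := by
    ext y
    simp only [Set.mem_ofPred_eq, Set.mem_iUnion, exists_prop]
    constructor
    · intro h
      exact ⟨_, ⟨fun c hc => hF.mem_toFinset.2 (h hc), y.chain⟩, subset_rfl⟩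
    · rintro ⟨S, ⟨hS, -⟩, hy⟩ c hc
      exact hF.mem_toFinset.1 (hS (hy hc))
  rw [h]
  refine Set.Finite.isCompact_biUnion ?_ fun S hS => isCompact_simplex hS.2
  exact (hF.toFinset.powerset.finite_toSet).subset fun S hS => Finset.mem_powerset.2 hS.1

/-- Closed balls of the spine are compact. -/
instance properSpace : ProperSpace (Spine n) where
  isCompact_closedBall x R := by
    obtain ⟨F, hF, hsub⟩ := exists_finite_cells x R
    refine (isCompact_of_finite hF).of_isClosed_subset Metric.isClosed_closedBall fun y hy => ?_
    exact hsub y (by rw [dist_comm]; exact hy)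

/-- Every two points of the spine are joined by a geodesic. -/
theorem isGeodesicSpace : IsGeodesicSpace (Spine n) := by
  intro x y
  set d := dist x y with hd
  rcases (dist_nonneg : 0 ≤ dist x y).eq_or_lt with h | hpos
  · obtain rfl := dist_eq_zero.1 h.symm
    refine ⟨fun _ => x, rfl, rfl, fun s hs t ht => ?_⟩
    rw [hd, ← h] at hs ht
    rw [le_antisymm hs.2 hs.1, le_antisymm ht.2 ht.1]
    simp
  rw [← hd] at hpos
  -- Almost geodesics form decreasing sets that are closed for pointwise convergence, inside a
  -- product of compact balls. A common point is a path with Lipschitz constant 1. The radius `2 *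
  -- d` suffices since the constants are at most 2.
  let K (k : ℕ) : Set (ℝ → Spine n) := {γ | (∀ s, γ s ∈ Metric.closedBall x (2 * d)) ∧ γ 0 = x ∧
    γ d = y ∧ ∀ s ∈ Set.Icc 0 d, ∀ t ∈ Set.Icc 0 d, dist (γ s) (γ t) ≤ (1 + 1 / (k + 1)) * |s - t|}
  have hclosed (k : ℕ) : IsClosed (K k) := by
    have h1 : K k = (⋂ s, {γ | γ s ∈ Metric.closedBall x (2 * d)}) ∩ ({γ | γ 0 = x} ∩ ({γ | γ d = y} ∩
        ⋂ s ∈ Set.Icc 0 d, ⋂ t ∈ Set.Icc 0 d,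
          {γ | dist (γ s) (γ t) ≤ (1 + 1 / (k + 1)) * |s - t|})) := by
      ext γ
      simp only [K, Set.mem_ofPred_eq, Set.mem_inter_iff, Set.mem_iInter]
    rw [h1]
    refine (isClosed_iInter fun s => Metric.isClosed_closedBall.preimage (continuous_apply s)).inter
      ((isClosed_eq (continuous_apply _) continuous_const).inter
      ((isClosed_eq (continuous_apply _) continuous_const).inter ?_))
    exact isClosed_biInter fun s _ => isClosed_biInter fun t _ => isClosed_le
      ((continuous_apply s).dist (continuous_apply t)) continuous_const
  have hne (k : ℕ) : (K k).Nonempty := by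
    have hk : (0 : ℝ) < 1 / (k + 1) := by positivity
    have hk1 : 1 / ((k : ℝ) + 1) ≤ 1 := by
      rw [div_le_one (by positivity)]
      have : (0 : ℝ) ≤ k := k.cast_nonneg
      linarith
    obtain ⟨L, hL, hpath⟩ := exists_plPath_of_dist_lt (x := x) (y := y)
      (r := (1 + 1 / (k + 1)) * d) (by rw [← hd]; nlinarith)
    obtain ⟨γ, h0, h1, hγ⟩ := hpath.exists_lipschitz
    have hL0 := hpath.nonneg
    have hmem {s : ℝ} (hs : s ∈ Set.Icc 0 d) : s * (L / d) ∈ Set.Icc 0 L := by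
      refine ⟨mul_nonneg hs.1 (by positivity), ?_⟩
      calc s * (L / d) ≤ d * (L / d) := by gcongr; exact hs.2
        _ = L := mul_div_cancel₀ _ hpos.ne'
    have hLd : L / d ≤ 1 + 1 / (k + 1) := by
      rw [div_le_iff₀ hpos]
      exact hL.le
    classical
    have hlip {s t : ℝ} (hs : s ∈ Set.Icc 0 d) (ht : t ∈ Set.Icc 0 d) :
        dist (γ (s * (L / d))) (γ (t * (L / d))) ≤ (1 + 1 / (k + 1)) * |s - t| := by
      refine (hγ _ (hmem hs) _ (hmem ht)).trans ?_
      rw [← sub_mul, abs_mul, abs_of_nonneg (by positivity : 0 ≤ L / d), mul_comm]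
      gcongr
    -- Outside the interval the value is set to `x`, only to keep the map in the product of balls.
    refine ⟨fun s => if s ∈ Set.Icc 0 d then γ (s * (L / d)) else x, fun s => ?_, ?_, ?_,
      fun s hs t ht => ?_⟩
    · beta_reduce
      split_ifs with hs
      · rw [Metric.mem_closedBall]
        have h2 := hlip hs ⟨le_rfl, hpos.le⟩
        rw [zero_mul, h0, sub_zero, abs_of_nonneg hs.1] at h2
        refine h2.trans ?_
        have := hs.1
        have := hs.2
        nlinarith
      · rw [Metric.mem_closedBall, dist_self]
        positivity
    · beta_reduce
      rw [if_pos ⟨le_rfl, hpos.le⟩, zero_mul, h0]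
    · beta_reduce
      rw [if_pos ⟨hpos.le, le_rfl⟩, mul_div_cancel₀ _ hpos.ne', h1]
    · beta_reduce
      rw [if_pos hs, if_pos ht]
      exact hlip hs ht
  have hcomp : IsCompact (K 0) := by
    refine (isCompact_univ_pi fun _ : ℝ => isCompact_closedBall x (2 * d)).of_isClosed_subset
      (hclosed 0) fun γ hγ => ?_
    simpa only [Set.mem_univ_pi] using hγ.1
  have hmono (k : ℕ) : K (k + 1) ⊆ K k := by
    rintro γ ⟨h1, h2, h3, h4⟩
    refine ⟨h1, h2, h3, fun s hs t ht => (h4 s hs t ht).trans ?_⟩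
    push_cast
    gcongr
    linarith
  obtain ⟨γ, hγ⟩ := IsCompact.nonempty_iInter_of_sequence_nonempty_isCompact_isClosed K hmono hne
    hcomp hclosed
  rw [Set.mem_iInter] at hγ
  have hlip {s t : ℝ} (hs : s ∈ Set.Icc 0 d) (ht : t ∈ Set.Icc 0 d) :
      dist (γ s) (γ t) ≤ |s - t| := by
    have h1 : Filter.Tendsto (fun k : ℕ => (1 + 1 / ((k : ℝ) + 1)) * |s - t|) Filter.atTop
        (nhds ((1 + 0) * |s - t|)) :=
      (tendsto_one_div_add_atTop_nhds_zero_nat.const_add 1).mul_const _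
    rw [add_zero, one_mul] at h1
    exact ge_of_tendsto' h1 fun k => (hγ k).2.2.2 s hs t ht
  refine ⟨γ, (hγ 0).2.1, (hγ 0).2.2.1, fun s hs t ht => ?_⟩
  wlog hst : s ≤ t generalizing s t
  · rw [dist_comm, abs_sub_comm]
    exact this t ht s hs (not_le.1 hst).le
  refine le_antisymm (hlip hs ht) ?_
  have h1 := hlip ⟨le_rfl, hpos.le⟩ hs
  have h2 := hlip ht ⟨hpos.le, le_rfl⟩
  -- A strict shortening between times `s` and `t` would make the distance of `x` and `y` less than
  -- `d`.
  have h3 := dist_triangle4 x (γ s) (γ t) y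
  rw [(hγ 0).2.1, zero_sub, abs_neg, abs_of_nonneg hs.1] at h1
  rw [(hγ 0).2.2.1, abs_of_nonpos (by linarith [ht.2])] at h2
  rw [abs_of_nonpos (by linarith)]
  linarith

theorem exists_finite_cells_of_isCompact {A : Set (Spine n)} (hA : IsCompact A) :
    ∃ F : Set (Cell n), F.Finite ∧ ∀ y ∈ A, (y.coord.support : Set (Cell n)) ⊆ F := by
  rcases A.eq_empty_or_nonempty with rfl | ⟨x, hx⟩
  · exact ⟨∅, Set.finite_empty, by simp⟩
  · obtain ⟨R, hR⟩ := hA.isBounded.subset_closedBall x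
    obtain ⟨F, hF, hsub⟩ := exists_finite_cells x R
    exact ⟨F, hF, fun y hy => hsub y (by rw [dist_comm]; exact hR hy)⟩

/-- The action on the spine is geometric. -/
theorem isGeometricAction : IsGeometricAction (OutFree n)ᵐᵒᵖ (Spine n) where
  isometry := isometry_smul
  properSpace := properSpace
  geodesic := isGeodesicSpace
  proper A B hA hB := by
    obtain ⟨F, hF, hFA⟩ := exists_finite_cells_of_isCompact hA
    obtain ⟨F', hF', hFB⟩ := exists_finite_cells_of_isCompact hB
    -- An element that makes the compact sets meet takes one of finitely many cells to one of
    -- finitely many cells.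
    refine (hF.biUnion fun c _ => hF'.biUnion fun c' _ => finite_transporter hn.out c c').subset ?_
    rintro φ ⟨_, ⟨x, hx, rfl⟩, hB⟩
    obtain ⟨c, hc⟩ := x.support_nonempty
    simp only [Set.mem_iUnion, exists_prop]
    exact ⟨c, hFA x hx hc, φ • c, hFB _ hB (support_smul_subset φ x hc), rfl⟩
  cocompact := by
    obtain ⟨T, hT, hφ⟩ := exists_finite_representatives hn.out
    -- The compact set consists of the points supported in the neighbours of the orbit
    -- representatives; every point has a translate whose support contains a representative.
    refine ⟨_, isCompact_of_finite (hT.biUnion fun c _ => finite_neighbors c),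
      Set.eq_univ_of_forall fun x => ?_⟩
    obtain ⟨c, hc⟩ := x.support_nonempty
    obtain ⟨φ, h⟩ := hφ c
    refine Set.mem_iUnion.2 ⟨φ⁻¹, φ • x, ?_, inv_smul_smul φ x⟩
    exact (support_subset_neighbors (support_smul_subset φ x hc)).trans
      (Set.subset_biUnion_of_mem h)

end Spine

end OuterSpace

end

theorem mainTheorem4 (n : ℕ) (hn : 2 ≤ n) :
    (∃ d : MetricSpace (OuterSpace.Spine n),
      (∀ x y : OuterSpace.Spine n, edist x y = OuterSpace.Spine.simplicialEDist x y) ∧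
      OuterSpace.IsGeometricAction (OuterSpace.OutFree n)ᵐᵒᵖ (OuterSpace.Spine n)) ∧
    Group.FG (OuterSpace.OutFree n) := by
  have : Fact (2 ≤ n) := ⟨hn⟩
  exact ⟨⟨OuterSpace.Spine.metricSpace, fun _ _ => rfl, OuterSpace.Spine.isGeometricAction⟩,
    OuterSpace.fg_outFree⟩
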